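/- Conventions. A computable structure is a first-order structure in a computable language (relation and function symbols) whose universe is a computable subset of $\omega$ and whose relations and functions are uniformly computable; an index of it is an index of a partial computable function computing all this data, and $\mathcal M_i$ is the structure with index $i$ (if there is one). A degree is the Turing degree of a subset of $\omega$. $\Sigma_0=\Pi_0$ formulas are the finitary quantifier-free formulas; for an ordinal $\beta>0$ a $\Sigma_\beta$ (respectively $\Pi_\beta$) formula of $L_{\omega_1\omega}$ is a countable disjunction of formulas $\exists\bar u\,\psi$ with $\psi$ in $\Pi_\gamma$ for some $\gamma<\beta$ (respectively a countable conjunction of formulas $\forall\bar u\,\psi$ with $\psi$ in $\Sigma_\gamma$ for some $\gamma<\beta$). A $\Sigma_\beta$-elementary embedding $h:\mathcal A\to\mathcal B$ is an embedding such that $\mathcal A\models\varphi(\bar a)\iff\mathcal B\models\varphi(h(\bar a))$ for all $\Sigma_\beta$ formulas $\varphi$ and all tuples $\bar a$. An ordinal is computable if it is the order type of a computable well-order of a computable subset of $\omega$; an index of it is an index of such a well-order; $\omega_1^{CK}$ is the least non-computable ordinal. A degree $\mathbf d$ is high for isomorphism if for all computable structures $\mathcal A\cong\mathcal B$, $\mathbf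 d$ computes an isomorphism from $\mathcal A$ to $\mathcal B$. It is $\alpha$-collegiate if for every $\beta\le\alpha$ and all computable structures $\mathcal A,\mathcal B$ such that there is a $\Sigma_\beta$-elementary embedding of $\mathcal A$ into $\mathcal B$, $\mathbf d$ computes such an embedding. It is computably collegiate if it is $\alpha$-collegiate for every computable ordinal $\alpha$. Uniform versions. $\mathbf d$ is uniformly high for isomorphism if there are $D\in\mathbf d$ and a total computable $f$ such that $\{f(i,j)\}^D$ is an isomorphism from $\mathcal M_i$ to $\mathcal M_j$ whenever $\mathcal M_i\cong\mathcal M_j$ are computable structures. $\mathbf d$ is uniformly $\alpha$-collegiate if there are $D\in\mathbf d$ and a total computable $f$ such that for every index $b$ of an ordinal $\beta\le\alpha$ and all computable structures $\mathcal M_i,\mathcal M_j$ for which there is a $\Sigma_\beta$-elementary embedding of $\mathcal M_i$ into $\mathcal M_j$, $\{f(b,i,j)\}^D$ is such an embedding. $\mathbf d$ is uniformly computably collegiate if one pair $D,f$ has this property for all computable ordinals $\beta$. $\mathbf d$ is levelwise uniformly $\alpha$-collegiate if for each $\beta\le\alpha$ there are $D\in\mathbf d$ and a total computable $f$ such that $\{f(i,j)\}^D$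 is a $\Sigma_\beta$-elementary embedding of $\mathcal M_i$ into $\mathcal M_j$ whenever $\mathcal M_i,\mathcal M_j$ are computable structures for which there is one. Theorem. (a) Let $\alpha$ be a computable ordinal and $\mathbf d$ a degree. The following are equivalent: (1) $\mathbf d$ is $\alpha$-collegiate; (2) $\mathbf d$ is computably collegiate; (3) $\mathbf d$ is high for isomorphism. (b) The same holds for the uniform versions: for $\alpha$ and $\mathbf d$ as in (a), the following are equivalent: $\mathbf d$ is uniformly $\alpha$-collegiate; $\mathbf d$ is levelwise uniformly $\alpha$-collegiate; $\mathbf d$ is uniformly computably collegiate; $\mathbf d$ is uniformly $\gamma$-collegiate for every computable ordinal $\gamma$; $\mathbf d$ is levelwise uniformly $\gamma$-collegiate for every computable ordinal $\gamma$; $\mathbf d$ is uniformly high for isomorphism. (c) Let $\mathcal A,\mathcal B$ be computable structures in the same language with $\mathcal A\equiv_{\omega_1^{CK}}\mathcal B$, i.e. $\mathcal A\le_{\omega_1^{CK}}\mathcal B$ and $\mathcal B\le_{\omega_1^{CK}}\mathcal A$, where $\le_\delta$ ($\delta\ge 1$) are the standard back-and-forth relations: $(\mathcal A,\bar a)\le_1(\mathcal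 B,\bar b)$ if all $\Pi_1$ formulas true of $\bar a$ in $\mathcal A$ are true of $\bar b$ in $\mathcal B$, and for $\delta>1$, $(\mathcal A,\bar a)\le_\delta(\mathcal B,\bar b)$ if for all $1\le\gamma<\delta$ and every finite tuple $\bar d$ in $\mathcal B$ there is a tuple $\bar c$ in $\mathcal A$ with $(\mathcal B,\bar b,\bar d)\le_\gamma(\mathcal A,\bar a,\bar c)$. Then $\mathcal A\cong\mathcal B$. -/

import Mathlib

open FirstOrder

noncomputable section

namespace Collegiate

/-! ### Oracle computations and Turing degrees -/

/-- Programs for oracle computations: the constructors are those of `Nat.RecursiveIn` with a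
single oracle. -/
inductive OCode : Type
  | zero : OCode
  | succ : OCode
  | left : OCode
  | right : OCode
  | oracle : OCode
  | pair : OCode → OCode → OCode
  | comp : OCode → OCode → OCode
  | prec : OCode → OCode → OCode
  | rfind : OCode → OCode

namespace OCode

/-- The partial function computed by a program with oracle `g`. -/
def eval (g : ℕ →. ℕ) : OCode → ℕ →. ℕ
  | zero => fun _ => Part.some 0
  | succ => fun n => Part.some (n + 1)
  | left => fun n => Part.some n.unpair.1
  | right => fun n => Part.some n.unpair.2
  | oracle => g
  | pair cf ch => fun n => Nat.pair <$> eval g cf n <*> eval g ch n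
  | comp cf ch => fun n => eval g ch n >>= eval g cf
  | prec cf ch => fun p =>
      let (a, n) := Nat.unpair p
      n.rec (eval g cf a) fun y IH => do
        let i ← IH
        eval g ch (Nat.pair a (Nat.pair y i))
  | rfind cf => fun a => Nat.rfind fun n => (fun m => m = 0) <$> eval g cf (Nat.pair a n)

/-- The numbering of the programs. -/
def encodeOCode : OCode → ℕ
  | zero => 0
  | succ => 1
  | left => 2
  | right => 3
  | oracle => 4
  | pair cf ch => 2 * (2 * Nat.pair (encodeOCode cf) (encodeOCode ch)) + 5
  | comp cf ch => 2 * (2 * Nat.pair (encodeOCode cf) (encodeOCode ch) + 1) + 5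
  | prec cf ch => (2 * (2 * Nat.pair (encodeOCode cf) (encodeOCode ch)) + 1) + 5
  | rfind cf => (2 * (2 * encodeOCode cf + 1) + 1) + 5

/-- The program with a given number. -/
def ofNatOCode : ℕ → OCode
  | 0 => zero
  | 1 => succ
  | 2 => left
  | 3 => right
  | 4 => oracle
  | n + 5 =>
    let m := n.div2.div2
    have hm : m < n + 5 := by
      simp only [m, Nat.div2_val]
      lia
    have _m1 : m.unpair.1 < n + 5 := lt_of_le_of_lt m.unpair_left_le hm
    have _m2 : m.unpair.2 < n + 5 := lt_of_le_of_lt m.unpair_right_le hm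
    match n.bodd, n.div2.bodd with
    | false, false => pair (ofNatOCode m.unpair.1) (ofNatOCode m.unpair.2)
    | false, true => comp (ofNatOCode m.unpair.1) (ofNatOCode m.unpair.2)
    | true, false => prec (ofNatOCode m.unpair.1) (ofNatOCode m.unpair.2)
    | true, true => rfind (ofNatOCode m)
termination_by n => n
decreasing_by all_goals assumption

theorem ofNat_encodeOCode (c : OCode) : ofNatOCode (encodeOCode c) = c := by
  induction c <;> simp [encodeOCode, ofNatOCode, Nat.div2_val, *]

theorem encode_ofNatOCode : ∀ n, encodeOCode (ofNatOCode n) = n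
  | 0 => by simp [ofNatOCode, encodeOCode]
  | 1 => by simp [ofNatOCode, encodeOCode]
  | 2 => by simp [ofNatOCode, encodeOCode]
  | 3 => by simp [ofNatOCode, encodeOCode]
  | 4 => by simp [ofNatOCode, encodeOCode]
  | n + 5 => by
    let m := n.div2.div2
    have hm : m < n + 5 := by
      simp only [m, Nat.div2_val]
      lia
    have _m1 : m.unpair.1 < n + 5 := lt_of_le_of_lt m.unpair_left_le hm
    have _m2 : m.unpair.2 < n + 5 := lt_of_le_of_lt m.unpair_right_le hm
    have IH := encode_ofNatOCode m
    have IH1 := encode_ofNatOCode m.unpair.1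
    have IH2 := encode_ofNatOCode m.unpair.2
    conv_rhs => rw [← Nat.bit_bodd_div2 n, ← Nat.bit_bodd_div2 n.div2]
    simp only [ofNatOCode.eq_6]
    cases n.bodd <;> cases n.div2.bodd <;>
      simp [m, encodeOCode, IH, IH1, IH2, Nat.bit_val]
termination_by n => n
decreasing_by all_goals assumption

instance instDenumerable : Denumerable OCode :=
  Denumerable.mk' ⟨encodeOCode, ofNatOCode, ofNat_encodeOCode, encode_ofNatOCode⟩

/-- The programs compute exactly the partial functions that are recursive in the oracle. -/
theorem exists_eval_iff {g f : ℕ →. ℕ} : (∃ c : OCode, c.eval g = f) ↔ RecursiveIn {g} f := by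
  rw [RecursiveIn.iff_nat]
  constructor
  · rintro ⟨c, rfl⟩
    induction c with
    | zero => exact .zero
    | succ => exact .succ
    | left => exact .left
    | right => exact .right
    | oracle => exact .oracle g rfl
    | pair _ _ h₁ h₂ => exact .pair h₁ h₂
    | comp _ _ h₁ h₂ => exact .comp h₁ h₂
    | prec _ _ h₁ h₂ => exact .prec h₁ h₂
    | rfind _ h => exact .rfind h
  · intro h
    induction h with
    | zero => exact ⟨zero, rfl⟩
    | succ => exact ⟨succ, rfl⟩
    | left => exact ⟨left, rfl⟩
    | right => exact ⟨right, rfl⟩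
    | oracle h hh => exact ⟨oracle, (Set.mem_singleton_iff.1 hh).symm⟩
    | pair _ _ h₁ h₂ =>
      obtain ⟨c₁, rfl⟩ := h₁
      obtain ⟨c₂, rfl⟩ := h₂
      exact ⟨pair c₁ c₂, rfl⟩
    | comp _ _ h₁ h₂ =>
      obtain ⟨c₁, rfl⟩ := h₁
      obtain ⟨c₂, rfl⟩ := h₂
      exact ⟨comp c₁ c₂, rfl⟩
    | prec _ _ h₁ h₂ =>
      obtain ⟨c₁, rfl⟩ := h₁
      obtain ⟨c₂, rfl⟩ := h₂
      exact ⟨prec c₁ c₂, rfl⟩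
    | rfind _ h =>
      obtain ⟨c, rfl⟩ := h
      exact ⟨rfind c, rfl⟩

end OCode

open Classical in
/-- The characteristic function of a set of natural numbers, as an oracle. -/
def charFun (D : Set ℕ) : ℕ →. ℕ := fun n => Part.some (if n ∈ D then 1 else 0)

/-- The Turing degree of a set of natural numbers. -/
def degreeOf (D : Set ℕ) : TuringDegree := toAntisymmetrization TuringReducible (charFun D)

/-- `{e}^D`: the partial function computed by the `e`-th program with oracle `D`. -/
def oracleEval (e : ℕ) (D : Set ℕ) : ℕ →. ℕ := (Denumerable.ofNat OCode e).eval (charFun D)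

/-- The `e`-th partial computable function (without oracle). -/
def phi (e : ℕ) : ℕ →. ℕ := (Denumerable.ofNat Nat.Partrec.Code e).eval

/-! ### Computable ordinals -/

open Classical in
/-- `b` is an index of a computable well-order, on a computable set `S` of natural numbers, of
order type `β`. -/
def CodesOrdinal (b : ℕ) (β : Ordinal.{0}) : Prop :=
  ∃ (S : Set ℕ) (r : S → S → Prop) (_ : IsWellOrder S r), Ordinal.type r = β ∧
    (∀ x : ℕ, phi b (Nat.pair 0 x) = Part.some (if x ∈ S then 1 else 0)) ∧
    ∀ x y : S, phi b (Nat.pair 1 (Nat.pair x y)) = Part.some (if r x y then 1 else 0)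

/-- Computable ordinals. -/
def IsComputableOrdinal (β : Ordinal.{0}) : Prop := ∃ b, CodesOrdinal b β

/-- The Church-Kleene ordinal, the least ordinal that is not computable. -/
def omegaOneCK : Ordinal.{0} := sInf {β | ¬ IsComputableOrdinal β}

/-! ### Computable structures -/

/-- A language whose symbols are natural numbers: `rel k = some n` says that `k` is a relation
symbol of arity `n`, and `rel k = none` that `k` is not a relation symbol; likewise `fn` for
function symbols (constants are function symbols of arity `0`). -/
structure Signature where
  rel : ℕ → Option ℕ
  fn : ℕ → Option ℕ

/-- The first-order language given by a signature. -/
def Signature.lang (S : Signature) : FirstOrder.Language.{0, 0} where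
  Functions n := {k : ℕ // S.fn k = some n}
  Relations n := {k : ℕ // S.rel k = some n}

/-- A structure whose universe is a set of natural numbers. -/
structure NatStructure (S : Signature) where
  carrier : Set ℕ
  str : S.lang.Structure carrier

instance (S : Signature) : CoeSort (NatStructure S) Type := ⟨fun A => A.carrier⟩

instance (S : Signature) (A : NatStructure S) : S.lang.Structure A := A.str

open Classical in
/-- `e` is an index of the structure `A`, that is, `A` is the `e`-th computable structure:
the `e`-th partial computable function decides the universe, computes the language
(which numbers are symbols, and their arities), and computes all relations and functions of `A`
uniformly in the symbol. -/
def IsIndex {S : Signature} (e : ℕ) (A : NatStructure S) : Prop :=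
  (∀ x : ℕ, phi e (Nat.pair 0 x) = Part.some (if x ∈ A.carrier then 1 else 0)) ∧
  (∀ k : ℕ, phi e (Nat.pair 1 k) = Part.some (Encodable.encode (S.rel k))) ∧
  (∀ k : ℕ, phi e (Nat.pair 2 k) = Part.some (Encodable.encode (S.fn k))) ∧
  (∀ (n : ℕ) (R : S.lang.Relations n) (v : Fin n → A),
    phi e (Nat.pair 3 (Nat.pair R.1 (Encodable.encode (List.ofFn fun i => (v i : ℕ))))) =
      Part.some (if FirstOrder.Language.Structure.RelMap R v then 1 else 0)) ∧
  (∀ (n : ℕ) (F : S.lang.Functions n) (v : Fin n → A),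
    phi e (Nat.pair 4 (Nat.pair F.1 (Encodable.encode (List.ofFn fun i => (v i : ℕ))))) =
      Part.some (FirstOrder.Language.Structure.funMap F v : A).1)

/-- Computable structures. -/
def IsComputableStructure {S : Signature} (A : NatStructure S) : Prop := ∃ e, IsIndex e A

/-! ### Infinitary formulas -/

/-- Infinitary formulas in normal form, with free variables among `n` variables: finitary
quantifier-free formulas, countable disjunctions of formulas `∃ u, ψ`, and countable conjunctions
of formulas `∀ u, ψ`, where `u` is a finite (possibly empty) tuple of variables. -/
inductive InfFormula (L : FirstOrder.Language.{0, 0}) : ℕ → Type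
  | qf {n : ℕ} (φ : L.Formula (Fin n)) (h : φ.IsQF) : InfFormula L n
  | iSupEx {n : ℕ} (k : ℕ → ℕ) (ψ : ∀ i : ℕ, InfFormula L (n + k i)) : InfFormula L n
  | iInfAll {n : ℕ} (k : ℕ → ℕ) (ψ : ∀ i : ℕ, InfFormula L (n + k i)) : InfFormula L n

namespace InfFormula

variable {L : FirstOrder.Language.{0, 0}}

/-- Truth of an infinitary formula in a structure. -/
def Realize {M : Type} [L.Structure M] : {n : ℕ} → InfFormula L n → (Fin n → M) → Prop
  | _, qf φ _, v => φ.Realize v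
  | _, iSupEx k ψ, v => ∃ i, ∃ u : Fin (k i) → M, (ψ i).Realize (Fin.append v u)
  | _, iInfAll k ψ, v => ∀ i, ∀ u : Fin (k i) → M, (ψ i).Realize (Fin.append v u)

mutual

/-- `Σ_α` formulas: `Σ_0` is finitary quantifier-free; for `α > 0`, a `Σ_α` formula is a countable
disjunction of formulas `∃ u, ψ` with `ψ` a `Π_β` formula for some `β < α`. -/
def IsSigma : {n : ℕ} → InfFormula L n → Ordinal.{0} → Prop
  | _, qf _ _, α => α = 0
  | _, iSupEx _ ψ, α => ∀ i, ∃ β < α, (ψ i).IsPi β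
  | _, iInfAll _ _, _ => False

/-- `Π_α` formulas: `Π_0` is finitary quantifier-free; for `α > 0`, a `Π_α` formula is a countable
conjunction of formulas `∀ u, ψ` with `ψ` a `Σ_β` formula for some `β < α`. -/
def IsPi : {n : ℕ} → InfFormula L n → Ordinal.{0} → Prop
  | _, qf _ _, α => α = 0
  | _, iSupEx _ _, _ => False
  | _, iInfAll _ ψ, α => ∀ i, ∃ β < α, (ψ i).IsSigma β

end

end InfFormula

/-- `f` is a `Σ_β`-elementary embedding. -/
def IsSigmaElementary {L : FirstOrder.Language.{0, 0}} {M N : Type} [L.Structure M] [L.Structure N]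
    (β : Ordinal.{0}) (f : M ↪[L] N) : Prop :=
  ∀ (n : ℕ) (φ : InfFormula L n), φ.IsSigma β →
    ∀ v : Fin n → M, φ.Realize v ↔ φ.Realize (f ∘ v)

/-! ### Back-and-forth relations -/

/-- The standard back-and-forth relations `(M, a) ≤_α (N, b)`, for `α ≥ 1`: `(M, a) ≤_1 (N, b)` if
all `Π_1` formulas true of `a` in `M` are true of `b` in `N`; for `α > 1`, `(M, a) ≤_α (N, b)` if
for all `1 ≤ β < α` and every finite tuple `d` in `N` there is a tuple `c` in `M` with
`(N, b, d) ≤_β (M, a, c)`. (At `α = 0`, which is not used, it refers to `Π_0` formulas.) -/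
def BackForthLE (L : FirstOrder.Language.{0, 0}) (α : Ordinal.{0}) (M N : Type) [L.Structure M]
    [L.Structure N] {n : ℕ} (a : Fin n → M) (b : Fin n → N) : Prop :=
  (α ≤ 1 → ∀ φ : InfFormula L n, φ.IsPi α → φ.Realize a → φ.Realize b) ∧
  (1 < α → ∀ (β : Ordinal.{0}) (_ : 1 ≤ β) (_ : β < α) (m : ℕ) (d : Fin m → N),
    ∃ c : Fin m → M, BackForthLE L β N M (Fin.append b d) (Fin.append a c))
termination_by α

/-- `M ≡_α N`. -/
def BackForthEquiv (L : FirstOrder.Language.{0, 0}) (α : Ordinal.{0}) (M N : Type) [L.Structure M]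
    [L.Structure N] : Prop :=
  BackForthLE L α M N (Fin.elim0 : Fin 0 → M) (Fin.elim0 : Fin 0 → N) ∧
  BackForthLE L α N M (Fin.elim0 : Fin 0 → N) (Fin.elim0 : Fin 0 → M)

/-! ### Highness notions -/

/-- The partial function `g` on the natural numbers agrees on `A` with `h : A → B`. -/
def Extends {S : Signature} {A B : NatStructure S} (g : ℕ →. ℕ) (h : A → B) : Prop :=
  ∀ x : A, g x.1 = Part.some (h x).1

/-- The degree `d` computes the function `h : A → B`. -/
def Computes {S : Signature} {A B : NatStructure S} (d : TuringDegree) (h : A → B) : Prop :=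
  ∃ D : Set ℕ, degreeOf D = d ∧ ∃ g : ℕ →. ℕ, TuringReducible g (charFun D) ∧ Extends g h

/-- `d` is high for isomorphism. -/
def HighForIsomorphism (d : TuringDegree) : Prop :=
  ∀ (S : Signature) (A B : NatStructure S), IsComputableStructure A → IsComputableStructure B →
    Nonempty (A ≃[S.lang] B) → ∃ h : A ≃[S.lang] B, Computes d h

/-- `d` is `α`-collegiate. -/
def IsCollegiate (α : Ordinal.{0}) (d : TuringDegree) : Prop :=
  ∀ β ≤ α, ∀ (S : Signature) (A B : NatStructure S),
    IsComputableStructure A → IsComputableStructure B →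
    (∃ h : A ↪[S.lang] B, IsSigmaElementary β h) →
    ∃ h : A ↪[S.lang] B, IsSigmaElementary β h ∧ Computes d h

/-- `d` is computably collegiate. -/
def IsComputablyCollegiate (d : TuringDegree) : Prop :=
  ∀ α, IsComputableOrdinal α → IsCollegiate α d

/-- `d` is uniformly high for isomorphism. -/
def UniformlyHighForIsomorphism (d : TuringDegree) : Prop :=
  ∃ D : Set ℕ, degreeOf D = d ∧ ∃ f : ℕ → ℕ → ℕ, Computable₂ f ∧
    ∀ (S : Signature) (A B : NatStructure S) (i j : ℕ), IsIndex i A → IsIndex j B →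
      Nonempty (A ≃[S.lang] B) →
      ∃ h : A ≃[S.lang] B, Extends (oracleEval (f i j) D) h

/-- `f i j` is, from indices `i`, `j` of computable structures `A`, `B`, an index relative to `D` of
a `Σ_β`-elementary embedding of `A` into `B` if there is one. -/
def FindsElementary (D : Set ℕ) (β : Ordinal.{0}) (f : ℕ → ℕ → ℕ) : Prop :=
  ∀ (S : Signature) (A B : NatStructure S) (i j : ℕ), IsIndex i A → IsIndex j B →
    (∃ h : A ↪[S.lang] B, IsSigmaElementary β h) →
    ∃ h : A ↪[S.lang] B, IsSigmaElementary β h ∧ Extends (oracleEval (f i j) D) h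

/-- `d` is uniformly `α`-collegiate: one procedure handles all pairs of computable structures and
all `β ≤ α`, where `β` is given by an index of a computable well-order. -/
def UniformlyCollegiate (α : Ordinal.{0}) (d : TuringDegree) : Prop :=
  ∃ D : Set ℕ, degreeOf D = d ∧ ∃ f : ℕ → ℕ → ℕ → ℕ,
    Computable (fun p : ℕ × ℕ × ℕ => f p.1 p.2.1 p.2.2) ∧
    ∀ β ≤ α, ∀ b, CodesOrdinal b β → FindsElementary D β (f b)

/-- `d` is uniformly computably collegiate: one procedure handles all pairs of computable structures
and all computable ordinals `β`. -/
def UniformlyComputablyCollegiate (d : TuringDegree) : Prop :=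
  ∃ D : Set ℕ, degreeOf D = d ∧ ∃ f : ℕ → ℕ → ℕ → ℕ,
    Computable (fun p : ℕ × ℕ × ℕ => f p.1 p.2.1 p.2.2) ∧
    ∀ β, ∀ b, CodesOrdinal b β → FindsElementary D β (f b)

/-- The weaker form of uniformity, in the structures only: for each `β ≤ α` separately there is a
procedure that handles all pairs of computable structures. -/
def LevelwiseUniformlyCollegiate (α : Ordinal.{0}) (d : TuringDegree) : Prop :=
  ∀ β ≤ α, ∃ D : Set ℕ, degreeOf D = d ∧ ∃ f : ℕ → ℕ → ℕ,
    Computable₂ f ∧ FindsElementary D β f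

end Collegiate

end

-- Every highness notion here is equivalent to a single one: computing a member of each nonempty
-- class of functions that avoids a computably listed family of finite conditions, that is, of each
-- nonempty Π⁰₁ class of Baire space (`ComputesPaths`, and `UniformlyComputesPaths` for the uniform
-- notions).
--
-- From isomorphisms or embeddings to paths. A tree is coded by two structures whose elements are
-- finite sets of nodes of one level. They carry the projection to parents modulo 2 and differ only
-- in whether the even or the odd sets are distinguished. Adding the nodes of a path modulo 2 is an
-- isomorphism between them (`nonempty_treeStr_equiv`). Conversely, any embedding sends the empty
-- sets of the levels to sets `X n` such that `X 0` is odd and a node lies in `X n` exactly when it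
-- has an odd number of children in `X (n + 1)`. From the root on, one can therefore always step to
-- a child in the next set (`avoids_chosenPath`). Embeddings suffice for this, so only `β = 0` is
-- needed of a collegiate degree.
--
-- From paths to embeddings. A Σ_β-elementary embedding is one that preserves Π_β formulas in both
-- directions (`isSigmaElementary_iff_piLE`), and preservation of Π_γ formulas is a game in which
-- the ordinal descends with every move (`PiLE.exists_response`, `piLE_of_responses`). Being a
-- winning position is a complicated property, but being a strategy is not. A function `F` codes the
-- embedding together with responses to all moves, and its nonzero values say which positions it
-- claims to win. Each defect of such an `F` shows in finitely many values at a finite stage, so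
-- these functions form a Π⁰₁ class, uniformly in the indices (`exists_avoids_elementary`).
-- Quantifier-free formulas are replaced by finitely many tests (`exists_qf_determined`), and each
-- move announces how many tests the response must pass. Claims are correct by induction on the
-- ordinal (`piLE_of_claims`), and all correct positions can be claimed at once
-- (`exists_goodResponses`). Isomorphisms need only images and preimages.
--
-- Part (c). By the recursion theorem there is a class consisting of the strategies that claim the
-- empty position and play along the Kleene-Brouwer order of the tree of this very class. If the
-- class were empty, that order would be a well-order of computable type, and the back-and-forth
-- hypothesis would supply a member. So the tree has a path, whose initial segments descend forever
-- in the order. The strategy can then be played for infinitely many rounds and builds an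
-- isomorphism (`nonempty_equiv_of_claims`).

noncomputable section

namespace Collegiate

open FirstOrder.Language

-- Infinitary formulas: negation and normal forms

namespace InfFormula

variable {L : FirstOrder.Language.{0, 0}} {M N : Type} [L.Structure M] [L.Structure N]

/-- The negation of an infinitary formula, in normal form. -/
def neg : {n : ℕ} → InfFormula L n → InfFormula L n
  | _, qf φ h => qf φ.not h.not
  | _, iSupEx k ψ => iInfAll k fun i => (ψ i).neg
  | _, iInfAll k ψ => iSupEx k fun i => (ψ i).neg

theorem realize_neg {n : ℕ} (φ : InfFormula L n) (v : Fin n → M) :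
    φ.neg.Realize v ↔ ¬ φ.Realize v := by
  induction φ with
  | qf φ h => simp [neg, Realize]
  | iSupEx k ψ ih => simp [neg, Realize, ih]
  | iInfAll k ψ ih => simp [neg, Realize, ih]

theorem isSigma_neg_and_isPi_neg {n : ℕ} (φ : InfFormula L n) (α : Ordinal.{0}) :
    (φ.IsPi α → φ.neg.IsSigma α) ∧ (φ.IsSigma α → φ.neg.IsPi α) := by
  induction φ generalizing α with
  | qf φ h => simp [neg, IsSigma, IsPi]
  | iSupEx k ψ ih =>
    refine ⟨fun h => by simp [IsPi] at h, fun h => ?_⟩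
    simp only [IsSigma, neg, IsPi] at h ⊢
    exact fun i => (h i).imp fun β hβ => ⟨hβ.1, (ih i β).1 hβ.2⟩
  | iInfAll k ψ ih =>
    refine ⟨fun h => ?_, fun h => by simp [IsSigma] at h⟩
    simp only [IsSigma, neg, IsPi] at h ⊢
    exact fun i => (h i).imp fun β hβ => ⟨hβ.1, (ih i β).2 hβ.2⟩

theorem IsPi.neg {n : ℕ} {φ : InfFormula L n} {α : Ordinal.{0}} (h : φ.IsPi α) :
    φ.neg.IsSigma α := (isSigma_neg_and_isPi_neg φ α).1 h

theorem IsSigma.neg {n : ℕ} {φ : InfFormula L n} {α : Ordinal.{0}} (h : φ.IsSigma α) :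
    φ.neg.IsPi α := (isSigma_neg_and_isPi_neg φ α).2 h

theorem IsSigma.exists_qf {n : ℕ} {φ : InfFormula L n} (h : φ.IsSigma 0) :
    ∃ (θ : L.Formula (Fin n)) (hθ : θ.IsQF), φ = qf θ hθ := by
  cases φ with
  | qf θ hθ => exact ⟨θ, hθ, rfl⟩
  | iSupEx k ψ =>
    obtain ⟨β, hβ, -⟩ := (show ∀ i, ∃ β < 0, (ψ i).IsPi β by simpa only [IsSigma] using h) 0
    exact absurd hβ not_lt_zero
  | iInfAll k ψ => simp [IsSigma] at h

theorem IsPi.exists_qf {n : ℕ} {φ : InfFormula L n} (h : φ.IsPi 0) :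
    ∃ (θ : L.Formula (Fin n)) (hθ : θ.IsQF), φ = qf θ hθ := by
  cases φ with
  | qf θ hθ => exact ⟨θ, hθ, rfl⟩
  | iSupEx k ψ => simp [IsPi] at h
  | iInfAll k ψ =>
    obtain ⟨β, hβ, -⟩ := (show ∀ i, ∃ β < 0, (ψ i).IsSigma β by simpa only [IsPi] using h) 0
    exact absurd hβ not_lt_zero

theorem IsSigma.exists_iSupEx {n : ℕ} {φ : InfFormula L n} {α : Ordinal.{0}} (h : φ.IsSigma α)
    (hα : α ≠ 0) : ∃ (k : ℕ → ℕ) (ψ : ∀ i, InfFormula L (n + k i)), φ = iSupEx k ψ ∧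
      ∀ i, ∃ β < α, (ψ i).IsPi β := by
  cases φ with
  | qf θ hθ => exact absurd (by simpa only [IsSigma] using h) hα
  | iSupEx k ψ => exact ⟨k, ψ, rfl, by simpa only [IsSigma] using h⟩
  | iInfAll k ψ => simp [IsSigma] at h

theorem IsPi.exists_iInfAll {n : ℕ} {φ : InfFormula L n} {α : Ordinal.{0}} (h : φ.IsPi α)
    (hα : α ≠ 0) : ∃ (k : ℕ → ℕ) (ψ : ∀ i, InfFormula L (n + k i)), φ = iInfAll k ψ ∧
      ∀ i, ∃ β < α, (ψ i).IsSigma β := by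
  cases φ with
  | qf θ hθ => exact absurd (by simpa only [IsPi] using h) hα
  | iSupEx k ψ => simp [IsPi] at h
  | iInfAll k ψ => exact ⟨k, ψ, rfl, by simpa only [IsPi] using h⟩

/-- For `α ≠ 0`, the `Σ_α` formulas are closed under countable disjunctions. -/
theorem exists_isSigma_iSup {n : ℕ} {α : Ordinal.{0}} (hα : α ≠ 0) (φ : ℕ → InfFormula L n)
    (h : ∀ i, (φ i).IsSigma α) : ∃ Φ : InfFormula L n, Φ.IsSigma α ∧
      (∀ v : Fin n → M, Φ.Realize v ↔ ∃ i, (φ i).Realize v) ∧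
      (∀ v : Fin n → N, Φ.Realize v ↔ ∃ i, (φ i).Realize v) := by
  choose k ψ hφ hψ using fun i => (h i).exists_iSupEx hα
  have key : ∀ {M : Type} [L.Structure M] (v : Fin n → M),
      (iSupEx (fun i => k i.unpair.1 i.unpair.2) fun i => ψ i.unpair.1 i.unpair.2).Realize v ↔
        ∃ i, (φ i).Realize v := by
    intro M _ v
    simp only [hφ, Realize]
    constructor
    · rintro ⟨i, u, hu⟩
      exact ⟨_, _, u, hu⟩
    · rintro ⟨i, j, u, hu⟩
      refine ⟨Nat.pair i j, ?_⟩
      rw [Nat.unpair_pair]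
      exact ⟨u, hu⟩
  refine ⟨_, ?_, key, key⟩
  simp only [IsSigma]
  exact fun i => hψ _ _

end InfFormula

-- Preservation of Π_γ formulas as a back-and-forth property

section PiLE

variable {L : FirstOrder.Language.{0, 0}} {M N : Type} [L.Structure M] [L.Structure N]

/-- All `Π_γ` formulas true of `a` in `M` are true of `b` in `N`. -/
def PiLE (L : FirstOrder.Language.{0, 0}) {M N : Type} [L.Structure M] [L.Structure N]
    (γ : Ordinal.{0}) {n : ℕ} (a : Fin n → M) (b : Fin n → N) : Prop :=
  ∀ φ : InfFormula L n, φ.IsPi γ → φ.Realize a → φ.Realize b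

theorem append_fin_zero {n : ℕ} {α : Type*} (v : Fin n → α) (u : Fin 0 → α) :
    (Fin.append v u : Fin (n + 0) → α) = v := by
  funext i
  exact Fin.append_left v u i

/-- The levels are cumulative by definition, except that a quantifier-free formula is not literally
Π_γ for `γ > 0`. It becomes so as a constant conjunction quantifying over the empty tuple. -/
theorem PiLE.mono {γ δ : Ordinal.{0}} {n : ℕ} {a : Fin n → M} {b : Fin n → N}
    (h : PiLE L γ a b) (hδ : δ ≤ γ) : PiLE L δ a b := by
  intro φ hφ ha
  rcases eq_or_ne δ 0 with rfl | hδ0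
  · rcases eq_or_ne γ 0 with rfl | hγ
    · exact h φ hφ ha
    · obtain ⟨θ, hθ, rfl⟩ := hφ.exists_qf
      have := h (.iInfAll (fun _ => 0) fun _ => .qf (n := n + 0) θ hθ)
        (by simpa only [InfFormula.IsPi] using fun _ => ⟨0, pos_iff_ne_zero.2 hγ, by
          simp [InfFormula.IsSigma]⟩)
        (by
          simp only [InfFormula.Realize]
          intro _ u
          rw [append_fin_zero]
          exact ha)
      simp only [InfFormula.Realize] at this
      have := this 0 Fin.elim0
      rw [append_fin_zero] at this
      exact this
  · obtain ⟨k, ψ, rfl, hψ⟩ := hφ.exists_iInfAll hδ0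
    refine h _ ?_ ha
    simp only [InfFormula.IsPi]
    exact fun i => (hψ i).imp fun β hβ => ⟨hβ.1.trans_le hδ, hβ.2⟩

theorem PiLE.realize_qf {γ : Ordinal.{0}} {n : ℕ} {a : Fin n → M} {b : Fin n → N}
    (h : PiLE L γ a b) {θ : L.Formula (Fin n)} (hθ : θ.IsQF) : θ.Realize a ↔ θ.Realize b := by
  have key : ∀ {θ : L.Formula (Fin n)}, θ.IsQF → θ.Realize a → θ.Realize b := fun {θ} hθ ha =>
    h.mono (zero_le (a := γ)) (.qf θ hθ) (by simp [InfFormula.IsPi]) ha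
  refine ⟨key hθ, fun hb => by_contra fun ha => ?_⟩
  exact (key hθ.not (by simpa using ha) : ¬ _) hb

/-- A tuple on the right has a response on the left. -/
theorem PiLE.exists_response [Countable M] {γ δ : Ordinal.{0}} {n : ℕ} {a : Fin n → M}
    {b : Fin n → N} (h : PiLE L γ a b) (hδ : δ < γ) (hδ0 : δ ≠ 0) {m : ℕ} (d : Fin m → N) :
    ∃ c : Fin m → M, PiLE L δ (Fin.append b d) (Fin.append a c) := by
  by_contra hc
  simp only [PiLE, not_exists, not_forall] at hc
  choose ψ hψ hψd hψc using hc
  -- Each tuple of `M` that is not a response fails some Π_δ formula true of `d`. The countable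
  -- disjunction `Φ` of the negations holds of every tuple of `M` but not of `d`, so the Π_γ formula
  -- `∀ u, Φ` distinguishes `a` from `b`.
  obtain ⟨Φ, hΦ, hΦM, hΦN⟩ : ∃ Φ : InfFormula L (n + m), Φ.IsSigma δ ∧
      (∀ c, Φ.Realize (Fin.append a c)) ∧ ¬ Φ.Realize (Fin.append b d) := by
    rcases isEmpty_or_nonempty (Fin m → M) with he | he
    -- Disjunctions are indexed by all of `ℕ`, so the empty one is a disjunction of falsities.
    · refine ⟨.iSupEx (fun _ => 0) fun _ => .qf ⊥ BoundedFormula.isQF_bot, ?_, he.elim, ?_⟩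
      · simpa only [InfFormula.IsSigma] using fun _ => ⟨0, pos_iff_ne_zero.2 hδ0, by
          simp [InfFormula.IsPi]⟩
      · simp [InfFormula.Realize]
    · obtain ⟨g, hg⟩ := exists_surjective_nat (Fin m → M)
      obtain ⟨Φ, hΦ, hM, hN⟩ := InfFormula.exists_isSigma_iSup (M := M) (N := N) hδ0
        (fun i => (ψ (g i)).neg) fun i => (hψ (g i)).neg
      refine ⟨Φ, hΦ, fun c => ?_, fun hd => ?_⟩
      · obtain ⟨i, rfl⟩ := hg c
        exact (hM _).2 ⟨i, (InfFormula.realize_neg _ _).2 (hψc _ )⟩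
      · obtain ⟨i, hi⟩ := (hN _).1 hd
        exact (InfFormula.realize_neg _ _).1 hi (hψd _)
  have := h (.iInfAll (fun _ => m) fun _ => Φ) (by
    simp only [InfFormula.IsPi]
    exact fun _ => ⟨δ, hδ, hΦ⟩) (by
    simp only [InfFormula.Realize]
    exact fun _ => hΦM)
  simp only [InfFormula.Realize] at this
  exact hΦN (this 0 d)

/-- The substitute for responses at ordinal 0. Quantifier-free formulas are not closed under
infinite disjunctions, so the response can be made to satisfy only one prescribed formula. -/
theorem PiLE.exists_response_qf {γ : Ordinal.{0}} {n : ℕ} {a : Fin n → M}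
    {b : Fin n → N} (h : PiLE L γ a b) (hγ : γ ≠ 0) {m : ℕ} (d : Fin m → N)
    {θ : L.Formula (Fin (n + m))} (hθ : θ.IsQF) (hd : θ.Realize (Fin.append b d)) :
    ∃ c : Fin m → M, θ.Realize (Fin.append a c) := by
  by_contra hc
  simp only [not_exists] at hc
  have := h (.iInfAll (fun _ => m) fun _ => .qf θ.not hθ.not) (by
    simp only [InfFormula.IsPi]
    exact fun _ => ⟨0, pos_iff_ne_zero.2 hγ, by simp [InfFormula.IsSigma]⟩) (by
    simp only [InfFormula.Realize]
    exact fun _ c => by simpa using hc c)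
  simp only [InfFormula.Realize] at this
  exact (this 0 d : ¬ _) hd

/-- If a Π_γ formula fails at `b`, some conjunct fails at a tuple `u`. The response to `u` satisfies
the negation of that conjunct, so the formula fails at `a` as well. -/
theorem piLE_of_responses {γ : Ordinal.{0}} {n : ℕ} {a : Fin n → M} {b : Fin n → N} (hγ : γ ≠ 0)
    (h0 : ∀ (m : ℕ) (d : Fin m → N) (θ : L.Formula (Fin (n + m))), θ.IsQF →
      θ.Realize (Fin.append b d) → ∃ c : Fin m → M, θ.Realize (Fin.append a c))
    (h1 : ∀ δ < γ, δ ≠ 0 → ∀ (m : ℕ) (d : Fin m → N),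
      ∃ c : Fin m → M, PiLE L δ (Fin.append b d) (Fin.append a c)) : PiLE L γ a b := by
  intro φ hφ ha
  obtain ⟨k, ψ, rfl, hψ⟩ := hφ.exists_iInfAll hγ
  simp only [InfFormula.Realize] at ha ⊢
  intro i u
  by_contra hu
  obtain ⟨δ, hδ, hs⟩ := hψ i
  rcases eq_or_ne δ 0 with rfl | hδ0
  · obtain ⟨θ, hθ, hi⟩ := hs.exists_qf
    simp only [hi, InfFormula.Realize] at hu
    obtain ⟨c, hc⟩ := h0 _ u θ.not hθ.not (by simpa using hu)
    have := ha i c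
    simp only [hi, InfFormula.Realize] at this
    exact (hc : ¬ _) this
  · obtain ⟨c, hc⟩ := h1 δ hδ hδ0 _ u
    exact (InfFormula.realize_neg _ _).1 (hc _ hs.neg ((InfFormula.realize_neg _ _).2 hu)) (ha i c)

theorem BackForthLE.piLE {α : Ordinal.{0}} (hα : α ≠ 0) :
    ∀ {M N : Type} [L.Structure M] [L.Structure N] {n : ℕ} {a : Fin n → M} {b : Fin n → N},
      BackForthLE L α M N a b → PiLE L α a b := by
  induction α using WellFoundedLT.induction with
  | ind α ih =>
    intro M N _ _ n a b h
    rw [BackForthLE] at h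
    rcases le_or_gt α 1 with h1 | h1
    · exact h.1 h1
    · have key : ∀ δ < α, δ ≠ 0 → ∀ (m : ℕ) (d : Fin m → N),
          ∃ c : Fin m → M, PiLE L δ (Fin.append b d) (Fin.append a c) := by
        intro δ hδ hδ0 m d
        obtain ⟨c, hc⟩ := h.2 h1 δ (Order.one_le_iff_ne_zero.2 hδ0) hδ m d
        exact ⟨c, ih δ hδ hδ0 hc⟩
      refine piLE_of_responses hα (fun m d θ hθ hd => ?_) key
      -- The recursion stops at 1, and a response at level 1 already preserves quantifier-free
      -- formulas.
      obtain ⟨c, hc⟩ := key 1 h1 one_ne_zero m d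
      exact ⟨c, (hc.realize_qf hθ).1 hd⟩

theorem isSigmaElementary_zero (f : M ↪[L] N) : IsSigmaElementary 0 f := by
  intro n φ hφ v
  obtain ⟨θ, hθ, rfl⟩ := hφ.exists_qf
  simp only [InfFormula.Realize]
  have := BoundedFormula.IsQF.realize_embedding hθ f (v := v) (xs := default)
  rw [Formula.Realize, Formula.Realize, ← this]
  congr!

/-- Negation exchanges Σ_β and Π_β. The two one-sided relations on the right are what positions of
the game express, one for each side. -/
theorem isSigmaElementary_iff_piLE {β : Ordinal.{0}} (f : M ↪[L] N) :
    IsSigmaElementary β f ↔ ∀ (n : ℕ) (v : Fin n → M),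
      PiLE L β v (f ∘ v) ∧ PiLE L β (f ∘ v) v := by
  constructor
  · intro h n v
    refine ⟨fun φ hφ hv => ?_, fun φ hφ hv => ?_⟩
    · by_contra hc
      rw [← InfFormula.realize_neg, ← h n _ hφ.neg v, InfFormula.realize_neg] at hc
      exact hc hv
    · by_contra hc
      rw [← InfFormula.realize_neg, h n _ hφ.neg v, InfFormula.realize_neg] at hc
      exact hc hv
  · intro h n φ hφ v
    rw [← not_iff_not, ← InfFormula.realize_neg, ← InfFormula.realize_neg]
    exact ⟨(h n v).1 _ hφ.neg, (h n v).2 _ hφ.neg⟩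

end PiLE

end Collegiate

end

-- Finite tests on lists of elements

noncomputable section

namespace Collegiate

open FirstOrder.Language

/-- A test on a list of elements of a structure: `(0, k, w, _)` asks whether the entries `k` and
`w` are equal, `(1, k, _, l)` whether the relation symbol `k` holds of the entries listed in `l`,
and `(_, k, w, l)` whether the function symbol `k` maps the entries listed in `l` to the entry
`w`. -/
abbrev Test : Type := ℕ × ℕ × ℕ × List ℕ

/-- The entries of `u` at the positions listed in `l`. -/
def select {M : Type*} (u : List M) (l : List ℕ) : List M := l.filterMap (u[·]?)

theorem select_map {M M' : Type*} (f : M → M') (u : List M) (l : List ℕ) :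
    select (u.map f) l = (select u l).map f := by
  simp [select, List.map_filterMap]

theorem select_ofFn {M : Type*} {u : List M} {k : ℕ} {j : Fin k → ℕ} {v : Fin k → M}
    (h : ∀ i, u[j i]? = some (v i)) : select u (List.ofFn j) = List.ofFn v := by
  induction k with
  | zero => simp [select]
  | succ k ih =>
    have := ih (j := fun i => j i.succ) (v := fun i => v i.succ) fun i => h _
    simp only [select] at this
    simp [List.ofFn_succ, select, h, this]

theorem length_select_eq_iff {M : Type*} {u : List M} {l : List ℕ} :
    (select u l).length = l.length ↔ ∀ i ∈ l, i < u.length := by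
  simp [select, List.filterMap_length_eq_length]

variable {S : Signature} {M M' : Type} [S.lang.Structure M] [S.lang.Structure M']

/-- The relation symbol with a given number. -/
def Signature.relSym {k n : ℕ} (h : S.rel k = some n) : S.lang.Relations n := ⟨k, h⟩

/-- The function symbol with a given number. -/
def Signature.fnSym {k n : ℕ} (h : S.fn k = some n) : S.lang.Functions n := ⟨k, h⟩

/-- The relation symbol `k` holds of the list `r`. -/
def RelHolds (S : Signature) {M : Type} [S.lang.Structure M] (k : ℕ) (r : List M) : Prop :=
  ∃ h : S.rel k = some r.length, Structure.RelMap (Signature.relSym h) r.get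

/-- The value of the function symbol `k` at the list `r` is `p`. -/
def FnValue (S : Signature) {M : Type} [S.lang.Structure M] (k : ℕ) (r : List M) (p : M) : Prop :=
  ∃ h : S.fn k = some r.length,
    Structure.funMap (Signature.fnSym h) r.get = p

theorem relHolds_iff_of_length {n : ℕ} (R : S.lang.Relations n) (r : List M) (hr : r.length = n) :
    RelHolds S R.1 r ↔ Structure.RelMap R fun i => r.get (i.cast hr.symm) := by
  subst hr
  exact ⟨fun ⟨_, h⟩ => h, fun h => ⟨R.2, h⟩⟩

theorem fnValue_iff_of_length {n : ℕ} (F : S.lang.Functions n) (r : List M) (hr : r.length = n)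
    (p : M) :
    FnValue S F.1 r p ↔ Structure.funMap F (fun i => r.get (i.cast hr.symm)) = p := by
  subst hr
  exact ⟨fun ⟨_, h⟩ => h, fun h => ⟨F.2, h⟩⟩

theorem relHolds_ofFn {n : ℕ} (R : S.lang.Relations n) (v : Fin n → M) :
    RelHolds S R.1 (List.ofFn v) ↔ Structure.RelMap R v := by
  rw [relHolds_iff_of_length R _ List.length_ofFn]
  simp

theorem fnValue_ofFn {n : ℕ} (F : S.lang.Functions n) (v : Fin n → M) (p : M) :
    FnValue S F.1 (List.ofFn v) p ↔ Structure.funMap F v = p := by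
  rw [fnValue_iff_of_length F _ List.length_ofFn]
  simp

/-- The test `t` succeeds on the list `u`. -/
def Holds (S : Signature) {M : Type} [S.lang.Structure M] (u : List M) : Test → Prop
  | (0, k, w, _) => u[k]? = u[w]?
  | (1, k, _, l) => (∀ i ∈ l, i < u.length) ∧ RelHolds S k (select u l)
  | (_ + 2, k, w, l) =>
    (∀ i ∈ l, i < u.length) ∧ ∃ p, u[w]? = some p ∧ FnValue S k (select u l) p

/-- The tests with code less than `N` have the same results on both lists. -/
def Agree (S : Signature) {M M' : Type} [S.lang.Structure M] [S.lang.Structure M'] (N : ℕ)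
    (u : List M) (u' : List M') : Prop :=
  ∀ t : Test, Encodable.encode t < N → (Holds S u t ↔ Holds S u' t)

theorem Agree.mono {N N' : ℕ} {u : List M} {u' : List M'} (h : Agree S N u u') (hN : N' ≤ N) :
    Agree S N' u u' := fun t ht => h t (ht.trans_le hN)

theorem Agree.refl (N : ℕ) (u : List M) : Agree S N u u := fun _ _ => Iff.rfl

-- Quantifier-free formulas and tests determine each other

section Formula

theorem select_ofFn_fin {M : Type*} {n : ℕ} (v : Fin n → M) {l : List ℕ} (hl : ∀ i ∈ l, i < n) :
    select (List.ofFn v) l =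
      List.ofFn fun i : Fin l.length => v ⟨l.get i, hl _ (l.get_mem i)⟩ := by
  conv_lhs => rw [← List.ofFn_get l]
  refine select_ofFn fun i => ?_
  have := hl _ (l.get_mem i)
  simp only [List.get_eq_getElem] at this ⊢
  simp [this]

/-- A test is an atomic formula in the entries, or has a constant result when an index is out of
range or the symbol does not fit. Hence one formula serves all structures. -/
theorem exists_formula_holds (n : ℕ) (t : Test) :
    ∃ θ : S.lang.Formula (Fin n), θ.IsQF ∧ ∀ {M : Type} [S.lang.Structure M] (v : Fin n → M),
      θ.Realize v ↔ Holds S (List.ofFn v) t := by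
  obtain ⟨kd, k, w, l⟩ := t
  match kd with
  | 0 =>
    by_cases hk : k < n <;> by_cases hw : w < n
    · refine ⟨Term.equal (Term.var ⟨k, hk⟩) (Term.var ⟨w, hw⟩),
        (BoundedFormula.IsAtomic.equal _ _).isQF, fun v => ?_⟩
      simp [Holds, hk, hw]
    · exact ⟨⊥, BoundedFormula.isQF_bot, fun v => by simp [Holds, hk, hw]⟩
    · exact ⟨⊥, BoundedFormula.isQF_bot, fun v => by simp [Holds, hk, hw]⟩
    -- Two positions beyond the end compare `none` with `none`, so the test succeeds.
    · exact ⟨⊤, BoundedFormula.isQF_bot.imp BoundedFormula.isQF_bot, fun v => by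
        simp [Holds, hk, hw]⟩
  | 1 =>
    by_cases hl : ∀ i ∈ l, i < n
    · by_cases hS : S.rel k = some l.length
      · refine ⟨Relations.formula (Signature.relSym hS) fun i =>
          Term.var ⟨l.get i, hl _ (l.get_mem i)⟩, (BoundedFormula.IsAtomic.rel _ _).isQF,
          fun v => ?_⟩
        simp only [Holds, List.length_ofFn, select_ofFn_fin v hl, Formula.realize_rel,
          Term.realize_var]
        have := relHolds_ofFn (Signature.relSym hS)
          fun i : Fin l.length => v ⟨l.get i, hl _ (l.get_mem i)⟩
        exact ⟨fun h => ⟨hl, this.2 h⟩, fun h => this.1 h.2⟩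
      · refine ⟨⊥, BoundedFormula.isQF_bot, fun v => ?_⟩
        simp only [Holds, List.length_ofFn, select_ofFn_fin v hl, RelHolds]
        simp [hS]
    · exact ⟨⊥, BoundedFormula.isQF_bot, fun v => by
        simp only [Holds, List.length_ofFn, hl]; simp⟩
  | _ + 2 =>
    by_cases hl : (∀ i ∈ l, i < n) ∧ w < n
    · by_cases hS : S.fn k = some l.length
      · refine ⟨Term.equal (Term.func (Signature.fnSym hS) fun i =>
          Term.var ⟨l.get i, hl.1 _ (l.get_mem i)⟩) (Term.var ⟨w, hl.2⟩),
          (BoundedFormula.IsAtomic.equal _ _).isQF, fun v => ?_⟩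
        simp only [Holds, List.length_ofFn, select_ofFn_fin v hl.1, Formula.realize_equal,
          Term.realize_var, Term.realize_func]
        have := fnValue_ofFn (Signature.fnSym hS)
          (fun i : Fin l.length => v ⟨l.get i, hl.1 _ (l.get_mem i)⟩) (v ⟨w, hl.2⟩)
        refine ⟨fun h => ⟨hl.1, _, by simp [hl.2], this.2 h⟩, ?_⟩
        rintro ⟨-, p, hp, h⟩
        simp only [List.getElem?_ofFn, hl.2, dite_true, Option.some.injEq] at hp
        subst hp
        exact this.1 h
      · refine ⟨⊥, BoundedFormula.isQF_bot, fun v => ?_⟩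
        simp only [Holds, List.length_ofFn, select_ofFn_fin v hl.1, FnValue]
        simp [hS]
    · refine ⟨⊥, BoundedFormula.isQF_bot, fun v => ?_⟩
      simp only [Holds, List.length_ofFn, Formula.realize_bot, false_iff, not_and, not_exists]
      intro h1 p hp
      refine absurd ⟨h1, ?_⟩ hl
      simpa using (List.getElem?_eq_some_iff.1 hp).1

/-- The results of finitely many tests are described by a quantifier-free formula. -/
theorem exists_formula_agree (N : ℕ) {n : ℕ} (v : Fin n → M) :
    ∃ θ : S.lang.Formula (Fin n), θ.IsQF ∧ θ.Realize v ∧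
      ∀ {M' : Type} [S.lang.Structure M'] (v' : Fin n → M'), θ.Realize v' →
        Agree S N (List.ofFn v) (List.ofFn v') := by
  induction N with
  | zero =>
    exact ⟨⊤, BoundedFormula.isQF_bot.imp BoundedFormula.isQF_bot, by simp, fun v' _ t ht =>
      absurd ht (Nat.not_lt_zero _)⟩
  | succ N ih =>
    obtain ⟨θ, hθ, hv, h⟩ := ih
    obtain ⟨χ, hχ, hχv⟩ := exists_formula_holds (S := S) n (Denumerable.ofNat Test N)
    have key : ∀ {M' : Type} [S.lang.Structure M'] (v' : Fin n → M'), θ.Realize v' →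
        (χ.Realize v ↔ χ.Realize v') → Agree S (N + 1) (List.ofFn v) (List.ofFn v') := by
      intro M' _ v' h1 h2 t ht
      rcases Nat.lt_succ_iff_lt_or_eq.1 ht with ht | rfl
      · exact h v' h1 t ht
      · rw [Denumerable.ofNat_encode] at hχv
        rw [← hχv, ← hχv, h2]
    by_cases hc : χ.Realize v
    · exact ⟨θ ⊓ χ, hθ.inf hχ, by simp [hv, hc], fun v' hv' => by
        rw [Formula.realize_inf] at hv'
        exact key v' hv'.1 (iff_of_true hc hv'.2)⟩
    · exact ⟨θ ⊓ χ.not, hθ.inf hχ.not, by simp [hv, hc], fun v' hv' => by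
        rw [Formula.realize_inf, Formula.realize_not] at hv'
        exact key v' hv'.1 (iff_of_false hc hv'.2)⟩

theorem PiLE.agree {γ : Ordinal.{0}} {n : ℕ} {a : Fin n → M} {b : Fin n → M'}
    (h : PiLE S.lang γ a b) (N : ℕ) : Agree S N (List.ofFn a) (List.ofFn b) := by
  obtain ⟨θ, hθ, ha, hb⟩ := exists_formula_agree (S := S) N a
  exact hb b ((h.realize_qf hθ).1 ha)

/-- The value of the term `t` is an entry, determined by finitely many tests, of any list that
extends a suitable list. -/
def TermDetermined {X : Type} (f : X → ℕ) (v : X → M) (t : S.lang.Term X) : Prop :=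
  ∀ u : List M, ∃ U : List M, u <+: U ∧ ∃ j N : ℕ, ∀ W : List M, U <+: W →
    (∀ x, W[f x]? = some (v x)) →
    ∀ (M' : Type) [S.lang.Structure M'] (W' : List M') (v' : X → M'), W'.length = W.length →
      (∀ x, W'[f x]? = some (v' x)) → Agree S N W W' → W'[j]? = some (t.realize v')

/-- The terms are treated one at a time, each extending the list left by the previous one. This does
not disturb the earlier terms, since they are determined on every further extension. -/
theorem exists_terms_determined {X : Type} {f : X → ℕ} {v : X → M} {k : ℕ}
    {ts : Fin k → S.lang.Term X} (ih : ∀ i, TermDetermined f v (ts i)) (u : List M) :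
    ∃ U : List M, u <+: U ∧ ∃ (j : Fin k → ℕ) (N : ℕ), ∀ W : List M, U <+: W →
      (∀ x, W[f x]? = some (v x)) → ∀ (M' : Type) [S.lang.Structure M'] (W' : List M')
      (v' : X → M'), W'.length = W.length → (∀ x, W'[f x]? = some (v' x)) → Agree S N W W' →
        (∀ i ∈ List.ofFn j, i < W'.length) ∧
          select W' (List.ofFn j) = List.ofFn fun i => (ts i).realize v' := by
  have args : ∀ m ≤ k, ∃ U : List M, u <+: U ∧ ∃ (j : Fin k → ℕ) (N : ℕ), ∀ W : List M, U <+: W →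
      (∀ x, W[f x]? = some (v x)) → ∀ (M' : Type) [S.lang.Structure M'] (W' : List M')
      (v' : X → M'), W'.length = W.length → (∀ x, W'[f x]? = some (v' x)) → Agree S N W W' →
      ∀ i : Fin k, i.1 < m → W'[j i]? = some ((ts i).realize v') := by
    intro m
    induction m with
    | zero => exact fun _ => ⟨u, List.prefix_rfl, fun _ => 0, 0, by simp⟩
    | succ m ihm =>
      intro hm
      obtain ⟨U, hU, j, N, h⟩ := ihm (by lia)
      obtain ⟨U', hU', j', N', h'⟩ := ih ⟨m, hm⟩ U
      refine ⟨U', hU.trans hU', Function.update j ⟨m, hm⟩ j', max N N', ?_⟩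
      intro W hW hv M' _ W' v' hl hv' hA i hi
      rcases Nat.lt_succ_iff_lt_or_eq.1 hi with hi | hi
      · rw [Function.update_of_ne (by simp [Fin.ext_iff]; lia)]
        exact h W (hU'.trans hW) hv M' W' v' hl hv' (hA.mono (le_max_left _ _)) i hi
      · obtain rfl : i = ⟨m, hm⟩ := Fin.ext hi
        rw [Function.update_self]
        exact h' W hW hv M' W' v' hl hv' (hA.mono (le_max_right _ _))
  obtain ⟨U, hU, j, N, h⟩ := args k le_rfl
  refine ⟨U, hU, j, N, fun W hW hv M' _ W' v' hl hv' hA => ?_⟩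
  have := fun i => h W hW hv M' W' v' hl hv' hA i i.2
  refine ⟨fun i hi => ?_, select_ofFn this⟩
  obtain ⟨i, rfl⟩ := (List.mem_ofFn' _ _).1 hi
  exact (List.getElem?_eq_some_iff.1 (this i)).1

/-- Tests apply symbols to listed entries only, so nested terms need the values of their subterms in
the list. The value of a compound term is appended, and a function test certifies it. In another
structure, agreement on that test forces the entry at the same position to be the value there. -/
theorem termDetermined {X : Type} (f : X → ℕ) (v : X → M) (t : S.lang.Term X) :
    TermDetermined f v t := by
  intro u
  induction t generalizing u with
  | var x => exact ⟨u, List.prefix_rfl, f x, 0, fun W _ _ M' _ W' v' _ h _ => h x⟩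
  | @func k F ts ih =>
    obtain ⟨U, hU, j, N, h⟩ := exists_terms_determined ih u
    let T : Test := (2, F.1, U.length, List.ofFn j)
    refine ⟨U ++ [(Term.func F ts).realize v], hU.trans (List.prefix_append _ _), U.length,
      max N (Encodable.encode T + 1), ?_⟩
    intro W hW hv M' _ W' v' hl hv' hA
    have hUW := (List.prefix_append _ _).trans hW
    -- The hypothesis is applied to `W` against itself, to see that the test succeeds on `W`.
    obtain ⟨h1, h2⟩ := h W hUW hv M W v rfl hv (Agree.refl N W)
    obtain ⟨h1', h2'⟩ := h W hUW hv M' W' v' hl hv' (hA.mono (le_max_left _ _))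
    have hT : Holds S W T := by
      refine ⟨h1, (Term.func F ts).realize v, ?_, ?_⟩
      · obtain ⟨r, rfl⟩ := hW
        simp
      · rw [h2, fnValue_ofFn, Term.realize_func]
    rw [hA T (by simp)] at hT
    obtain ⟨-, p, hp, hF⟩ := hT
    rw [h2', fnValue_ofFn] at hF
    rw [hp, ← hF, Term.realize_func]

/-- Quantifier-free formulas are determined by finitely many tests on a suitable extension of the
tuple. -/
theorem exists_qf_determined {X : Type} (f : X → ℕ) (v : X → M) {θ : S.lang.BoundedFormula X 0}
    (hθ : θ.IsQF) (u : List M) : ∃ U : List M, u <+: U ∧ ∃ N : ℕ, ∀ W : List M, U <+: W →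
      (∀ x, W[f x]? = some (v x)) →
      ∀ (M' : Type) [S.lang.Structure M'] (W' : List M') (v' : X → M'), W'.length = W.length →
        (∀ x, W'[f x]? = some (v' x)) → Agree S N W W' →
        (θ.Realize v default ↔ θ.Realize v' default) := by
  let g : X ⊕ Fin 0 → ℕ := Sum.elim f Fin.elim0
  have hg : ∀ {M : Type} {W : List M} {v : X → M}, (∀ x, W[f x]? = some (v x)) →
      ∀ x, W[g x]? = some (Sum.elim v default x) := by
    rintro M W v h (x | x)
    · exact h x
    · exact x.elim0
  induction hθ generalizing u with
  | falsum => exact ⟨u, List.prefix_rfl, 0, fun _ _ _ _ _ _ _ _ _ _ => Iff.rfl⟩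
  | of_isAtomic hA =>
    cases hA with
    | equal t₁ t₂ =>
      obtain ⟨U₁, hU₁, j₁, N₁, h₁⟩ := termDetermined g (Sum.elim v default) t₁ u
      obtain ⟨U₂, hU₂, j₂, N₂, h₂⟩ := termDetermined g (Sum.elim v default) t₂ U₁
      let T : Test := (0, j₁, j₂, [])
      refine ⟨U₂, hU₁.trans hU₂, max (max N₁ N₂) (Encodable.encode T + 1), ?_⟩
      intro W hW hv M' _ W' v' hl hv' hA
      have e₁ := h₁ W (hU₂.trans hW) (hg hv) M W _ rfl (hg hv) (Agree.refl _ _)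
      have e₂ := h₂ W hW (hg hv) M W _ rfl (hg hv) (Agree.refl _ _)
      have e₁' := h₁ W (hU₂.trans hW) (hg hv) M' W' _ hl (hg hv') (hA.mono (by simp))
      have e₂' := h₂ W hW (hg hv) M' W' _ hl (hg hv') (hA.mono (by simp))
      have hT := hA T (by simp)
      simp only [T, Holds] at hT
      rw [e₁, e₂, e₁', e₂'] at hT
      simpa using hT
    | @rel k R ts =>
      obtain ⟨U, hU, j, N, h⟩ := exists_terms_determined
        (fun i => termDetermined g (Sum.elim v default) (ts i)) u
      let T : Test := (1, R.1, 0, List.ofFn j)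
      refine ⟨U, hU, max N (Encodable.encode T + 1), ?_⟩
      intro W hW hv M' _ W' v' hl hv' hA
      obtain ⟨h1, h2⟩ := h W hW (hg hv) M W _ rfl (hg hv) (Agree.refl N W)
      obtain ⟨h1', h2'⟩ := h W hW (hg hv) M' W' _ hl (hg hv') (hA.mono (le_max_left _ _))
      have hT := hA T (by simp)
      simp only [T, Holds, h2, h2', relHolds_ofFn] at hT
      rw [BoundedFormula.realize_rel, BoundedFormula.realize_rel]
      exact ⟨fun h => (hT.1 ⟨h1, h⟩).2, fun h => (hT.2 ⟨h1', h⟩).2⟩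
  | imp _ _ ih₁ ih₂ =>
    obtain ⟨U₁, hU₁, N₁, h₁⟩ := ih₁ u
    obtain ⟨U₂, hU₂, N₂, h₂⟩ := ih₂ U₁
    refine ⟨U₂, hU₁.trans hU₂, max N₁ N₂, ?_⟩
    intro W hW hv M' _ W' v' hl hv' hA
    rw [BoundedFormula.realize_imp, BoundedFormula.realize_imp,
      h₁ W (hU₂.trans hW) hv M' W' v' hl hv' (hA.mono (le_max_left _ _)),
      h₂ W hW hv M' W' v' hl hv' (hA.mono (le_max_right _ _))]

end Formula

end Collegiate
end

noncomputable section

namespace Collegiate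

/-! ### Closure properties of the primitive recursive functions, for `fun_prop` -/

section Primrec

variable {α β γ σ : Type*} [Primcodable α] [Primcodable β] [Primcodable γ] [Primcodable σ]

attribute [fun_prop] Primrec PrimrecPred Primrec.id Primrec.const Primrec.comp

@[fun_prop] theorem primrec_fst {f : α → β × γ} (hf : Primrec f) : Primrec fun a => (f a).1 :=
  Primrec.fst.comp hf

@[fun_prop] theorem primrec_snd {f : α → β × γ} (hf : Primrec f) : Primrec fun a => (f a).2 :=
  Primrec.snd.comp hf

@[fun_prop] theorem primrec_mk {f : α → β} {g : α → γ} (hf : Primrec f) (hg : Primrec g) :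
    Primrec fun a => (f a, g a) := hf.pair hg

@[fun_prop] theorem primrec_add {f g : α → ℕ} (hf : Primrec f) (hg : Primrec g) :
    Primrec fun a => f a + g a := Primrec.nat_add.comp hf hg

@[fun_prop] theorem primrec_sub {f g : α → ℕ} (hf : Primrec f) (hg : Primrec g) :
    Primrec fun a => f a - g a := Primrec.nat_sub.comp hf hg

@[fun_prop] theorem primrec_mul {f g : α → ℕ} (hf : Primrec f) (hg : Primrec g) :
    Primrec fun a => f a * g a := Primrec.nat_mul.comp hf hg

@[fun_prop] theorem primrec_div {f g : α → ℕ} (hf : Primrec f) (hg : Primrec g) :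
    Primrec fun a => f a / g a := Primrec.nat_div.comp hf hg

@[fun_prop] theorem primrec_mod {f g : α → ℕ} (hf : Primrec f) (hg : Primrec g) :
    Primrec fun a => f a % g a := Primrec.nat_mod.comp hf hg

@[fun_prop] theorem primrec_pow {f g : α → ℕ} (hf : Primrec f) (hg : Primrec g) :
    Primrec fun a => f a ^ g a := (Primrec₂.unpaired'.1 Nat.Primrec.pow).comp hf hg

@[fun_prop] theorem primrec_natPair {f g : α → ℕ} (hf : Primrec f) (hg : Primrec g) :
    Primrec fun a => Nat.pair (f a) (g a) := Primrec₂.natPair.comp hf hg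

@[fun_prop] theorem primrec_unpair {f : α → ℕ} (hf : Primrec f) :
    Primrec fun a => Nat.unpair (f a) := Primrec.unpair.comp hf

@[fun_prop] theorem primrec_encode {f : α → β} (hf : Primrec f) :
    Primrec fun a => Encodable.encode (f a) := Primrec.encode.comp hf

@[fun_prop] theorem primrec_ofNat {δ : Type*} [Denumerable δ] {f : α → ℕ} (hf : Primrec f) :
    Primrec fun a => Denumerable.ofNat δ (f a) := (Primrec.ofNat δ).comp hf

@[fun_prop] theorem primrec_some {f : α → β} (hf : Primrec f) : Primrec fun a => some (f a) :=
  Primrec.option_some.comp hf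

@[fun_prop] theorem primrec_option_map {f : α → Option β} {g : α → β → γ} (hf : Primrec f)
    (hg : Primrec fun p : α × β => g p.1 p.2) : Primrec fun a => (f a).map (g a) :=
  Primrec.option_map hf hg

@[fun_prop] theorem primrec_toList {f : α → Option β} (hf : Primrec f) :
    Primrec fun a => (f a).toList := Primrec.optionToList.comp hf

@[fun_prop] theorem primrec_list_map {f : α → List β} {g : α → β → γ} (hf : Primrec f)
    (hg : Primrec fun p : α × β => g p.1 p.2) : Primrec fun a => (f a).map (g a) :=
  Primrec.list_map hf hg

@[fun_prop] theorem primrec_filterMap {f : α → List β} {g : α → β → Option γ} (hf : Primrec f)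
    (hg : Primrec fun p : α × β => g p.1 p.2) : Primrec fun a => (f a).filterMap (g a) :=
  Primrec.listFilterMap hf hg

@[fun_prop] theorem primrec_length {f : α → List β} (hf : Primrec f) :
    Primrec fun a => (f a).length := Primrec.list_length.comp hf

@[fun_prop] theorem primrec_reverse {f : α → List β} (hf : Primrec f) :
    Primrec fun a => (f a).reverse := Primrec.list_reverse.comp hf

@[fun_prop] theorem primrec_getElem? {f : α → List β} {g : α → ℕ} (hf : Primrec f)
    (hg : Primrec g) : Primrec fun a => (f a)[g a]? := Primrec.list_getElem?.comp hf hg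

@[fun_prop] theorem primrec_append {f g : α → List β} (hf : Primrec f) (hg : Primrec g) :
    Primrec fun a => f a ++ g a := Primrec.list_append.comp hf hg

@[fun_prop] theorem primrec_cons {f : α → β} {g : α → List β} (hf : Primrec f) (hg : Primrec g) :
    Primrec fun a => f a :: g a := Primrec.list_cons.comp hf hg

@[fun_prop] theorem primrec_range {f : α → ℕ} (hf : Primrec f) :
    Primrec fun a => List.range (f a) := Primrec.list_range.comp hf

@[fun_prop] theorem primrec_tail {f : α → List β} (hf : Primrec f) :
    Primrec fun a => (f a).tail := Primrec.list_tail.comp hf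

@[fun_prop] theorem primrec_headI [Inhabited β] {f : α → List β} (hf : Primrec f) :
    Primrec fun a => (f a).headI := Primrec.list_headI.comp hf

@[fun_prop] theorem primrec_ite {p : α → Prop} [DecidablePred p] {f g : α → β}
    (hp : PrimrecPred p) (hf : Primrec f) (hg : Primrec g) :
    Primrec fun a => if p a then f a else g a := Primrec.ite hp hf hg

@[fun_prop] theorem primrec_not {f : α → Bool} (hf : Primrec f) : Primrec fun a => !(f a) :=
  Primrec.not.comp hf

@[fun_prop] theorem primrecPred_eq {f g : α → β} (hf : Primrec f) (hg : Primrec g) :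
    PrimrecPred fun a => f a = g a := Primrec.eq.comp hf hg

@[fun_prop] theorem primrecPred_lt {f g : α → ℕ} (hf : Primrec f) (hg : Primrec g) :
    PrimrecPred fun a => f a < g a := Primrec.nat_lt.comp hf hg

@[fun_prop] theorem primrecPred_and {p q : α → Prop} (hp : PrimrecPred p) (hq : PrimrecPred q) :
    PrimrecPred fun a => p a ∧ q a := hp.and hq

@[fun_prop] theorem primrecPred_or {p q : α → Prop} (hp : PrimrecPred p) (hq : PrimrecPred q) :
    PrimrecPred fun a => p a ∨ q a := hp.or hq

@[fun_prop] theorem primrecPred_not {p : α → Prop} (hp : PrimrecPred p) :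
    PrimrecPred fun a => ¬ p a := hp.not

@[fun_prop] theorem primrecPred_true : PrimrecPred fun _ : α => True :=
  ⟨inferInstance, Primrec.const _⟩

/-- The predicate `P` holds of all entries of the list `l`. -/
def AllMem {β : Type*} (l : List β) (P : β → Prop) : Prop := ∀ b ∈ l, P b

@[fun_prop] theorem primrecPred_allMem {f : α → List β} {P : α → β → Prop} (hf : Primrec f)
    (hP : PrimrecPred fun p : α × β => P p.1 p.2) : PrimrecPred fun a => AllMem (f a) (P a) := by
  have h : PrimrecRel fun (b : β) (a : α) => P a b := by
    show PrimrecPred fun p : β × α => P p.2 p.1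
    exact hP.comp (f := fun p : β × α => (p.2, p.1)) (by fun_prop)
  exact h.forall_mem_list.comp hf Primrec.id

/-- The entries of the list `l` that satisfy `P`. -/
def filterMem {β : Type*} (l : List β) (P : β → Prop) : List β :=
  open Classical in l.filter (P ·)

@[fun_prop] theorem primrec_filterMem {f : α → List β} {P : α → β → Prop} (hf : Primrec f)
    (hP : PrimrecPred fun p : α × β => P p.1 p.2) : Primrec fun a => filterMem (f a) (P a) := by
  classical
  have h : PrimrecRel fun (b : β) (a : α) => P a b := by
    show PrimrecPred fun p : β × α => P p.2 p.1
    exact hP.comp (f := fun p : β × α => (p.2, p.1)) (by fun_prop)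
  exact h.listFilter.comp hf Primrec.id

theorem mem_filterMem {β : Type*} {l : List β} {P : β → Prop} {b : β} :
    b ∈ filterMem l P ↔ b ∈ l ∧ P b := by
  simp [filterMem]

end Primrec

/-! ### Bounded evaluation of partial computable functions -/

open Nat.Partrec (Code)

/-- The result of `st` steps of the computation of the `e`-th partial computable function. -/
def phiSteps (st e n : ℕ) : Option ℕ := Code.evaln st (Denumerable.ofNat Code e) n

@[fun_prop] theorem primrec_phiSteps {α : Type*} [Primcodable α] {f g h : α → ℕ} (hf : Primrec f)
    (hg : Primrec g) (hh : Primrec h) : Primrec fun a => phiSteps (f a) (g a) (h a) :=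
  Code.primrec_evaln.comp
    (f := fun a : (ℕ × Code) × ℕ => Code.evaln a.1.1 a.1.2 a.2) (by fun_prop :
      Primrec fun a => ((f a, Denumerable.ofNat Code (g a)), h a))

theorem phi_eq_of_phiSteps {st e n v : ℕ} (h : phiSteps st e n = some v) :
    phi e n = Part.some v :=
  Part.eq_some_iff.2 (Code.evaln_sound h)

theorem eventually_phiSteps {e n v : ℕ} (h : phi e n = Part.some v) :
    ∀ᶠ st in Filter.atTop, phiSteps st e n = some v := by
  obtain ⟨k, hk⟩ := Code.evaln_complete.1 (Part.eq_some_iff.1 h)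
  filter_upwards [Filter.eventually_ge_atTop k] with st hst
  exact Code.evaln_mono hst hk

theorem phiSteps_mono {st st' e n v : ℕ} (h : phiSteps st e n = some v) (hst : st ≤ st') :
    phiSteps st' e n = some v := Code.evaln_mono hst h

/-- The parametrization theorem. -/
theorem exists_computable_phi_eq {α : Type*} [Primcodable α] {f : α × ℕ →. ℕ} (hf : Partrec f) :
    ∃ g : α → ℕ, Computable g ∧ ∀ a n, phi (g a) n = f (a, n) := by
  obtain ⟨c, hc⟩ := Code.exists_code.1 hf
  refine ⟨fun a => Encodable.encode (Code.curry c (Encodable.encode a)), ?_, fun a n => ?_⟩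
  · exact Computable.encode.comp (Code.primrec₂_curry.to_comp.comp (Computable.const c)
      Computable.encode)
  · rw [phi, Denumerable.ofNat_encode, Code.eval_curry]
    refine (congrFun hc (Encodable.encode (a, n))).trans ?_
    simp only [Encodable.encodek, Part.coe_some, Part.bind_some]
    exact Part.map_id' (fun _ => rfl) _

/-! ### Classes of functions avoiding finite conditions, and trees -/

/-- `F` satisfies the finite condition `L`. -/
def Satisfies (F : ℕ → ℕ) (L : List (ℕ × ℕ)) : Prop := ∀ p ∈ L, F p.1 = p.2

/-- `F` satisfies none of the finite conditions that are values of the `e`-th partial computable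
function. These are the `Π⁰₁` classes of Baire space. -/
def Avoids (e : ℕ) (F : ℕ → ℕ) : Prop :=
  ∀ k r, phi e k = Part.some r → ¬ Satisfies F (Denumerable.ofNat (List (ℕ × ℕ)) r)

/-- A computable family of finite conditions yields an index of a class. -/
theorem exists_computable_avoids_iff {α δ : Type*} [Primcodable α] [Primcodable δ]
    {V : α × δ → Option (List (ℕ × ℕ))} (hV : Primrec V) :
    ∃ g : α → ℕ, Computable g ∧ ∀ a F, Avoids (g a) F ↔
      ∀ d L, V (a, d) = some L → ¬ Satisfies F L := by
  -- A number that codes nothing, or whose value is `none`, makes the computation undefined and so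
  -- contributes no condition.
  have h : Primrec fun p : α × ℕ => ((Encodable.decode (α := δ) p.2).bind fun d =>
      V (p.1, d)).map fun L => Encodable.encode L := by
    refine Primrec.option_map (Primrec.option_bind (Primrec.decode.comp Primrec.snd) ?_) ?_
    · exact hV.comp (by fun_prop : Primrec fun q : (α × ℕ) × δ => (q.1.1, q.2))
    · exact (by fun_prop : Primrec fun q : (α × ℕ) × List (ℕ × ℕ) => Encodable.encode q.2)
  obtain ⟨g, hg, hgf⟩ := exists_computable_phi_eq h.to_comp.ofOption
  refine ⟨g, hg, fun a F => ?_⟩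
  simp only [Avoids, hgf]
  constructor
  · intro H d L hL
    have := H (Encodable.encode d) (Encodable.encode L) (by simp [hL])
    rwa [Denumerable.ofNat_encode] at this
  · intro H k r hr
    rw [Part.eq_some_iff, Part.mem_ofOption] at hr
    simp only [Option.mem_def, Option.map_eq_some_iff, Option.bind_eq_some_iff] at hr
    obtain ⟨L, ⟨d, -, hL⟩, rfl⟩ := hr
    rw [Denumerable.ofNat_encode]
    exact H d L hL

/-- The list of the first `n` values of `F`. -/
def initSeg (F : ℕ → ℕ) (n : ℕ) : List ℕ := (List.range n).map F

theorem length_initSeg (F : ℕ → ℕ) (n : ℕ) : (initSeg F n).length = n := by simp [initSeg]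

theorem initSeg_succ (F : ℕ → ℕ) (n : ℕ) : initSeg F (n + 1) = initSeg F n ++ [F n] := by
  simp [initSeg, List.range_succ]

theorem initSeg_getElem?_eq_some {F : ℕ → ℕ} {n q v : ℕ} :
    (initSeg F n)[q]? = some v ↔ q < n ∧ F q = v := by
  simp [initSeg, List.getElem?_eq_some_iff]

/-- The tree of finite sequences that have not been seen to satisfy a condition of the `e`-th
class. -/
def InTree (e : ℕ) (l : List ℕ) : Prop :=
  AllMem (List.range l.length) fun k => AllMem (phiSteps l.length e k).toList fun r =>
    ¬ AllMem (Denumerable.ofNat (List (ℕ × ℕ)) r) fun p => l[p.1]? = some p.2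

@[fun_prop] theorem primrecPred_inTree {α : Type*} [Primcodable α] {f : α → ℕ} {g : α → List ℕ}
    (hf : Primrec f) (hg : Primrec g) : PrimrecPred fun a => InTree (f a) (g a) := by
  unfold InTree
  fun_prop

theorem inTree_iff {e : ℕ} {l : List ℕ} : InTree e l ↔ ∀ k < l.length, ∀ r,
    phiSteps l.length e k = some r →
      ¬ ∀ p ∈ Denumerable.ofNat (List (ℕ × ℕ)) r, l[p.1]? = some p.2 := by
  simp [InTree, AllMem]

/-- The length bounds both the number of steps and the conditions considered, so a longer sequence
sees every violation seen by a shorter one. -/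
theorem InTree.of_prefix {e : ℕ} {l l' : List ℕ} (h : InTree e l) (hl : l' <+: l) :
    InTree e l' := by
  rw [inTree_iff] at h ⊢
  intro k hk r hr hc
  refine h k (hk.trans_le hl.length_le) r (phiSteps_mono hr hl.length_le) fun p hp => ?_
  obtain ⟨t, rfl⟩ := hl
  have := hc p hp
  rw [List.getElem?_append_left (List.getElem?_eq_some_iff.1 this).1, this]

/-- A violated condition concerns finitely many arguments. It is noticed once `n` exceeds these, the
number of the condition, and the time needed to compute it. -/
theorem avoids_iff_inTree {e : ℕ} {F : ℕ → ℕ} : Avoids e F ↔ ∀ n, InTree e (initSeg F n) := by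
  simp only [inTree_iff, length_initSeg, initSeg_getElem?_eq_some]
  constructor
  · intro h n k _ r hr hc
    exact h k r (phi_eq_of_phiSteps hr) fun p hp => (hc p hp).2
  · intro h k r hr hs
    obtain ⟨n, h1, h2, h3⟩ := ((eventually_phiSteps hr).and
      ((Filter.eventually_gt_atTop k).and (Filter.eventually_gt_atTop
        (((Denumerable.ofNat (List (ℕ × ℕ)) r).map Prod.fst).foldr max 0)))).exists
    refine h n k h2 r h1 fun p hp => ⟨lt_of_le_of_lt ?_ h3, hs p hp⟩
    exact List.le_max_of_le (List.mem_map_of_mem hp) le_rfl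

end Collegiate
end

noncomputable section

namespace Collegiate

/-! ### The Kleene-Brouwer order -/

/-- The Kleene-Brouwer order of finite sequences. -/
def KB : List ℕ → List ℕ → Prop
  | [], _ => False
  | _ :: _, [] => True
  | a :: l, b :: m => a < b ∨ a = b ∧ KB l m

theorem kb_trichotomous (l m : List ℕ) (h1 : ¬ KB l m) (h2 : ¬ KB m l) : l = m := by
  induction l generalizing m with
  | nil => cases m <;> simp_all [KB]
  | cons a l ih =>
    cases m with
    | nil => simp [KB] at h1
    | cons b m =>
      simp only [KB, not_or, not_and, not_lt] at h1 h2
      obtain rfl := le_antisymm h2.1 h1.1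
      rw [ih m (h1.2 rfl) (h2.2 rfl)]

theorem kb_append_singleton (l : List ℕ) (a : ℕ) : KB (l ++ [a]) l := by
  induction l with
  | nil => simp [KB]
  | cons b l ih => simp [KB, ih]

/-- A form with bounded quantifiers, which makes the order primitive recursive: `i` is the first
place where `l` departs from `m`, either extending it or being smaller there. -/
theorem kb_iff (l m : List ℕ) : KB l m ↔ ¬ AllMem (List.range l.length) fun i =>
    ¬ (AllMem (List.range i) (fun j => l[j]? = m[j]?) ∧
      (m[i]? = none ∨ l[i]?.getD 0 < m[i]?.getD 0)) := by
  simp only [AllMem, List.mem_range, not_forall, not_not, exists_prop]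
  induction l generalizing m with
  | nil => simp [KB]
  | cons a l ih =>
    cases m with
    | nil => simpa [KB] using ⟨0, by simp⟩
    | cons b m =>
      simp only [KB, ih m]
      constructor
      · rintro (h | ⟨rfl, i, hi, hij, h⟩)
        · exact ⟨0, by simp [h]⟩
        · refine ⟨i + 1, by simpa using hi, fun j hj => ?_, by simpa using h⟩
          cases j with
          | zero => simp
          | succ j => simpa using hij j (by lia)
      · rintro ⟨i, hi, hij, h⟩
        cases i with
        | zero => exact Or.inl (by simpa using h)
        | succ i =>
          refine Or.inr ⟨by simpa using hij 0 (by lia), i, by simpa using hi, fun j hj => ?_,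
            by simpa using h⟩
          simpa using hij (j + 1) (by lia)

@[fun_prop] theorem primrecPred_kb {α : Type*} [Primcodable α] {f g : α → List ℕ}
    (hf : Primrec f) (hg : Primrec g) : PrimrecPred fun a => KB (f a) (g a) := by
  have hD : ∀ {β : Type _} [Primcodable β] {h : β → Option ℕ}, Primrec h →
      Primrec fun b => (h b).getD 0 := fun h => Primrec.option_getD.comp h (Primrec.const 0)
  simp only [kb_iff]
  have h1 : PrimrecPred fun p : α × ℕ => (f p.1)[p.2]?.getD 0 < (g p.1)[p.2]?.getD 0 :=
    primrecPred_lt (hD (by fun_prop)) (hD (by fun_prop))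
  fun_prop

/-- The order is a sum along `ℕ` of the orders on the tails after each first entry, with the empty
sequence on top. Contrapositively, ill-foundedness survives in some immediate subtree. -/
theorem wellFoundedOn_kb_of_cons {X : Set (List ℕ)}
    (h : ∀ n, {l | n :: l ∈ X}.WellFoundedOn KB) : X.WellFoundedOn KB := by
  have cons : ∀ n l (hl : n :: l ∈ X), Acc (fun a b : X => KB a b) ⟨n :: l, hl⟩ := by
    intro n
    induction n using Nat.strong_induction_on with
    | _ n ihn =>
      intro l hl
      have key : ∀ p : {l | n :: l ∈ X}, Acc (fun a b : X => KB a b) ⟨n :: p.1, p.2⟩ := by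
        intro p
        refine WellFounded.induction (C := fun p : {l | n :: l ∈ X} =>
          Acc (fun a b : X => KB a b) ⟨n :: p.1, p.2⟩) (h n) p fun p ihp => ⟨_, ?_⟩
        rintro ⟨y, hy⟩ hyp
        cases y with
        | nil => simp [KB] at hyp
        | cons m y =>
          simp only [KB] at hyp
          rcases hyp with hm | ⟨rfl, hyp⟩
          · exact ihn m hm y hy
          · exact ihp ⟨y, hy⟩ hyp
      exact key ⟨l, hl⟩
  refine ⟨?_⟩
  rintro ⟨x, hx⟩
  refine ⟨_, ?_⟩
  rintro ⟨y, hy⟩ hyx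
  cases y with
  | nil => simp [KB] at hyx
  | cons m y => exact cons m y hy

/-- A tree whose Kleene-Brouwer order is not well-founded has a path. -/
theorem exists_path_of_not_wellFoundedOn_kb {X : Set (List ℕ)}
    (hX : ∀ l ∈ X, ∀ l', l' <+: l → l' ∈ X) (h : ¬ X.WellFoundedOn KB) :
    ∃ F : ℕ → ℕ, ∀ n, initSeg F n ∈ X := by
  -- Sequences above which the tree is ill-founded. Each has a one-step extension of the same kind,
  -- and iterating from the empty sequence gives the path.
  let G := {l : List ℕ // ¬ {m | l ++ m ∈ X}.WellFoundedOn KB}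
  have step : ∀ l : G, ∃ n, ¬ {m | (l.1 ++ [n]) ++ m ∈ X}.WellFoundedOn KB := by
    intro l
    by_contra hc
    push Not at hc
    refine l.2 (wellFoundedOn_kb_of_cons fun n => ?_)
    simpa using hc n
  choose nx hnx using step
  let g : ℕ → G := fun n => n.rec ⟨[], by simpa using h⟩ fun _ l => ⟨l.1 ++ [nx l], hnx l⟩
  have hg : ∀ n, initSeg (fun k => nx (g k)) n = (g n).1 := by
    intro n
    induction n with
    | zero => rfl
    | succ n ih => rw [initSeg_succ, ih]
  refine ⟨fun k => nx (g k), fun n => ?_⟩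
  rw [hg]
  by_contra hc
  refine (g n).2 ?_
  have : {m | (g n).1 ++ m ∈ X} = ∅ := by
    ext m
    simpa using fun hm => hc (hX _ hm _ (List.prefix_append _ _))
  rw [this]
  exact Set.wellFoundedOn_empty _

/-! ### Computable ordinals -/

theorem partrec_phi : Partrec fun p : ℕ × ℕ => phi p.1 p.2 :=
  Nat.Partrec.Code.eval_part.comp ((Computable.ofNat _).comp Computable.fst) Computable.snd

/-- A smaller ordinal is the type of the initial segment below some `x`, which is computable with
`x` as a parameter. -/
theorem IsComputableOrdinal.of_lt {α β : Ordinal.{0}} (hβ : IsComputableOrdinal β) (h : α < β) :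
    IsComputableOrdinal α := by
  classical
  obtain ⟨b, S, r, _, rfl, hS, hr⟩ := hβ
  obtain ⟨x, rfl⟩ := Ordinal.typein_surj r h
  -- A membership query answered positively is followed by the query whether the number lies below
  -- `x`. Any other query is simply repeated.
  have hq : Primrec fun p : ℕ × ℕ =>
      if p.1.unpair.1 = 0 ∧ p.2 = 1 then Nat.pair 1 (Nat.pair p.1.unpair.2 x) else p.1 := by
    fun_prop
  have hf : Partrec fun n : ℕ => (phi b n).bind fun v =>
      phi b (if n.unpair.1 = 0 ∧ v = 1 then Nat.pair 1 (Nat.pair n.unpair.2 x) else n) :=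
    (partrec_phi.comp ((Computable.const b).pair Computable.id)).bind
      ((partrec_phi.comp ((Computable.const b).pair hq.to_comp)).to₂)
  obtain ⟨g, -, hg⟩ := exists_computable_phi_eq
    (hf.comp (Computable.snd : Computable (Prod.snd : ℕ × ℕ → ℕ)))
  let S' : Set ℕ := {y | ∃ h : y ∈ S, r ⟨y, h⟩ x}
  let ι : S' → {y : S // r y x} := fun y => ⟨⟨y.1, y.2.1⟩, y.2.2⟩
  have hι : Function.Bijective ι := by
    refine ⟨fun a b hab => ?_, fun ⟨⟨y, hy⟩, hyx⟩ => ⟨⟨y, hy, hyx⟩, rfl⟩⟩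
    simp only [ι, Subtype.mk.injEq] at hab
    exact Subtype.ext hab
  let s : S' → S' → Prop := fun y z => Subrel r (r · x) (ι y) (ι z)
  let E : s ≃r Subrel r (r · x) := ⟨Equiv.ofBijective ι hι, Iff.rfl⟩
  have : IsWellOrder S' s := E.toRelEmbedding.isWellOrder
  refine ⟨g 0, S', s, this, ?_, fun y => ?_, fun y z => ?_⟩
  · rw [← Ordinal.type_subrel]
    exact Ordinal.type_eq.2 ⟨E⟩
  · rw [hg]
    simp only [hS, Part.bind_some, Nat.unpair_pair, true_and]
    by_cases hy : y ∈ S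
    · simp [hy, S', hr ⟨y, hy⟩ x]
    · simp [hy, S', hS]
  · rw [hg]
    simp only [hr ⟨y.1, y.2.1⟩ ⟨z.1, z.2.1⟩, Part.bind_some, Nat.unpair_pair, one_ne_zero,
      false_and, if_false]
    rfl

theorem IsComputableOrdinal.of_le {α β : Ordinal.{0}} (hβ : IsComputableOrdinal β) (h : α ≤ β) :
    IsComputableOrdinal α := by
  rcases h.lt_or_eq with h | rfl
  exacts [hβ.of_lt h, hβ]

theorem CodesOrdinal.unique {b : ℕ} {α β : Ordinal.{0}} (hα : CodesOrdinal b α)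
    (hβ : CodesOrdinal b β) : α = β := by
  classical
  obtain ⟨S, r, _, rfl, hS, hr⟩ := hα
  obtain ⟨S', r', _, rfl, hS', hr'⟩ := hβ
  obtain rfl : S = S' := by
    ext x
    have := (hS x).symm.trans (hS' x)
    by_cases h : x ∈ S <;> by_cases h' : x ∈ S' <;> simp_all
  obtain rfl : r = r' := by
    funext x y
    have := (hr x y).symm.trans (hr' x y)
    by_cases h : r x y <;> by_cases h' : r' x y <;> simp_all
  rfl

/-- Otherwise choosing indices would inject all ordinals into `ℕ`. This ensures that the infimum
defining `omegaOneCK` is attained. -/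
theorem exists_not_isComputableOrdinal : ∃ β, ¬ IsComputableOrdinal β := by
  by_contra hc
  push Not at hc
  choose c hc using hc
  have hinj : Function.Injective c := fun α β h => (hc α).unique (h ▸ hc β)
  have : Small.{0} Ordinal.{0} := small_of_injective hinj
  have : Small.{0} (Set.univ : Set Ordinal.{0}) := inferInstance
  exact not_bddAbove_univ (Ordinal.bddAbove_of_small (s := Set.univ))

theorem IsComputableOrdinal.lt_omegaOneCK {β : Ordinal.{0}} (h : IsComputableOrdinal β) :
    β < omegaOneCK := by
  have hm : ¬ IsComputableOrdinal omegaOneCK := csInf_mem exists_not_isComputableOrdinal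
  by_contra hc
  exact hm (h.of_le (not_lt.1 hc))

/-! ### The Kleene-Brouwer orders of the trees -/

open Classical in
theorem exists_kbIndex : ∃ b : ℕ → ℕ, Computable b ∧ ∀ e x,
    phi (b e) (Nat.pair 0 x) = Part.some (if InTree e (Denumerable.ofNat _ x) then 1 else 0) ∧
    ∀ y, phi (b e) (Nat.pair 1 (Nat.pair x y)) =
      Part.some (if KB (Denumerable.ofNat _ x) (Denumerable.ofNat _ y) then 1 else 0) := by
  have h : Primrec fun p : ℕ × ℕ => if p.2.unpair.1 = 0 then
      (if InTree p.1 (Denumerable.ofNat _ p.2.unpair.2) then 1 else 0)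
      else (if KB (Denumerable.ofNat _ p.2.unpair.2.unpair.1)
        (Denumerable.ofNat _ p.2.unpair.2.unpair.2) then 1 else 0) := by fun_prop
  obtain ⟨b, hb, hbe⟩ := exists_computable_phi_eq (f := _) h.to_comp
  exact ⟨b, hb, fun e x => ⟨by simp [hbe], fun y => by simp [hbe]⟩⟩

/-- An index of the Kleene-Brouwer order of the `e`-th tree. -/
def kbIndex : ℕ → ℕ := exists_kbIndex.choose

theorem computable_kbIndex : Computable kbIndex := exists_kbIndex.choose_spec.1

open Classical in
theorem phi_kbIndex_zero (e x : ℕ) : phi (kbIndex e) (Nat.pair 0 x) =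
    Part.some (if InTree e (Denumerable.ofNat _ x) then 1 else 0) :=
  (exists_kbIndex.choose_spec.2 e x).1

open Classical in
theorem phi_kbIndex_one (e x y : ℕ) : phi (kbIndex e) (Nat.pair 1 (Nat.pair x y)) =
    Part.some (if KB (Denumerable.ofNat _ x) (Denumerable.ofNat _ y) then 1 else 0) :=
  (exists_kbIndex.choose_spec.2 e x).2 y

/-- The class of an empty set of functions has a tree without paths, on which the Kleene-Brouwer
order is a well-order. -/
theorem exists_codesOrdinal_kbIndex {e : ℕ} (h : ¬ ∃ F, Avoids e F) :
    ∃ β, CodesOrdinal (kbIndex e) β := by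
  have hwf : {l | InTree e l}.WellFoundedOn KB := by
    by_contra hc
    obtain ⟨F, hF⟩ := exists_path_of_not_wellFoundedOn_kb (fun l hl l' => hl.of_prefix) hc
    exact h ⟨F, avoids_iff_inTree.2 hF⟩
  let S : Set ℕ := {x | InTree e (Denumerable.ofNat _ x)}
  let r : S → S → Prop := fun x y => KB (Denumerable.ofNat _ x.1) (Denumerable.ofNat _ y.1)
  have wf : WellFounded r := InvImage.wf (fun x : S => (⟨Denumerable.ofNat _ x.1, x.2⟩ :
    {l | InTree e l})) hwf
  have : IsWellOrder S r :=
    { wf := wf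
      trichotomous := fun x y h1 h2 => by
        have := kb_trichotomous _ _ h1 h2
        exact Subtype.ext ((Denumerable.eqv (List ℕ)).symm.injective this) }
  exact ⟨_, S, r, this, rfl, phi_kbIndex_zero e, fun x y => phi_kbIndex_one e x y⟩

end Collegiate
end

noncomputable section

namespace Collegiate

open FirstOrder.Language

/-! ### Binary digits -/

/-- The binary digit of `x` at `i`. -/
def digit (x i : ℕ) : ℕ := x / 2 ^ i % 2

@[fun_prop] theorem primrec_digit {α : Type*} [Primcodable α] {f g : α → ℕ} (hf : Primrec f)
    (hg : Primrec g) : Primrec fun a => digit (f a) (g a) := by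
  unfold digit
  fun_prop

theorem digit_eq_one_iff {x i : ℕ} : digit x i = 1 ↔ x.testBit i = true := by
  simp [digit, Nat.testBit_eq_decide_div_mod_eq]

theorem lt_of_digit_eq_one {x i : ℕ} (h : digit x i = 1) : i < x :=
  i.lt_two_pow_self.trans_le (Nat.ge_two_pow_of_testBit (digit_eq_one_iff.1 h))

theorem digit_xor_two_pow_eq_one {x p i : ℕ} :
    digit (x ^^^ 2 ^ p) i = 1 ↔ (digit x i = 1 ↔ i ≠ p) := by
  rw [digit_eq_one_iff, digit_eq_one_iff, Nat.testBit_xor, Nat.testBit_two_pow]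
  by_cases h : p = i
  · subst h; simp
  · simp [h, Ne.symm h]

theorem digit_eq_zero_or_one (x i : ℕ) : digit x i = 0 ∨ digit x i = 1 :=
  Nat.mod_two_eq_zero_or_one _

/-- The number of binary digits `1` of `x` at positions that satisfy `Q`. -/
def digitCount (Q : ℕ → Prop) (x : ℕ) : ℕ :=
  (filterMem (List.range x) fun i => digit x i = 1 ∧ Q i).length

theorem digitCount_eq_ncard (Q : ℕ → Prop) (x : ℕ) :
    digitCount Q x = {i | digit x i = 1 ∧ Q i}.ncard := by
  classical
  have : {i | digit x i = 1 ∧ Q i} =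
      ((Finset.range x).filter fun i => digit x i = 1 ∧ Q i : Finset ℕ) := by
    ext i
    simp only [Set.mem_ofPred_eq, Finset.coe_filter, Finset.mem_range]
    exact ⟨fun h => ⟨lt_of_digit_eq_one h.1, h⟩, fun h => h.2⟩
  rw [this, Set.ncard_coe_finset, digitCount, filterMem]
  simp only [Finset.card, Finset.filter, Finset.range, Multiset.range, Multiset.filter_coe,
    Multiset.coe_card]
  congr!

theorem finite_setOf_digit (Q : ℕ → Prop) (x : ℕ) : {i | digit x i = 1 ∧ Q i}.Finite :=
  (Set.finite_lt_nat x).subset fun _ h => lt_of_digit_eq_one h.1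

open Classical in
theorem digitCount_xor_two_pow (Q : ℕ → Prop) (x p : ℕ) :
    digitCount Q (x ^^^ 2 ^ p) % 2 = (digitCount Q x + if Q p then 1 else 0) % 2 := by
  rw [digitCount_eq_ncard, digitCount_eq_ncard]
  by_cases hQ : Q p
  · rw [if_pos hQ]
    by_cases hp : digit x p = 1
    · have : {i | digit x i = 1 ∧ Q i} =
          insert p {i | digit (x ^^^ 2 ^ p) i = 1 ∧ Q i} := by
        ext i
        simp only [digit_xor_two_pow_eq_one, Set.mem_ofPred_eq, Set.mem_insert_iff]
        by_cases h : i = p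
        · subst h; simp [hp, hQ]
        · simp [h]
      rw [this, Set.ncard_insert_of_notMem _ (finite_setOf_digit _ _)]
      · lia
      · simp [digit_xor_two_pow_eq_one, hp]
    · have : {i | digit (x ^^^ 2 ^ p) i = 1 ∧ Q i} =
          insert p {i | digit x i = 1 ∧ Q i} := by
        ext i
        simp only [digit_xor_two_pow_eq_one, Set.mem_ofPred_eq, Set.mem_insert_iff]
        by_cases h : i = p
        · subst h; simp [hp, hQ]
        · simp [h]
      rw [this, Set.ncard_insert_of_notMem _ (finite_setOf_digit _ _)]
      simp [hp]
  · have : {i | digit (x ^^^ 2 ^ p) i = 1 ∧ Q i} = {i | digit x i = 1 ∧ Q i} := by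
      ext i
      simp only [digit_xor_two_pow_eq_one, Set.mem_ofPred_eq]
      by_cases h : i = p
      · subst h; simp [hQ]
      · simp [h]
    rw [this, if_neg hQ, add_zero]

open Classical in
theorem digit_xor_two_pow (x p j : ℕ) :
    digit (x ^^^ 2 ^ p) j = (digit x j + if p = j then 1 else 0) % 2 := by
  have h := digit_xor_two_pow_eq_one (x := x) (p := p) (i := j)
  have h1 := digit_eq_zero_or_one x j
  have h2 := digit_eq_zero_or_one (x ^^^ 2 ^ p) j
  split_ifs with hp
  · subst hp
    simp only [ne_eq, not_true_eq_false, iff_false] at h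
    lia
  · simp only [ne_eq, Ne.symm hp, not_false_eq_true, iff_true] at h
    lia

theorem exists_of_digitCount_odd {Q : ℕ → Prop} {x : ℕ} (h : digitCount Q x % 2 = 1) :
    ∃ i, digit x i = 1 ∧ Q i := by
  rw [digitCount_eq_ncard] at h
  by_contra hc
  push Not at hc
  have : {i | digit x i = 1 ∧ Q i} = ∅ := by
    ext i
    simpa using hc i
  simp [this] at h

/-! ### Structures coding a tree

The elements are pairs of a level and a finite set of nodes of that level; the nodes are
represented by the codes of the reversed sequences, and finite sets of numbers by binary digits. -/

/-- The parent of a node. -/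
def parent (m : ℕ) : ℕ := Encodable.encode (Denumerable.ofNat (List ℕ) m).tail

@[fun_prop] theorem primrec_parent {α : Type*} [Primcodable α] {f : α → ℕ} (hf : Primrec f) :
    Primrec fun a => parent (f a) := by
  unfold parent
  fun_prop

/-- `m` is a node of level `n` of the `e`-th tree. -/
def IsNode (e n m : ℕ) : Prop :=
  (Denumerable.ofNat (List ℕ) m).length = n ∧ InTree e (Denumerable.ofNat (List ℕ) m).reverse

/-- `z` is a pair of a level and a finite set of nodes of that level. -/
def IsNodeSet (e z : ℕ) : Prop :=
  AllMem (List.range z.unpair.2) fun m => ¬ digit z.unpair.2 m = 1 ∨ IsNode e z.unpair.1 m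

@[fun_prop] theorem primrecPred_isNodeSet {α : Type*} [Primcodable α] {f g : α → ℕ}
    (hf : Primrec f) (hg : Primrec g) : PrimrecPred fun a => IsNodeSet (f a) (g a) := by
  unfold IsNodeSet IsNode
  fun_prop

theorem isNodeSet_iff {e z : ℕ} :
    IsNodeSet e z ↔ ∀ m, digit z.unpair.2 m = 1 → IsNode e z.unpair.1 m := by
  simp only [IsNodeSet, AllMem, List.mem_range]
  exact ⟨fun h m hm => (h m (lt_of_digit_eq_one hm)).resolve_left (not_not.2 hm),
    fun h m _ => or_iff_not_imp_left.2 fun hm => h m (not_not.1 hm)⟩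

/-- Parity (relation `0`), projection to the previous level modulo 2 (relation `1`), and level `n`
(relation `n + 2`). -/
def NodeRel (flip k : ℕ) (r : List ℕ) : Prop :=
  (k = 0 ∧ digitCount (fun _ => True) r.headI.unpair.2 % 2 = flip) ∨
  (k = 1 ∧ r.headI.unpair.1 = r.tail.headI.unpair.1 + 1 ∧
    AllMem (List.range r.tail.headI.unpair.2) (fun j => digit r.tail.headI.unpair.2 j =
      digitCount (fun i => parent i = j) r.headI.unpair.2 % 2) ∧
    AllMem (List.range r.headI.unpair.2) (fun i => digit r.tail.headI.unpair.2 (parent i) =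
      digitCount (fun i' => parent i' = parent i) r.headI.unpair.2 % 2)) ∨
  (1 < k ∧ r.headI.unpair.1 + 2 = k)

@[fun_prop] theorem primrecPred_nodeRel {α : Type*} [Primcodable α] {f g : α → ℕ}
    {h : α → List ℕ} (hf : Primrec f) (hg : Primrec g) (hh : Primrec h) :
    PrimrecPred fun a => NodeRel (f a) (g a) (h a) := by
  unfold NodeRel digitCount
  fun_prop

/-- The bounded clauses keep the relation primitive recursive. They suffice because a position with
nonzero digit in `y` is below `y`, and a position with odd count is the parent of some element of
`x`. -/
theorem projection_iff {x y : ℕ} :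
    (AllMem (List.range y) (fun j => digit y j = digitCount (fun i => parent i = j) x % 2) ∧
    AllMem (List.range x) (fun i => digit y (parent i) =
      digitCount (fun i' => parent i' = parent i) x % 2)) ↔
    ∀ j, digit y j = digitCount (fun i => parent i = j) x % 2 := by
  simp only [AllMem, List.mem_range]
  refine ⟨fun ⟨h1, h2⟩ j => ?_, fun h => ⟨fun j _ => h j, fun i _ => h _⟩⟩
  rcases digit_eq_zero_or_one y j with hy | hy
  · rcases Nat.mod_two_eq_zero_or_one (digitCount (fun i => parent i = j) x) with hx | hx
    · rw [hy, hx]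
    · obtain ⟨i, hi, rfl⟩ := exists_of_digitCount_odd hx
      exact h2 i (lt_of_digit_eq_one hi)
  · exact h1 j (lt_of_digit_eq_one hy)

/-- The signature of the structures coding a tree. -/
def treeSig : Signature where
  rel k := if k = 1 then some 2 else some 1
  fn _ := none

instance (n : ℕ) : IsEmpty (treeSig.lang.Functions n) := ⟨fun F => by cases F.2⟩

/-- The structures coding the `e`-th tree, for `flip = 0` and `flip = 1`; the former has the even
sets as its distinguished elements, the latter the odd sets. -/
def treeStr (flip e : ℕ) : NatStructure treeSig where
  carrier := {z | IsNodeSet e z}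
  str :=
    { funMap := fun F => isEmptyElim F
      RelMap := fun R v => NodeRel flip R.1 (List.ofFn fun i => (v i).1) }

theorem treeStr_relMap {flip e n : ℕ} (R : treeSig.lang.Relations n) (v : Fin n → treeStr flip e) :
    Structure.RelMap R v ↔ NodeRel flip R.1 (List.ofFn fun i => (v i).1) := Iff.rfl

open Classical in
theorem exists_treeIndex : ∃ g : ℕ × ℕ → ℕ, Computable g ∧
    ∀ flip e, IsIndex (g (flip, e)) (treeStr flip e) := by
  have h : Primrec fun p : (ℕ × ℕ) × ℕ =>
      if p.2.unpair.1 = 0 then (if IsNodeSet p.1.2 p.2.unpair.2 then 1 else 0)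
      else if p.2.unpair.1 = 1 then
        Encodable.encode (if p.2.unpair.2 = 1 then some 2 else some 1)
      else if p.2.unpair.1 = 2 then 0
      else (if NodeRel p.1.1 p.2.unpair.2.unpair.1
        (Denumerable.ofNat (List ℕ) p.2.unpair.2.unpair.2) then 1 else 0) := by fun_prop
  obtain ⟨g, hg, hge⟩ := exists_computable_phi_eq (f := _) h.to_comp
  refine ⟨g, hg, fun flip e => ⟨fun x => ?_, fun k => ?_, fun k => ?_, fun n R v => ?_,
    fun n F => isEmptyElim F⟩⟩
  · simp only [hge, treeStr, PFun.coe_val, Nat.unpair_pair, if_true]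
    congr!
  · simp [hge, treeSig]
  · simp [hge, treeSig]
  · rw [hge]
    simp only [PFun.coe_val, Nat.unpair_pair, OfNat.ofNat_ne_zero, if_false,
      Denumerable.ofNat_encode]
    rfl

/-- The node of level `n` of the path `F`. -/
def pathNode (F : ℕ → ℕ) (n : ℕ) : ℕ := Encodable.encode (initSeg F n).reverse

theorem parent_pathNode (F : ℕ → ℕ) (n : ℕ) : parent (pathNode F (n + 1)) = pathNode F n := by
  simp [parent, pathNode, initSeg_succ]

/-- Add the node of the path `F` to a set of nodes, modulo 2. -/
def toggle (F : ℕ → ℕ) (z : ℕ) : ℕ :=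
  Nat.pair z.unpair.1 (z.unpair.2 ^^^ 2 ^ pathNode F z.unpair.1)

theorem toggle_toggle (F : ℕ → ℕ) (z : ℕ) : toggle F (toggle F z) = z := by
  simp [toggle]

theorem isNodeSet_toggle {e : ℕ} {F : ℕ → ℕ} (hF : Avoids e F) {z : ℕ} (hz : IsNodeSet e z) :
    IsNodeSet e (toggle F z) := by
  rw [isNodeSet_iff] at hz ⊢
  simp only [toggle, Nat.unpair_pair, digit_xor_two_pow_eq_one]
  intro m hm
  by_cases h : m = pathNode F z.unpair.1
  · subst h
    simp only [IsNode, pathNode, Denumerable.ofNat_encode, List.length_reverse,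
      length_initSeg, List.reverse_reverse, true_and]
    exact avoids_iff_inTree.1 hF _
  · exact hz m (hm.2 h)

/-- Adding one node changes the parity of a set. It respects the projection because the parent of
the path's node at a level is the path's node at the level before, so both sides change at the same
position. -/
theorem nodeRel_toggle (F : ℕ → ℕ) {k n : ℕ} (hk : treeSig.rel k = some n) (v : Fin n → ℕ) :
    NodeRel 1 k (List.ofFn fun i => toggle F (v i)) ↔ NodeRel 0 k (List.ofFn v) := by
  rcases eq_or_ne k 1 with rfl | hk1
  · obtain rfl : 2 = n := by simpa [treeSig] using hk
    simp only [NodeRel, List.ofFn_succ, List.headI_cons, List.tail_cons, projection_iff,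
      one_ne_zero, false_and, true_and, false_or, lt_irrefl, or_false]
    simp only [toggle, Nat.unpair_pair]
    refine and_congr_right fun h => forall_congr' fun j => ?_
    rw [digit_xor_two_pow, digitCount_xor_two_pow, h, parent_pathNode]
    have := digit_eq_zero_or_one (v (Fin.succ 0)).unpair.2 j
    split_ifs <;> lia
  · obtain rfl : 1 = n := by simpa [treeSig, hk1] using hk
    simp only [NodeRel, List.ofFn_succ, List.headI_cons, hk1, false_and, false_or]
    simp only [toggle, Nat.unpair_pair, digitCount_xor_two_pow, if_true]
    refine or_congr (and_congr_right fun _ => ?_) Iff.rfl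
    lia

/-- The bijection `toggle`, between the structures coding a tree with a path. -/
def toggleEquiv {e : ℕ} {F : ℕ → ℕ} (hF : Avoids e F) : treeStr 0 e ≃ treeStr 1 e where
  toFun z := ⟨toggle F z.1, isNodeSet_toggle hF z.2⟩
  invFun z := ⟨toggle F z.1, isNodeSet_toggle hF z.2⟩
  left_inv z := Subtype.ext (toggle_toggle F z.1)
  right_inv z := Subtype.ext (toggle_toggle F z.1)

theorem toggleEquiv_val {e : ℕ} {F : ℕ → ℕ} (hF : Avoids e F) (z : treeStr 0 e) :
    (toggleEquiv hF z).1 = toggle F z.1 := rfl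

theorem nonempty_treeStr_equiv {e : ℕ} (h : ∃ F, Avoids e F) :
    Nonempty (treeStr 0 e ≃[treeSig.lang] treeStr 1 e) := by
  obtain ⟨F, hF⟩ := h
  refine ⟨{ toEquiv := toggleEquiv hF, map_fun' := fun G => isEmptyElim G, map_rel' := ?_ }⟩
  intro n R v
  rw [treeStr_relMap, treeStr_relMap]
  have hR : treeSig.rel R.1 = some n := R.2
  have := nodeRel_toggle F hR fun i => (v i).1
  simp only [← toggleEquiv_val hF] at this
  exact this

end Collegiate
end

noncomputable section

namespace Collegiate

open FirstOrder.Language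

/-! ### Programs with an oracle -/

/-- One program works for all oracles. This keeps the program transformations below independent of
the set `D`. -/
theorem OCode.exists_eval_eq {f : ℕ →. ℕ} (hf : Nat.Partrec f) :
    ∃ c : OCode, ∀ g, c.eval g = f := by
  induction hf with
  | zero => exact ⟨zero, fun _ => rfl⟩
  | succ => exact ⟨succ, fun _ => rfl⟩
  | left => exact ⟨left, fun _ => rfl⟩
  | right => exact ⟨right, fun _ => rfl⟩
  | pair _ _ h₁ h₂ =>
    obtain ⟨c₁, h₁⟩ := h₁
    obtain ⟨c₂, h₂⟩ := h₂
    exact ⟨pair c₁ c₂, fun g => by simp only [eval, h₁, h₂]; rfl⟩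
  | comp _ _ h₁ h₂ =>
    obtain ⟨c₁, h₁⟩ := h₁
    obtain ⟨c₂, h₂⟩ := h₂
    exact ⟨comp c₁ c₂, fun g => by simp only [eval, h₁, h₂]; rfl⟩
  | prec _ _ h₁ h₂ =>
    obtain ⟨c₁, h₁⟩ := h₁
    obtain ⟨c₂, h₂⟩ := h₂
    exact ⟨prec c₁ c₂, fun g => by simp only [eval, h₁, h₂]; rfl⟩
  | rfind _ h =>
    obtain ⟨c, h⟩ := h
    exact ⟨rfind c, fun g => by simp only [eval, h]; rfl⟩

theorem OCode.exists_eval_eq_some {f : ℕ → ℕ} (hf : Primrec f) :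
    ∃ c : OCode, ∀ g n, c.eval g n = Part.some (f n) := by
  obtain ⟨c, hc⟩ := OCode.exists_eval_eq (Nat.Partrec.of_primrec (Primrec.nat_iff.1 hf))
  exact ⟨c, fun g n => by rw [hc]; rfl⟩

theorem OCode.eval_comp_of_eq {g : ℕ →. ℕ} {c d : OCode} {n m : ℕ}
    (h : d.eval g n = Part.some m) : (comp c d).eval g n = c.eval g m := by
  simp only [eval, h]
  exact Part.bind_some _ _

theorem OCode.eval_pair_of_eq {g : ℕ →. ℕ} {c d : OCode} {n a b : ℕ}
    (h₁ : c.eval g n = Part.some a) (h₂ : d.eval g n = Part.some b) :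
    (pair c d).eval g n = Part.some (Nat.pair a b) := by
  simp [eval, h₁, h₂, Seq.seq]

theorem OCode.eval_prec_of_eq {g : ℕ →. ℕ} {c d : OCode} {a : ℕ} {f : ℕ → ℕ}
    (h₁ : c.eval g a = Part.some (f 0))
    (h₂ : ∀ n, d.eval g (Nat.pair a (Nat.pair n (f n))) = Part.some (f (n + 1))) (n : ℕ) :
    (prec c d).eval g (Nat.pair a n) = Part.some (f n) := by
  simp only [eval, Nat.unpair_pair]
  induction n with
  | zero => exact h₁
  | succ n ih =>
    simp only [ih]
    simp [h₂]

/-- The number of the composition of programs with given numbers. -/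
def compIndex (a b : ℕ) : ℕ := 2 * (2 * Nat.pair a b + 1) + 5

/-- The number of the pairing of programs with given numbers. -/
def pairIndex (a b : ℕ) : ℕ := 2 * (2 * Nat.pair a b) + 5

/-- The number of the primitive recursion given by programs with given numbers. -/
def precIndex (a b : ℕ) : ℕ := (2 * (2 * Nat.pair a b) + 1) + 5

theorem encode_comp (c d : OCode) : Encodable.encode (OCode.comp c d) =
    compIndex (Encodable.encode c) (Encodable.encode d) := rfl

theorem encode_pair (c d : OCode) : Encodable.encode (OCode.pair c d) =
    pairIndex (Encodable.encode c) (Encodable.encode d) := rfl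

theorem encode_prec (c d : OCode) : Encodable.encode (OCode.prec c d) =
    precIndex (Encodable.encode c) (Encodable.encode d) := rfl

theorem exists_oracleEval_eq {g : ℕ →. ℕ} {D : Set ℕ} (h : TuringReducible g (charFun D)) :
    ∃ c, oracleEval c D = g := by
  obtain ⟨c, hc⟩ := OCode.exists_eval_iff.2 h
  exact ⟨Encodable.encode c, by rw [oracleEval, Denumerable.ofNat_encode, hc]⟩

theorem turingReducible_oracleEval (c : ℕ) (D : Set ℕ) :
    TuringReducible (oracleEval c D) (charFun D) :=
  OCode.exists_eval_iff.1 ⟨_, rfl⟩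

/-! ### Paths from embeddings -/

/-- The first child of the node `m` in the set of nodes given by `z`. -/
def childIn (m z : ℕ) : ℕ :=
  (filterMem (List.range z.unpair.2) fun i => digit z.unpair.2 i = 1 ∧ parent i = m).headI

@[fun_prop] theorem primrec_childIn {α : Type*} [Primcodable α] {f g : α → ℕ} (hf : Primrec f)
    (hg : Primrec g) : Primrec fun a => childIn (f a) (g a) := by
  unfold childIn
  fun_prop

theorem childIn_spec {m z : ℕ} (h : digitCount (fun i => parent i = m) z.unpair.2 % 2 = 1) :
    digit z.unpair.2 (childIn m z) = 1 ∧ parent (childIn m z) = m := by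
  obtain ⟨i, hi, him⟩ := exists_of_digitCount_odd h
  have hmem : i ∈ filterMem (List.range z.unpair.2) fun i =>
      digit z.unpair.2 i = 1 ∧ parent i = m :=
    mem_filterMem.2 ⟨List.mem_range.2 (lt_of_digit_eq_one hi), hi, him⟩
  have hhead : childIn m z ∈ filterMem (List.range z.unpair.2) fun i =>
      digit z.unpair.2 i = 1 ∧ parent i = m := by
    unfold childIn
    generalize filterMem (List.range z.unpair.2) (fun i => digit z.unpair.2 i = 1 ∧ parent i = m)
      = l at hmem
    cases l with
    | nil => simp at hmem
    | cons a l => simp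
  exact (mem_filterMem.1 hhead).2

/-- The nodes chosen successively from the sets of nodes `X n`. -/
def chosenNode (X : ℕ → ℕ) (n : ℕ) : ℕ := n.rec 0 fun k m => childIn m (X (k + 1))

/-- The path through the nodes chosen successively from the sets of nodes `X n`. -/
def chosenPath (X : ℕ → ℕ) (n : ℕ) : ℕ :=
  (Denumerable.ofNat (List ℕ) (chosenNode X (n + 1))).headI

/-- The odd set `X 0` is nonempty and so contains the root. By the projection condition, a node of
`X n` has an odd number of children in `X (n + 1)`, hence at least one. -/
theorem avoids_chosenPath {e : ℕ} {X : ℕ → ℕ} (hX : ∀ n, IsNodeSet e (X n))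
    (hl : ∀ n, (X n).unpair.1 = n) (h0 : digitCount (fun _ => True) (X 0).unpair.2 % 2 = 1)
    (hp : ∀ n j, digit (X n).unpair.2 j =
      digitCount (fun i => parent i = j) (X (n + 1)).unpair.2 % 2) :
    Avoids e (chosenPath X) := by
  have node : ∀ n m, digit (X n).unpair.2 m = 1 → IsNode e n m := by
    intro n m hm
    have := isNodeSet_iff.1 (hX n) m hm
    rwa [hl] at this
  have key : ∀ n, digit (X n).unpair.2 (chosenNode X n) = 1 := by
    intro n
    induction n with
    | zero =>
      obtain ⟨i, hi, -⟩ := exists_of_digitCount_odd h0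
      have h1 := List.eq_nil_of_length_eq_zero (node 0 i hi).1
      -- The root is the empty sequence, with code 0, which is where `chosenNode` starts.
      have h2 : i = 0 := by
        rw [← Denumerable.encode_ofNat (α := List ℕ) i, h1]
        rfl
      rwa [h2] at hi
    | succ n ih =>
      rw [hp] at ih
      exact (childIn_spec ih).1
  have hpar : ∀ n, parent (chosenNode X (n + 1)) = chosenNode X n := by
    intro n
    have := key n
    rw [hp] at this
    exact (childIn_spec this).2
  have hpath : ∀ n, pathNode (chosenPath X) n = chosenNode X n := by
    intro n
    induction n with
    | zero => rfl
    | succ n ih =>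
      have hlen := (node _ _ (key (n + 1))).1
      have hpn := hpar n
      rw [← ih] at hpn
      simp only [pathNode, parent, Encodable.encode_inj] at hpn
      rw [pathNode, initSeg_succ, List.reverse_append, ← hpn, chosenPath]
      conv_rhs => rw [← Denumerable.encode_ofNat (α := List ℕ) (chosenNode X (n + 1))]
      generalize Denumerable.ofNat (List ℕ) (chosenNode X (n + 1)) = l at hlen
      cases l with
      | nil => simp at hlen
      | cons a l => simp
  rw [avoids_iff_inTree]
  intro n
  have := (node _ _ (key n)).2
  rw [← hpath, pathNode, Denumerable.ofNat_encode, List.reverse_reverse] at this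
  exact this

/-- There is a uniform procedure to compute a path of a tree from any embedding of the structures
coding the tree. -/
theorem exists_pathIndex : ∃ p : ℕ → ℕ, Primrec p ∧
    ∀ (e c : ℕ) (D : Set ℕ) (h : treeStr 0 e ↪[treeSig.lang] treeStr 1 e),
      Extends (oracleEval c D) h →
      ∃ F, Avoids e F ∧ ∀ n, oracleEval (p c) D n = Part.some (F n) := by
  obtain ⟨cK, hK⟩ := OCode.exists_eval_eq_some
    (f := fun w => childIn w.unpair.1 w.unpair.2) (by fun_prop)
  obtain ⟨cR, hR⟩ := OCode.exists_eval_eq_some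
    (f := fun w => w.unpair.2.unpair.2) (by fun_prop)
  obtain ⟨cQ, hQ⟩ := OCode.exists_eval_eq_some
    (f := fun w => Nat.pair (w.unpair.2.unpair.1 + 1) 0) (by fun_prop)
  obtain ⟨cH, hH⟩ := OCode.exists_eval_eq_some
    (f := fun w => (Denumerable.ofNat (List ℕ) w).headI) (by fun_prop)
  -- On the recursion input `(a, (k, m))`, `cQ` produces the empty set of level `k + 1`, `c` maps it
  -- to its image, and `cK` picks a child of `m` there. The result after `n + 1` rounds is a
  -- reversed sequence, whose head is the value at `n`.
  let code : OCode → OCode := fun c =>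
    .comp cH (.comp (.prec .zero (.comp cK (.pair cR (.comp c cQ)))) (.pair .zero .succ))
  refine ⟨fun c => Encodable.encode (code (Denumerable.ofNat OCode c)), ?_, ?_⟩
  · simp only [code, encode_comp, encode_pair, encode_prec, Denumerable.encode_ofNat]
    simp only [compIndex, pairIndex, precIndex]
    fun_prop
  · intro e c D h hc
    have hmem : ∀ n, Nat.pair n 0 ∈ (treeStr 0 e).carrier := by
      intro n
      refine isNodeSet_iff.2 fun m hm => ?_
      simp [digit] at hm
    let X : ℕ → ℕ := fun n => (h ⟨Nat.pair n 0, hmem n⟩).1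
    have hX : ∀ n, oracleEval c D (Nat.pair n 0) = Part.some (X n) := fun n => hc ⟨_, hmem n⟩
    have rel : ∀ {k n : ℕ} (hk : treeSig.rel k = some n) (v : Fin n → ℕ),
        NodeRel 0 k (List.ofFn fun i => Nat.pair (v i) 0) → NodeRel 1 k
          (List.ofFn fun i => X (v i)) := by
      intro k n hk v hv
      have := h.map_rel (Signature.relSym hk) fun i => ⟨Nat.pair (v i) 0, hmem (v i)⟩
      rw [treeStr_relMap, treeStr_relMap] at this
      exact this.2 hv
    have hcount : ∀ Q, digitCount Q 0 = 0 := fun Q => by simp [digitCount, filterMem]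
    refine ⟨chosenPath X, avoids_chosenPath (fun n => (h ⟨Nat.pair n 0, hmem n⟩).2) ?_ ?_ ?_, ?_⟩
    · intro n
      -- The relation `n + 2` fixes the level of the image. Below, relation 0 holds of the empty
      -- (even) set and so makes its image odd, and relation 1 yields the projection condition.
      have := rel (k := n + 2) (n := 1) (by simp [treeSig]) (fun _ => n) (by simp [NodeRel])
      simpa [NodeRel] using this
    · have := rel (k := 0) (n := 1) (by simp [treeSig]) (fun _ => 0) (by simp [NodeRel, hcount])
      simpa [NodeRel] using this
    · intro n
      have := rel (k := 1) (n := 2) (by simp [treeSig]) (![n + 1, n])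
        (by simp [NodeRel, AllMem])
      simp only [NodeRel, List.ofFn_succ, List.headI_cons, List.tail_cons, projection_iff] at this
      simp only [one_ne_zero, false_and, true_and, false_or, lt_irrefl, or_false] at this
      exact this.2
    · intro n
      have hX' : ∀ n, OCode.eval (charFun D) (Denumerable.ofNat OCode c) (Nat.pair n 0) =
        Part.some (X n) := hX
      rw [oracleEval, Denumerable.ofNat_encode]
      have hN : ∀ n, OCode.eval (charFun D) (.prec .zero
          (.comp cK (.pair cR (.comp (Denumerable.ofNat OCode c) cQ)))) (Nat.pair 0 n) =
          Part.some (chosenNode X n) := by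
        refine OCode.eval_prec_of_eq rfl fun n => ?_
        rw [OCode.eval_comp_of_eq (OCode.eval_pair_of_eq (hR _ _)
          ((OCode.eval_comp_of_eq (hQ _ _)).trans (hX' _))), hK]
        simp [chosenNode]
      rw [OCode.eval_comp_of_eq ((OCode.eval_comp_of_eq
        (OCode.eval_pair_of_eq (a := 0) (b := n + 1) rfl rfl)).trans (hN _)), hH]
      rfl

/-! ### Degrees that compute paths -/

/-- The degree `d` computes a member of every nonempty class. -/
def ComputesPaths (d : TuringDegree) : Prop :=
  ∀ e, (∃ F, Avoids e F) → ∃ D : Set ℕ, degreeOf D = d ∧ ∃ (c : ℕ) (F : ℕ → ℕ), Avoids e F ∧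
    ∀ n, oracleEval c D n = Part.some (F n)

/-- The degree `d` computes a member of every nonempty class, uniformly in an index of the
class. -/
def UniformlyComputesPaths (d : TuringDegree) : Prop :=
  ∃ D : Set ℕ, degreeOf D = d ∧ ∃ f : ℕ → ℕ, Computable f ∧ ∀ e, (∃ F, Avoids e F) →
    ∃ F, Avoids e F ∧ ∀ n, oracleEval (f e) D n = Part.some (F n)

theorem computesPaths_of_treeStr {d : TuringDegree}
    (h : ∀ e, Nonempty (treeStr 0 e ≃[treeSig.lang] treeStr 1 e) →
      ∃ h : treeStr 0 e ↪[treeSig.lang] treeStr 1 e, Computes d h) : ComputesPaths d := by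
  obtain ⟨p, -, hp⟩ := exists_pathIndex
  intro e he
  obtain ⟨h, D, hD, g, hg, hgh⟩ := h e (nonempty_treeStr_equiv he)
  obtain ⟨c, rfl⟩ := exists_oracleEval_eq hg
  obtain ⟨F, hF⟩ := hp e c D h hgh
  exact ⟨D, hD, p c, F, hF⟩

theorem isComputableStructure_treeStr (flip e : ℕ) : IsComputableStructure (treeStr flip e) := by
  obtain ⟨g, -, hg⟩ := exists_treeIndex
  exact ⟨_, hg flip e⟩

theorem HighForIsomorphism.computesPaths {d : TuringDegree} (h : HighForIsomorphism d) :
    ComputesPaths d := by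
  refine computesPaths_of_treeStr fun e he => ?_
  obtain ⟨f, hf⟩ := h _ _ _ (isComputableStructure_treeStr 0 e)
    (isComputableStructure_treeStr 1 e) he
  exact ⟨f.toEmbedding, hf⟩

theorem IsCollegiate.computesPaths {α : Ordinal.{0}} {d : TuringDegree} (h : IsCollegiate α d) :
    ComputesPaths d := by
  refine computesPaths_of_treeStr fun e he => ?_
  obtain ⟨f⟩ := he
  obtain ⟨f, -, hf⟩ := h 0 (zero_le (a := α)) _ _ _ (isComputableStructure_treeStr 0 e)
    (isComputableStructure_treeStr 1 e) ⟨f.toEmbedding, isSigmaElementary_zero _⟩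
  exact ⟨f, hf⟩

theorem uniformlyComputesPaths_of_treeStr {d : TuringDegree} {D : Set ℕ} (hD : degreeOf D = d)
    {f : ℕ → ℕ → ℕ} (hf : Computable₂ f)
    (h : ∀ e i j, IsIndex i (treeStr 0 e) → IsIndex j (treeStr 1 e) →
      Nonempty (treeStr 0 e ≃[treeSig.lang] treeStr 1 e) →
      ∃ h : treeStr 0 e ↪[treeSig.lang] treeStr 1 e, Extends (oracleEval (f i j) D) h) :
    UniformlyComputesPaths d := by
  obtain ⟨p, hp, hpe⟩ := exists_pathIndex
  obtain ⟨g, hg, hge⟩ := exists_treeIndex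
  refine ⟨D, hD, fun e => p (f (g (0, e)) (g (1, e))), ?_, fun e he => ?_⟩
  · exact hp.to_comp.comp (hf.comp (hg.comp ((Computable.const 0).pair Computable.id))
      (hg.comp ((Computable.const 1).pair Computable.id)))
  · obtain ⟨h, hh⟩ := h e _ _ (hge 0 e) (hge 1 e) (nonempty_treeStr_equiv he)
    exact hpe e _ D h hh

theorem UniformlyHighForIsomorphism.uniformlyComputesPaths {d : TuringDegree}
    (h : UniformlyHighForIsomorphism d) : UniformlyComputesPaths d := by
  obtain ⟨D, hD, f, hf, h⟩ := h
  refine uniformlyComputesPaths_of_treeStr hD hf fun e i j hi hj he => ?_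
  obtain ⟨g, hg⟩ := h _ _ _ i j hi hj he
  exact ⟨g.toEmbedding, hg⟩

theorem LevelwiseUniformlyCollegiate.uniformlyComputesPaths {α : Ordinal.{0}} {d : TuringDegree}
    (h : LevelwiseUniformlyCollegiate α d) : UniformlyComputesPaths d := by
  obtain ⟨D, hD, f, hf, h⟩ := h 0 (zero_le (a := α))
  refine uniformlyComputesPaths_of_treeStr hD hf fun e i j hi hj he => ?_
  obtain ⟨g⟩ := he
  obtain ⟨g, -, hg⟩ := h _ _ _ i j hi hj ⟨g.toEmbedding, isSigmaElementary_zero _⟩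
  exact ⟨g, hg⟩

end Collegiate
end

noncomputable section

namespace Collegiate

open FirstOrder.Language Filter

/-! ### Computing the results of tests -/

/-- The result of the test `t` on the list `u`, in the structure with index `i`, if it is found in
`st` steps. -/
def testValue (st i : ℕ) (u : List ℕ) (t : Test) : Option ℕ :=
  if t.1 = 0 then some (if u[t.2.1]? = u[t.2.2.1]? then 1 else 0)
  else if (select u t.2.2.2).length = t.2.2.2.length then
    if t.1 = 1 then
      if phiSteps st i (Nat.pair 1 t.2.1) = some (Encodable.encode (some t.2.2.2.length)) then
        phiSteps st i (Nat.pair 3 (Nat.pair t.2.1 (Encodable.encode (select u t.2.2.2))))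
      else none
    else if phiSteps st i (Nat.pair 2 t.2.1) = some (Encodable.encode (some t.2.2.2.length)) then
      (phiSteps st i (Nat.pair 4 (Nat.pair t.2.1 (Encodable.encode (select u t.2.2.2))))).map
        fun p => if u[t.2.2.1]? = some p then 1 else 0
    else none
  else none

@[fun_prop] theorem primrec_testValue {α : Type*} [Primcodable α] {f g : α → ℕ} {u : α → List ℕ}
    {t : α → Test} (hf : Primrec f) (hg : Primrec g) (hu : Primrec u) (ht : Primrec t) :
    Primrec fun a => testValue (f a) (g a) (u a) (t a) := by
  unfold testValue select
  fun_prop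

variable {S : Signature}

/-- The test `t` makes sense for lists of length `n`. -/
def TestApplies (S : Signature) (n : ℕ) (t : Test) : Prop :=
  t.1 = 0 ∨ (∀ i ∈ t.2.2.2, i < n) ∧
    ((t.1 = 1 ∧ S.rel t.2.1 = some t.2.2.2.length) ∨
      (t.1 ≠ 0 ∧ t.1 ≠ 1 ∧ S.fn t.2.1 = some t.2.2.2.length))

/-- Applicability depends only on the signature and the length of the list. A test that does not
apply fails on all lists of that length and can never cause disagreement. -/
theorem Holds.testApplies {M : Type} [S.lang.Structure M] {u : List M} {t : Test}
    (h : Holds S u t) : TestApplies S u.length t := by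
  obtain ⟨kd, k, w, l⟩ := t
  match kd with
  | 0 => exact Or.inl rfl
  | 1 =>
    obtain ⟨h1, h2, -⟩ := h
    exact Or.inr ⟨h1, Or.inl ⟨rfl, by rw [h2, length_select_eq_iff.2 h1]⟩⟩
  | n + 2 =>
    obtain ⟨h1, p, -, h2, -⟩ := h
    exact Or.inr ⟨h1, Or.inr ⟨by simp, by simp, by rw [h2, length_select_eq_iff.2 h1]⟩⟩

open Classical in
theorem phi_relHolds {i : ℕ} {P : NatStructure S} (hi : IsIndex i P) {k : ℕ} {r : List P}
    (hk : S.rel k = some r.length) :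
    phi i (Nat.pair 3 (Nat.pair k (Encodable.encode (r.map Subtype.val)))) =
      Part.some (if RelHolds S k r then 1 else 0) := by
  have h := hi.2.2.2.1 r.length (Signature.relSym hk) r.get
  have h1 : (List.ofFn fun i => (r.get i : ℕ)) = r.map Subtype.val := by
    rw [← Function.comp_def Subtype.val r.get, ← List.map_ofFn, List.ofFn_get]
  rw [h1] at h
  have h2 : RelHolds S k r ↔ Structure.RelMap (Signature.relSym hk) r.get :=
    ⟨fun ⟨_, h⟩ => h, fun h => ⟨hk, h⟩⟩
  simp only [h2]
  exact h

theorem exists_phi_fnValue {i : ℕ} {P : NatStructure S} (hi : IsIndex i P) {k : ℕ} {r : List P}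
    (hk : S.fn k = some r.length) : ∃ p : P,
    phi i (Nat.pair 4 (Nat.pair k (Encodable.encode (r.map Subtype.val)))) = Part.some p.1 ∧
      ∀ p', FnValue S k r p' ↔ p = p' := by
  have h := hi.2.2.2.2 r.length (Signature.fnSym hk) r.get
  have h1 : (List.ofFn fun i => (r.get i : ℕ)) = r.map Subtype.val := by
    rw [← Function.comp_def Subtype.val r.get, ← List.map_ofFn, List.ofFn_get]
  rw [h1] at h
  exact ⟨_, h, fun p' => ⟨fun ⟨_, h⟩ => h, fun h => ⟨hk, h⟩⟩⟩

open Classical in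
theorem eventually_testValue {i : ℕ} {P : NatStructure S} (hi : IsIndex i P) {u : List P}
    {t : Test} (ht : TestApplies S u.length t) :
    ∀ᶠ st in atTop, testValue st i (u.map Subtype.val) t =
      some (if Holds S u t then 1 else 0) := by
  have get : ∀ n : ℕ, (u.map Subtype.val)[n]? = u[n]?.map Subtype.val := fun n => by simp
  obtain ⟨kd, k, w, l⟩ := t
  match kd with
  | 0 =>
    refine Eventually.of_forall fun st => ?_
    simp only [testValue, if_true, Holds, get,
      (Option.map_injective Subtype.val_injective).eq_iff]
    by_cases h : u[k]? = u[w]? <;> simp only [h, if_true, if_false]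
  | 1 =>
    simp only [TestApplies, one_ne_zero, false_or, true_and, ne_eq, not_true_eq_false,
      false_and, and_false, or_false] at ht
    have hl : (select (u.map Subtype.val) l).length = l.length := by
      simpa [length_select_eq_iff] using ht.1
    have hk : S.rel k = some (select u l).length := by rw [ht.2, length_select_eq_iff.2 ht.1]
    filter_upwards [eventually_phiSteps (hi.2.1 k), eventually_phiSteps (phi_relHolds hi hk)]
      with st h1 h2
    have h3 : Holds S u (1, k, w, l) ↔ RelHolds S k (select u l) := and_iff_right ht.1
    rw [testValue, if_neg one_ne_zero, if_pos hl, if_pos rfl, if_pos (ht.2 ▸ h1), select_map, h2]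
    simp only [h3]
  | n + 2 =>
    obtain ⟨h1, h2⟩ : (∀ i ∈ l, i < u.length) ∧ S.fn k = some l.length := by
      simpa [TestApplies] using ht
    have hl : (select (u.map Subtype.val) l).length = l.length := by
      simpa [length_select_eq_iff] using h1
    have hk : S.fn k = some (select u l).length := by rw [h2, length_select_eq_iff.2 h1]
    obtain ⟨p, hp, hpv⟩ := exists_phi_fnValue hi hk
    filter_upwards [eventually_phiSteps (hi.2.2.1 k), eventually_phiSteps hp] with st h3 h4
    have h5 : (Option.map Subtype.val u[w]? = some p.1) ↔ u[w]? = some p := by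
      rw [← Option.map_some, (Option.map_injective Subtype.val_injective).eq_iff]
    have h6 : Holds S u (n + 2, k, w, l) ↔ u[w]? = some p := by
      simp only [Holds, hpv]
      exact ⟨fun ⟨_, p', h, h'⟩ => h' ▸ h, fun h => ⟨h1, p, h, rfl⟩⟩
    rw [testValue, if_neg (by simp), if_pos hl, if_neg (by simp), if_pos (h2 ▸ h3), select_map, h4]
    simp only [h6, get, Option.map_some, h5]

theorem testValue_mono {st st' i v : ℕ} {u : List ℕ} {t : Test} (h : testValue st i u t = some v)
    (hst : st ≤ st') : testValue st' i u t = some v := by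
  rw [testValue] at h ⊢
  by_cases h1 : t.1 = 0
  · rwa [if_pos h1] at h ⊢
  · rw [if_neg h1] at h ⊢
    obtain ⟨h2, h⟩ := Option.ite_none_right_eq_some.1 h
    rw [if_pos h2]
    by_cases h3 : t.1 = 1
    · rw [if_pos h3] at h ⊢
      obtain ⟨h4, h⟩ := Option.ite_none_right_eq_some.1 h
      rw [if_pos (phiSteps_mono h4 hst), phiSteps_mono h hst]
    · rw [if_neg h3] at h ⊢
      obtain ⟨h4, h⟩ := Option.ite_none_right_eq_some.1 h
      obtain ⟨p, hp, h⟩ := Option.map_eq_some_iff.1 h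
      rw [if_pos (phiSteps_mono h4 hst), phiSteps_mono hp hst, Option.map_some, h]

theorem testApplies_of_testValue {st i v : ℕ} {P : NatStructure S} (hi : IsIndex i P) {u : List P}
    {t : Test} (h : testValue st i (u.map Subtype.val) t = some v) :
    TestApplies S u.length t := by
  rw [testValue] at h
  by_cases h1 : t.1 = 0
  · exact Or.inl h1
  · rw [if_neg h1] at h
    obtain ⟨h2, h⟩ := Option.ite_none_right_eq_some.1 h
    rw [length_select_eq_iff, List.length_map] at h2
    by_cases h3 : t.1 = 1
    · rw [if_pos h3] at h
      have := phi_eq_of_phiSteps (Option.ite_none_right_eq_some.1 h).1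
      rw [hi.2.1] at this
      exact Or.inr ⟨h2, Or.inl ⟨h3, Encodable.encode_injective (Part.some_injective this)⟩⟩
    · rw [if_neg h3] at h
      have := phi_eq_of_phiSteps (Option.ite_none_right_eq_some.1 h).1
      rw [hi.2.2.1] at this
      exact Or.inr ⟨h2, Or.inr ⟨h1, h3, Encodable.encode_injective (Part.some_injective this)⟩⟩

open Classical in
theorem testValue_eq {st i v : ℕ} {P : NatStructure S} (hi : IsIndex i P) {u : List P}
    {t : Test} (h : testValue st i (u.map Subtype.val) t = some v) :
    v = if Holds S u t then 1 else 0 := by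
  have happ := testApplies_of_testValue hi h
  obtain ⟨st', h1, h2⟩ := ((eventually_testValue hi happ).and (eventually_ge_atTop st)).exists
  rw [testValue_mono h h2] at h1
  exact Option.some_injective _ h1

/-- The test `t` is found in `st` steps to have different results on the lists `u` and `w`. -/
def Mismatch (st i j : ℕ) (u w : List ℕ) (t : Test) : Prop :=
  ¬ testValue st i u t = none ∧ ¬ testValue st j w t = none ∧
    ¬ testValue st i u t = testValue st j w t

/-- This makes agreement a Π⁰₁ condition. If the results differ, the test succeeds on one list,
hence applies to both, so both computations terminate and show the difference at a finite stage. -/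
theorem agree_iff_not_mismatch {i j N : ℕ} {P Q : NatStructure S} (hi : IsIndex i P)
    (hj : IsIndex j Q) {u : List P} {w : List Q} (hl : u.length = w.length) :
    Agree S N u w ↔ ∀ st t, Encodable.encode t < N →
      ¬ Mismatch st i j (u.map Subtype.val) (w.map Subtype.val) t := by
  classical
  constructor
  · rintro h st t ht ⟨h1, h2, h3⟩
    obtain ⟨v1, h1⟩ := Option.ne_none_iff_exists'.1 h1
    obtain ⟨v2, h2⟩ := Option.ne_none_iff_exists'.1 h2
    refine h3 ?_
    have := h t ht
    rw [h1, h2, testValue_eq hi h1, testValue_eq hj h2]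
    simp only [this]
  · intro h t ht
    by_contra hc
    have happ : TestApplies S u.length t := by
      by_cases h1 : Holds S u t
      · exact h1.testApplies
      · rw [hl]
        exact (show Holds S w t by tauto).testApplies
    obtain ⟨st, h1, h2⟩ := ((eventually_testValue hi happ).and
      (eventually_testValue hj (hl ▸ happ))).exists
    refine h st t ht ⟨h1 ▸ Option.some_ne_none _, h2 ▸ Option.some_ne_none _, ?_⟩
    rw [h1, h2]
    by_cases h3 : Holds S u t <;> by_cases h4 : Holds S w t <;> simp_all

/-! ### The conditions -/

/-- A position: the level, `0` for the top and `x + 1` for the element `x` of a linear order, a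
side, and a tuple of the structure on that side and a tuple of the other structure. -/
abbrev Position : Type := ℕ × Bool × List ℕ × List ℕ

/-- A move at a position: the next level, a tuple of the structure on the other side, and a bound
for the tests that the response has to pass. -/
abbrev Move : Type := ℕ × List ℕ × ℕ

/-- The argument at which a function codes the image of `z`. -/
def imageKey (z : ℕ) : ℕ := Nat.pair 0 z

/-- The argument at which a function codes the response to a move. -/
def responseKey (q : Position) (m : Move) : ℕ := Nat.pair 1 (Encodable.encode (q, m))

/-- The argument at which a function codes the preimage of `z`. -/
def preimageKey (z : ℕ) : ℕ := Nat.pair 2 z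

/-- The index of the structure on a side. -/
def sideIndex (i j : ℕ) (s : Bool) : ℕ := if s = true then i else j

/-- All elements of `l` are found in `st` steps to be in the structure with index `i`. -/
def ListIn (st i : ℕ) (l : List ℕ) : Prop :=
  AllMem l fun z => phiSteps st i (Nat.pair 0 z) = some 1

/-- Some element of `l` is found in `st` steps not to be in the structure with index `i`. -/
def ListNotIn (st i : ℕ) (l : List ℕ) : Prop :=
  ¬ AllMem l fun z => ¬ phiSteps st i (Nat.pair 0 z) = some 0

/-- The move `m` at `q` is found to be legal in `st` steps. -/
def LegalMove (b i j st : ℕ) (q : Position) (m : Move) : Prop :=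
  phiSteps st b (Nat.pair 0 m.1) = some 1 ∧
  (q.1 = 0 ∨ phiSteps st b (Nat.pair 0 (q.1 - 1)) = some 1 ∧
    phiSteps st b (Nat.pair 1 (Nat.pair m.1 (q.1 - 1))) = some 1) ∧
  ListIn st (sideIndex i j !q.2.1) m.2.1

/-- The response `c` to the move `m` at `q` is found to be wrong in `st` steps. -/
def BadResponse (i j st : ℕ) (q : Position) (m : Move) (c : List ℕ) (t : Test) : Prop :=
  ¬ c.length = m.2.1.length ∨ ListNotIn st (sideIndex i j q.2.1) c ∨
  Encodable.encode t < m.2.2 ∧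
    Mismatch st (sideIndex i j !q.2.1) (sideIndex i j q.2.1) (q.2.2.2 ++ m.2.1) (q.2.2.1 ++ c) t

/-- The position after the move `m` at `q` and the response `c`. -/
def nextPosition (q : Position) (m : Move) (c : List ℕ) : Position :=
  (m.1 + 1, !q.2.1, q.2.2.2 ++ m.2.1, q.2.2.1 ++ c)

section

variable {α : Type*} [Primcodable α]

@[fun_prop] theorem primrec_sideIndex {f g : α → ℕ} {s : α → Bool} (hf : Primrec f)
    (hg : Primrec g) (hs : Primrec s) : Primrec fun a => sideIndex (f a) (g a) (s a) := by
  unfold sideIndex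
  fun_prop

@[fun_prop] theorem primrec_imageKey {f : α → ℕ} (hf : Primrec f) :
    Primrec fun a => imageKey (f a) := by
  unfold imageKey
  fun_prop

@[fun_prop] theorem primrec_preimageKey {f : α → ℕ} (hf : Primrec f) :
    Primrec fun a => preimageKey (f a) := by
  unfold preimageKey
  fun_prop

@[fun_prop] theorem primrec_responseKey {f : α → Position} {g : α → Move} (hf : Primrec f)
    (hg : Primrec g) : Primrec fun a => responseKey (f a) (g a) := by
  unfold responseKey
  fun_prop

@[fun_prop] theorem primrecPred_listIn {f g : α → ℕ} {l : α → List ℕ} (hf : Primrec f)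
    (hg : Primrec g) (hl : Primrec l) : PrimrecPred fun a => ListIn (f a) (g a) (l a) := by
  unfold ListIn
  fun_prop

@[fun_prop] theorem primrecPred_listNotIn {f g : α → ℕ} {l : α → List ℕ} (hf : Primrec f)
    (hg : Primrec g) (hl : Primrec l) : PrimrecPred fun a => ListNotIn (f a) (g a) (l a) := by
  unfold ListNotIn
  fun_prop

@[fun_prop] theorem primrecPred_mismatch {f g h : α → ℕ} {u w : α → List ℕ} {t : α → Test}
    (hf : Primrec f) (hg : Primrec g) (hh : Primrec h) (hu : Primrec u) (hw : Primrec w)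
    (ht : Primrec t) : PrimrecPred fun a => Mismatch (f a) (g a) (h a) (u a) (w a) (t a) := by
  unfold Mismatch
  fun_prop

@[fun_prop] theorem primrecPred_legalMove {b i j st : α → ℕ} {q : α → Position} {m : α → Move}
    (hb : Primrec b) (hi : Primrec i) (hj : Primrec j) (hst : Primrec st) (hq : Primrec q)
    (hm : Primrec m) :
    PrimrecPred fun a => LegalMove (b a) (i a) (j a) (st a) (q a) (m a) := by
  unfold LegalMove
  fun_prop

@[fun_prop] theorem primrecPred_badResponse {i j st : α → ℕ} {q : α → Position} {m : α → Move}
    {c : α → List ℕ} {t : α → Test} (hi : Primrec i) (hj : Primrec j) (hst : Primrec st)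
    (hq : Primrec q) (hm : Primrec m) (hc : Primrec c) (ht : Primrec t) :
    PrimrecPred fun a => BadResponse (i a) (j a) (st a) (q a) (m a) (c a) (t a) := by
  unfold BadResponse
  fun_prop

@[fun_prop] theorem primrec_nextPosition {q : α → Position} {m : α → Move} {c : α → List ℕ}
    (hq : Primrec q) (hm : Primrec m) (hc : Primrec c) :
    Primrec fun a => nextPosition (q a) (m a) (c a) := by
  unfold nextPosition
  fun_prop

end

/-- The position `q` is claimed by `F`: there are responses to all moves. -/
def Claims (F : ℕ → ℕ) (q : Position) : Prop := ∀ m, F (responseKey q m) ≠ 0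

/-- The responses given by `F` to legal moves are right, and lead to claimed positions. -/
def GoodResponses (b i j : ℕ) (F : ℕ → ℕ) : Prop :=
  ∀ st q m c, LegalMove b i j st q m → F (responseKey q m) = Encodable.encode c + 1 →
    (∀ st t, ¬ BadResponse i j st q m c t) ∧ Claims F (nextPosition q m c)

/-- The values of `F` on tuples of the first structure pass all tests. -/
def GoodImages (i j : ℕ) (F : ℕ → ℕ) : Prop :=
  ∀ st (l : List ℕ), ListIn st i l → ∀ st t, ¬ ListNotIn st j (l.map fun z => F (imageKey z)) ∧
    ¬ Mismatch st i j l (l.map fun z => F (imageKey z)) t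

/-- The preimages given by `F` are right. -/
def GoodPreimages (i j : ℕ) (F : ℕ → ℕ) : Prop :=
  ∀ st z, ListIn st j [z] → (∀ st, ¬ ListNotIn st i [F (preimageKey z)]) ∧
    F (imageKey (F (preimageKey z))) = z

/-- The positions given by tuples of the first structure and their images are claimed by `F`. -/
def ClaimsImages (i : ℕ) (F : ℕ → ℕ) : Prop :=
  ∀ st (l : List ℕ), ListIn st i l → Claims F (0, true, l, l.map fun z => F (imageKey z)) ∧
    Claims F (0, false, l.map fun z => F (imageKey z), l)

/-- Even arguments list the conditions of one class and odd arguments those of the other. -/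
theorem exists_avoids_and {α : Type*} [Primcodable α] {f g : α → ℕ} (hf : Computable f)
    (hg : Computable g) : ∃ h : α → ℕ, Computable h ∧
      ∀ a F, Avoids (h a) F ↔ Avoids (f a) F ∧ Avoids (g a) F := by
  have hp : Computable fun p : α × ℕ =>
      ((if p.2 % 2 = 0 then f p.1 else g p.1 : ℕ), p.2 / 2) := by
    refine Computable.pair ?_ (Primrec.to_comp (by fun_prop))
    have h1 : Computable fun p : α × ℕ => decide (p.2 % 2 = 0) := by
      refine Primrec.to_comp (PrimrecPred.decide ?_)
      fun_prop
    refine (Computable.cond h1 (hf.comp Computable.fst) (hg.comp Computable.fst)).of_eq ?_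
    intro p
    by_cases h : p.2 % 2 = 0 <;> simp [h]
  obtain ⟨h, hh, hhe⟩ := exists_computable_phi_eq (partrec_phi.comp hp)
  refine ⟨h, hh, fun a F => ?_⟩
  simp only [Avoids, hhe]
  constructor
  · refine fun H => ⟨fun k r hr => H (2 * k) r ?_, fun k r hr => H (2 * k + 1) r ?_⟩
    · simpa using hr
    · simpa [show (2 * k + 1) / 2 = k by lia] using hr
  · rintro ⟨h1, h2⟩ k r hr
    split_ifs at hr
    exacts [h1 _ _ hr, h2 _ _ hr]

open Classical in
-- A wrong response is one value of `F`. A response leading to an unclaimed position is refuted by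
-- two values, the response itself and a zero at the new position.
theorem exists_avoids_goodResponses : ∃ g : ℕ × ℕ × ℕ → ℕ, Computable g ∧
    ∀ b i j F, Avoids (g (b, i, j)) F ↔ GoodResponses b i j F := by
  have h1 : Primrec fun p : (ℕ × ℕ × ℕ) × (ℕ × ℕ × Position × Move × List ℕ × Test) =>
      if LegalMove p.1.1 p.1.2.1 p.1.2.2 p.2.1 p.2.2.2.1 p.2.2.2.2.1 ∧
        BadResponse p.1.2.1 p.1.2.2 p.2.2.1 p.2.2.2.1 p.2.2.2.2.1 p.2.2.2.2.2.1 p.2.2.2.2.2.2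
      then some [(responseKey p.2.2.2.1 p.2.2.2.2.1, Encodable.encode p.2.2.2.2.2.1 + 1)]
      else none := by
    fun_prop
  have h2 : Primrec fun p : (ℕ × ℕ × ℕ) × (ℕ × Position × Move × List ℕ × Move) =>
      if LegalMove p.1.1 p.1.2.1 p.1.2.2 p.2.1 p.2.2.1 p.2.2.2.1
      then some [(responseKey p.2.2.1 p.2.2.2.1, Encodable.encode p.2.2.2.2.1 + 1),
        (responseKey (nextPosition p.2.2.1 p.2.2.2.1 p.2.2.2.2.1) p.2.2.2.2.2, 0)]
      else none := by
    fun_prop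
  obtain ⟨g1, hg1, hge1⟩ := exists_computable_avoids_iff h1
  obtain ⟨g2, hg2, hge2⟩ := exists_computable_avoids_iff h2
  obtain ⟨g, hg, hge⟩ := exists_avoids_and hg1 hg2
  refine ⟨g, hg, fun b i j F => ?_⟩
  rw [hge, hge1, hge2]
  constructor
  · rintro ⟨H1, H2⟩ st q m c hl hF
    refine ⟨fun st' t hb => ?_, fun m' h0 => ?_⟩
    · exact H1 (st, st', q, m, c, t) _ (if_pos ⟨hl, hb⟩) (by simpa [Satisfies] using hF)
    · exact H2 (st, q, m, c, m') _ (if_pos hl) (by simpa [Satisfies] using ⟨hF, h0⟩)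
  · refine fun H => ⟨?_, ?_⟩
    · rintro ⟨st, st', q, m, c, t⟩ L hL hs
      obtain ⟨⟨hl, hb⟩, hL⟩ := Option.ite_none_right_eq_some.1 hL
      rw [Option.some.injEq] at hL
      subst hL
      exact (H st q m c hl (by simpa [Satisfies] using hs)).1 st' t hb
    · rintro ⟨st, q, m, c, m'⟩ L hL hs
      obtain ⟨hl, hL⟩ := Option.ite_none_right_eq_some.1 hL
      rw [Option.some.injEq] at hL
      subst hL
      simp only [Satisfies, List.mem_cons, List.not_mem_nil, or_false, forall_eq_or_imp,
        forall_eq] at hs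
      exact (H st q m c hl hs.1).2 m' hs.2

theorem satisfies_map_imageKey {F : ℕ → ℕ} {l : List (ℕ × ℕ)} :
    Satisfies F (l.map fun p => (imageKey p.1, p.2)) ↔
      (l.map Prod.fst).map (fun z => F (imageKey z)) = l.map Prod.snd := by
  simp only [Satisfies, List.forall_mem_map, List.map_map, List.map_inj_left, Function.comp]

/-- Conditions cannot mention `F`. They range over lists of pairs, among which are those formed by
arguments and their actual images. -/
theorem exists_map_fst_snd (F : ℕ → ℕ) (l : List ℕ) : ∃ l' : List (ℕ × ℕ),
    l'.map Prod.fst = l ∧ l'.map Prod.snd = l.map fun z => F (imageKey z) :=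
  ⟨l.map fun z => (z, F (imageKey z)), by simp [Function.comp_def]⟩

open Classical in
theorem exists_avoids_goodImages : ∃ g : ℕ × ℕ → ℕ, Computable g ∧
    ∀ i j F, Avoids (g (i, j)) F ↔ GoodImages i j F := by
  have h1 : Primrec fun p : (ℕ × ℕ) × (ℕ × ℕ × List (ℕ × ℕ) × Test) =>
      if ListIn p.2.1 p.1.1 (p.2.2.2.1.map fun p => p.1) ∧
        (ListNotIn p.2.2.1 p.1.2 (p.2.2.2.1.map fun p => p.2) ∨
          Mismatch p.2.2.1 p.1.1 p.1.2 (p.2.2.2.1.map fun p => p.1)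
            (p.2.2.2.1.map fun p => p.2) p.2.2.2.2)
      then some (p.2.2.2.1.map fun p => (imageKey p.1, p.2))
      else none := by
    fun_prop
  obtain ⟨g, hg, hge⟩ := exists_computable_avoids_iff h1
  refine ⟨g, hg, fun i j F => ?_⟩
  rw [hge]
  constructor
  · intro H st l hl st' t
    rw [← not_or]
    intro hb
    obtain ⟨l', rfl, h2⟩ := exists_map_fst_snd F l
    rw [← h2] at hb
    exact H (st, st', l', t) _ (if_pos ⟨hl, hb⟩) (satisfies_map_imageKey.2 h2.symm)
  · rintro H ⟨st, st', l, t⟩ L hL hs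
    obtain ⟨⟨hl, hb⟩, hL⟩ := Option.ite_none_right_eq_some.1 hL
    rw [Option.some.injEq] at hL
    subst hL
    have := H st _ hl st' t
    rw [satisfies_map_imageKey.1 hs] at this
    exact not_or.2 this hb

open Classical in
theorem exists_avoids_goodPreimages : ∃ g : ℕ × ℕ → ℕ, Computable g ∧
    ∀ i j F, Avoids (g (i, j)) F ↔ GoodPreimages i j F := by
  have h1 : Primrec fun p : (ℕ × ℕ) × (ℕ × ℕ × ℕ × ℕ × ℕ) =>
      if ListIn p.2.1 p.1.2 [p.2.2.2.1] ∧
        (ListNotIn p.2.2.1 p.1.1 [p.2.2.2.2.1] ∨ ¬ p.2.2.2.2.2 = p.2.2.2.1)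
      then some [(preimageKey p.2.2.2.1, p.2.2.2.2.1), (imageKey p.2.2.2.2.1, p.2.2.2.2.2)]
      else none := by
    fun_prop
  obtain ⟨g, hg, hge⟩ := exists_computable_avoids_iff h1
  refine ⟨g, hg, fun i j F => ?_⟩
  rw [hge]
  constructor
  · intro H st z hz
    have key : ∀ st', ¬ (ListNotIn st' i [F (preimageKey z)] ∨
        ¬ F (imageKey (F (preimageKey z))) = z) := fun st' hb =>
      H (st, st', z, _, _) _ (if_pos ⟨hz, hb⟩) (by simp [Satisfies])
    simp only [not_or, not_not] at key
    exact ⟨fun st' => (key st').1, (key 0).2⟩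
  · rintro H ⟨st, st', z, v, v'⟩ L hL hs
    obtain ⟨⟨hl, hb⟩, hL⟩ := Option.ite_none_right_eq_some.1 hL
    rw [Option.some.injEq] at hL
    subst hL
    simp only [Satisfies, List.mem_cons, List.not_mem_nil, or_false, forall_eq_or_imp,
        forall_eq] at hs
    obtain ⟨rfl, rfl⟩ := hs
    obtain ⟨h1, h2⟩ := H st z hl
    exact hb.elim (h1 st') (not_not.2 h2)

open Classical in
theorem exists_avoids_claimsImages : ∃ g : ℕ → ℕ, Computable g ∧
    ∀ i F, Avoids (g i) F ↔ ClaimsImages i F := by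
  have h1 : Primrec fun p : ℕ × (ℕ × List (ℕ × ℕ) × Bool × Move) =>
      if ListIn p.2.1 p.1 (p.2.2.1.map fun p => p.1)
      then some ((p.2.2.1.map fun p => (imageKey p.1, p.2)) ++
        [(responseKey (if p.2.2.2.1 = true
          then (0, true, p.2.2.1.map fun p => p.1, p.2.2.1.map fun p => p.2)
          else (0, false, p.2.2.1.map fun p => p.2, p.2.2.1.map fun p => p.1)) p.2.2.2.2, 0)])
      else none := by
    fun_prop
  obtain ⟨g, hg, hge⟩ := exists_computable_avoids_iff h1
  refine ⟨g, hg, fun i F => ?_⟩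
  rw [hge]
  have happ : ∀ L p, Satisfies F (L ++ [p]) ↔ Satisfies F L ∧ F p.1 = p.2 := by
    intro L p
    simp [Satisfies, or_imp, forall_and]
  constructor
  · intro H st l hl
    obtain ⟨l', rfl, h2⟩ := exists_map_fst_snd F l
    rw [← h2]
    refine ⟨fun m h0 => ?_, fun m h0 => ?_⟩
    · exact H (st, l', true, m) _ (if_pos hl) ((happ _ _).2 ⟨satisfies_map_imageKey.2 h2.symm, h0⟩)
    · exact H (st, l', false, m) _ (if_pos hl)
        ((happ _ _).2 ⟨satisfies_map_imageKey.2 h2.symm, h0⟩)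
  · rintro H ⟨st, l, s, m⟩ L hL hs
    obtain ⟨hl, hL⟩ := Option.ite_none_right_eq_some.1 hL
    rw [Option.some.injEq] at hL
    subst hL
    obtain ⟨h1, h2⟩ := (happ _ _).1 hs
    have := H st _ hl
    rw [satisfies_map_imageKey.1 h1] at this
    cases s
    · exact this.2 m h2
    · exact this.1 m h2

theorem exists_avoids_claims_nil : ∃ g : ℕ, ∀ F, Avoids g F ↔ Claims F (0, true, [], []) := by
  have h1 : Primrec fun p : ℕ × Move => some [(responseKey (0, true, [], []) p.2, 0)] := by
    fun_prop
  obtain ⟨g, -, hge⟩ := exists_computable_avoids_iff h1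
  refine ⟨g 0, fun F => ?_⟩
  rw [hge]
  simp [Satisfies, Claims]

end Collegiate
end

noncomputable section

namespace Collegiate

open FirstOrder.Language Filter

variable {S : Signature}

/-! ### Membership in the universe of a structure -/

theorem phi_eq_one_iff {i : ℕ} {P : NatStructure S} (hi : IsIndex i P) {z : ℕ} :
    phi i (Nat.pair 0 z) = Part.some 1 ↔ z ∈ P.carrier := by
  classical
  rw [hi.1]
  by_cases h : z ∈ P.carrier <;> simp [h]

theorem phi_eq_zero_iff {i : ℕ} {P : NatStructure S} (hi : IsIndex i P) {z : ℕ} :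
    phi i (Nat.pair 0 z) = Part.some 0 ↔ z ∉ P.carrier := by
  classical
  rw [hi.1]
  by_cases h : z ∈ P.carrier <;> simp [h]

theorem exists_eq_map_val {P : NatStructure S} {l : List ℕ} (h : ∀ z ∈ l, z ∈ P.carrier) :
    ∃ l' : List P, l = l'.map Subtype.val := by
  lift l to List P.carrier using h
  exact ⟨l, rfl⟩

theorem ListIn.exists_eq_map_val {st i : ℕ} {P : NatStructure S} (hi : IsIndex i P) {l : List ℕ}
    (h : ListIn st i l) : ∃ l' : List P, l = l'.map Subtype.val :=
  Collegiate.exists_eq_map_val fun z hz => (phi_eq_one_iff hi).1 (phi_eq_of_phiSteps (h z hz))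

theorem eventually_listIn {i : ℕ} {P : NatStructure S} (hi : IsIndex i P) (l : List P) :
    ∀ᶠ st in atTop, ListIn st i (l.map Subtype.val) := by
  induction l with
  | nil => exact Eventually.of_forall fun st => by simp [ListIn, AllMem]
  | cons z l ih =>
    filter_upwards [ih, eventually_phiSteps ((phi_eq_one_iff hi).2 z.2)] with st h1 h2
    intro y hy
    rcases List.mem_cons.1 hy with rfl | hy
    exacts [h2, h1 y hy]

theorem not_listNotIn {st i : ℕ} {P : NatStructure S} (hi : IsIndex i P) (l : List P) :
    ¬ ListNotIn st i (l.map Subtype.val) := by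
  rw [ListNotIn, not_not]
  intro z hz h
  obtain ⟨z, -, rfl⟩ := List.mem_map.1 hz
  exact (phi_eq_zero_iff hi).1 (phi_eq_of_phiSteps h) z.2

theorem exists_eq_map_val_of_not_listNotIn {i : ℕ} {P : NatStructure S} (hi : IsIndex i P)
    {l : List ℕ} (h : ∀ st, ¬ ListNotIn st i l) : ∃ l' : List P, l = l'.map Subtype.val := by
  refine exists_eq_map_val fun z hz => ?_
  by_contra hc
  obtain ⟨st, hst⟩ := (eventually_phiSteps ((phi_eq_zero_iff hi).2 hc)).exists
  exact h st fun h => h z hz hst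

theorem exists_ofFn_eq {α : Type*} {m : ℕ} {l : List α} (h : l.length = m) :
    ∃ f : Fin m → α, List.ofFn f = l := by
  subst h
  exact ⟨l.get, List.ofFn_get l⟩

/-! ### Levels -/

/-- The level `y + 1` is below the level `x`. -/
def LevelLT (b y x : ℕ) : Prop :=
  phi b (Nat.pair 0 y) = Part.some 1 ∧ (x = 0 ∨ phi b (Nat.pair 0 (x - 1)) = Part.some 1 ∧
    phi b (Nat.pair 1 (Nat.pair y (x - 1))) = Part.some 1)

theorem LegalMove.levelLT {b i j st : ℕ} {q : Position} {m : Move}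
    (h : LegalMove b i j st q m) : LevelLT b m.1 q.1 :=
  ⟨phi_eq_of_phiSteps h.1, h.2.1.imp id fun h => ⟨phi_eq_of_phiSteps h.1,
    phi_eq_of_phiSteps h.2⟩⟩

theorem eventually_legalMove {b i j : ℕ} {q : Position} {m : Move} {Q : NatStructure S}
    (hQ : IsIndex (sideIndex i j !q.2.1) Q) (h : LevelLT b m.1 q.1) {d : List Q}
    (hd : m.2.1 = d.map Subtype.val) : ∀ᶠ st in atTop, LegalMove b i j st q m := by
  obtain ⟨h1, h2⟩ := h
  have h3 := eventually_listIn hQ d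
  rw [← hd] at h3
  rcases h2 with h2 | ⟨h2, h4⟩
  · filter_upwards [eventually_phiSteps h1, h3] with st h1 h3
    exact ⟨h1, Or.inl h2, h3⟩
  · filter_upwards [eventually_phiSteps h1, h3, eventually_phiSteps h2, eventually_phiSteps h4]
      with st h1 h3 h2 h4
    exact ⟨h1, Or.inr ⟨h2, h4⟩, h3⟩

/-- `lev` assigns ordinals to the levels. -/
def IsLevelMap (b : ℕ) (lev : ℕ → Ordinal.{0}) : Prop :=
  (∀ y x, LevelLT b y x → lev (y + 1) < lev x) ∧
    ∀ x, ∀ γ < lev x, ∃ y, LevelLT b y x ∧ lev (y + 1) = γ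

theorem CodesOrdinal.exists_isLevelMap {b : ℕ} {β : Ordinal.{0}} (h : CodesOrdinal b β) :
    ∃ lev, IsLevelMap b lev ∧ lev 0 = β := by
  classical
  obtain ⟨S, r, _, rfl, hS, hr⟩ := h
  have hS1 : ∀ x, phi b (Nat.pair 0 x) = Part.some 1 ↔ x ∈ S := fun x => by
    rw [hS]
    by_cases h : x ∈ S <;> simp [h]
  have hr1 : ∀ x y : S, phi b (Nat.pair 1 (Nat.pair x y)) = Part.some 1 ↔ r x y := fun x y => by
    rw [hr]
    by_cases h : r x y <;> simp [h]
  -- The top level 0 gets the whole order type. A number outside the order gets 0, consistently with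
  -- having no level below it.
  let lev : ℕ → Ordinal.{0} := fun n =>
    if n = 0 then Ordinal.type r else if h : n - 1 ∈ S then Ordinal.typein r ⟨n - 1, h⟩ else 0
  have lev_succ : ∀ x : S, lev (x.1 + 1) = Ordinal.typein r x := fun x => by
    simp [lev]
  have lev_zero : lev 0 = Ordinal.type r := if_pos rfl
  refine ⟨lev, ⟨?_, ?_⟩, lev_zero⟩
  · rintro y x ⟨h1, h2⟩
    lift y to S using (hS1 y).1 h1
    rw [lev_succ]
    cases x with
    | zero =>
      rw [lev_zero]
      exact Ordinal.typein_lt_type r y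
    | succ x =>
      obtain ⟨h2, h3⟩ := h2.resolve_left (by simp)
      rw [Nat.add_sub_cancel] at h2 h3
      lift x to S using (hS1 x).1 h2
      rw [lev_succ]
      exact (Ordinal.typein_lt_typein r).2 ((hr1 y x).1 h3)
  · intro x γ hγ
    cases x with
    | zero =>
      rw [lev_zero] at hγ
      obtain ⟨y, rfl⟩ := Ordinal.typein_surj r hγ
      exact ⟨y, ⟨(hS1 y).2 y.2, Or.inl rfl⟩, lev_succ y⟩
    | succ x =>
      by_cases hx : x ∈ S
      · lift x to S using hx
        rw [lev_succ] at hγ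
        obtain ⟨y, rfl⟩ := Ordinal.typein_surj r (hγ.trans (Ordinal.typein_lt_type r x))
        refine ⟨y, ⟨(hS1 y).2 y.2, Or.inr ?_⟩, lev_succ y⟩
        rw [Nat.add_sub_cancel]
        exact ⟨(hS1 x).2 x.2, (hr1 y x).2 ((Ordinal.typein_lt_typein r).1 hγ)⟩
      · simp [lev, hx] at hγ

/-! ### Claimed positions are correct -/

/-- The value of `F` at the move is nonzero, hence a response. Since it is not found wrong at any
stage, it is a tuple of `P` of the right length that passes the tests. -/
theorem GoodResponses.exists_response {b i j : ℕ} {F : ℕ → ℕ} (h : GoodResponses b i j F)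
    {s : Bool} {P Q : NatStructure S} (hP : IsIndex (sideIndex i j s) P)
    (hQ : IsIndex (sideIndex i j !s) Q) {x y : ℕ} (hxy : LevelLT b y x) {a : List P} {a' : List Q}
    (hl : a.length = a'.length) (hc : Claims F (x, s, a.map Subtype.val, a'.map Subtype.val))
    (d : List Q) (N : ℕ) : ∃ c : List P, c.length = d.length ∧ Agree S N (a' ++ d) (a ++ c) ∧
      Claims F (y + 1, !s, (a' ++ d).map Subtype.val, (a ++ c).map Subtype.val) := by
  let q : Position := (x, s, a.map Subtype.val, a'.map Subtype.val)
  let m : Move := (y, d.map Subtype.val, N)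
  obtain ⟨c', hc'⟩ := Nat.exists_eq_succ_of_ne_zero (hc m)
  obtain ⟨c, rfl⟩ : ∃ c : List ℕ, c' = Encodable.encode c :=
    ⟨Denumerable.ofNat _ c', by simp⟩
  obtain ⟨st, hst⟩ := (eventually_legalMove (b := b) (i := i) (j := j) (q := q) (m := m) hQ hxy
    rfl).exists
  obtain ⟨h1, h2⟩ := h st q m c hst hc'
  obtain ⟨c, rfl⟩ := exists_eq_map_val_of_not_listNotIn hP fun st hst =>
    h1 st (0, 0, 0, []) (Or.inr (Or.inl hst))
  have hcl : c.length = d.length := by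
    by_contra hcl
    exact h1 0 (0, 0, 0, []) (Or.inl (by simpa [m] using hcl))
  refine ⟨c, hcl, ?_, ?_⟩
  · refine (agree_iff_not_mismatch hQ hP (by simp [hl, hcl])).2 fun st t ht hm => ?_
    refine h1 st t (Or.inr (Or.inr ⟨ht, ?_⟩))
    simpa only [List.map_append] using hm
  · simp only [List.map_append]
    exact h2

theorem getElem?_ofFn_append {α : Type*} {n : ℕ} (v : Fin n → α) (l : List α) (x : Fin n) :
    (List.ofFn v ++ l)[x.1]? = some (v x) := by
  rw [List.getElem?_append_left (by simp), List.getElem?_ofFn]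
  simp

/-- Claims supply the responses required by `piLE_of_responses`. At ordinal 0 there are no moves and
a claim says nothing, whence `γ ≠ 0`. The sides alternate, so the induction ranges over both
structures. -/
theorem piLE_of_claims {b i j : ℕ} {F : ℕ → ℕ} (h : GoodResponses b i j F) {lev : ℕ → Ordinal.{0}}
    (hlev : IsLevelMap b lev) (γ : Ordinal.{0}) (hγ : γ ≠ 0) :
    ∀ (x : ℕ) (s : Bool) (P Q : NatStructure S), lev x = γ → IsIndex (sideIndex i j s) P →
      IsIndex (sideIndex i j !s) Q → ∀ (n : ℕ) (a : Fin n → P) (a' : Fin n → Q),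
      Claims F (x, s, (List.ofFn a).map Subtype.val, (List.ofFn a').map Subtype.val) →
      PiLE S.lang γ a a' := by
  induction γ using WellFoundedLT.induction with
  | ind γ ih =>
    rintro x s P Q rfl hP hQ n a a' hc
    refine piLE_of_responses hγ ?_ ?_
    · intro m d θ hθ hd
      obtain ⟨y, hy, -⟩ := hlev.2 x 0 (pos_iff_ne_zero.2 hγ)
      -- The move plays `d` together with the auxiliary values `e`, and announces the bound `N` that
      -- decides `θ`. Only the first `m` entries of the response are kept.
      obtain ⟨U, ⟨e, rfl⟩, N, hN⟩ := exists_qf_determined (S := S) Fin.val (Fin.append a' d) hθ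
        (List.ofFn (Fin.append a' d))
      obtain ⟨c, hcl, hA, -⟩ := h.exists_response hP hQ hy (by simp) hc (List.ofFn d ++ e) N
      obtain ⟨c₁, hc₁⟩ := exists_ofFn_eq (l := c.take m) (m := m) (by simp [hcl])
      refine ⟨c₁, ?_⟩
      rw [← List.append_assoc, ← List.ofFn_fin_append] at hA
      have hac : List.ofFn a ++ c = List.ofFn (Fin.append a c₁) ++ c.drop m := by
        rw [List.ofFn_fin_append, hc₁, List.append_assoc, List.take_append_drop]
      rw [hac] at hA
      have key := hN _ List.prefix_rfl (getElem?_ofFn_append _ _) P _ (Fin.append a c₁)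
        (by simp [hcl]) (getElem?_ofFn_append _ _) hA
      exact key.1 hd
    · intro δ hδ hδ0 m d
      obtain ⟨y, hy, rfl⟩ := hlev.2 x δ hδ
      obtain ⟨c, hcl, -, hcc⟩ := h.exists_response hP hQ hy (by simp) hc (List.ofFn d) 0
      obtain ⟨c, rfl⟩ := exists_ofFn_eq (l := c) (m := m) (by simpa using hcl)
      refine ⟨c, ih _ hδ hδ0 (y + 1) (!s) Q P rfl hQ (by simpa using hP) _ _ _ ?_⟩
      rw [List.ofFn_fin_append, List.ofFn_fin_append]
      exact hcc

/-! ### Correct positions can be claimed -/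

/-- The position `q` is correct, for the ordinals `lev` of the levels. -/
def CorrectPosition (S : Signature) (i j : ℕ) (lev : ℕ → Ordinal.{0}) (q : Position) : Prop :=
  ∃ P Q : NatStructure S, IsIndex (sideIndex i j q.2.1) P ∧ IsIndex (sideIndex i j !q.2.1) Q ∧
    ∃ (n : ℕ) (a : Fin n → P) (a' : Fin n → Q), q.2.2.1 = (List.ofFn a).map Subtype.val ∧
      q.2.2.2 = (List.ofFn a').map Subtype.val ∧ (lev q.1 ≠ 0 → PiLE S.lang (lev q.1) a a')

/-- A legal move lowers the ordinal, so the current one is nonzero and its preservation relation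
supplies a response. -/
theorem CorrectPosition.exists_response {b i j : ℕ} {lev : ℕ → Ordinal.{0}}
    (hlev : IsLevelMap b lev) {q : Position} (hq : CorrectPosition S i j lev q) {st : ℕ} {m : Move}
    (hm : LegalMove b i j st q m) : ∃ c, CorrectPosition S i j lev (nextPosition q m c) ∧
      ∀ st t, ¬ BadResponse i j st q m c t := by
  obtain ⟨P, Q, hP, hQ, n, a, a', ha, ha', hle⟩ := hq
  have hlt := hlev.1 _ _ hm.levelLT
  have hx : lev q.1 ≠ 0 := (pos_iff_ne_zero.1 ((zero_le (a := lev (m.1 + 1))).trans_lt hlt))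
  obtain ⟨d, hd⟩ := ListIn.exists_eq_map_val hQ hm.2.2
  obtain ⟨k, d', rfl⟩ : ∃ (k : ℕ) (d' : Fin k → Q), List.ofFn d' = d :=
    ⟨d.length, exists_ofFn_eq rfl⟩
  suffices ∃ c : Fin k → P, (lev (m.1 + 1) ≠ 0 → PiLE S.lang (lev (m.1 + 1)) (Fin.append a' d')
      (Fin.append a c)) ∧ Agree S m.2.2 (List.ofFn (Fin.append a' d'))
        (List.ofFn (Fin.append a c)) by
    obtain ⟨c, h1, h2⟩ := this
    refine ⟨(List.ofFn c).map Subtype.val, ⟨Q, P, hQ, by simpa [nextPosition] using hP, n + k,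
      Fin.append a' d', Fin.append a c, ?_, ?_, h1⟩, ?_⟩
    · simp only [nextPosition, ha', hd, List.ofFn_fin_append, List.map_append]
    · simp only [nextPosition, ha, List.ofFn_fin_append, List.map_append]
    · rintro st t (h | h | ⟨h, h'⟩)
      · exact h (by simp [hd])
      · exact not_listNotIn hP _ h
      · refine (agree_iff_not_mismatch hQ hP (by simp)).1 h2 st t h ?_
        simp only [List.ofFn_fin_append, List.map_append]
        rw [← ha, ← ha', ← hd]
        exact h'
  -- At ordinal 0 only the announced tests matter, and one quantifier-free formula describes their
  -- results. At a nonzero ordinal the response preserves all tests.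
  by_cases h0 : lev (m.1 + 1) = 0
  · obtain ⟨θ, hθ, h1, h2⟩ := exists_formula_agree (S := S) m.2.2 (Fin.append a' d')
    obtain ⟨c, hc⟩ := (hle hx).exists_response_qf hx d' hθ h1
    exact ⟨c, fun h => absurd h0 h, h2 _ hc⟩
  · obtain ⟨c, hc⟩ := (hle hx).exists_response hlt h0 d'
    exact ⟨c, fun _ => hc, hc.agree _⟩

/-- There is a function with given values at the images whose responses are right and that claims all
correct positions. -/
theorem exists_goodResponses (S : Signature) {b : ℕ} (i j : ℕ) {lev : ℕ → Ordinal.{0}}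
    (hlev : IsLevelMap b lev) (h : ℕ → ℕ) : ∃ F : ℕ → ℕ, (∀ z, F (imageKey z) = h z) ∧
      GoodResponses b i j F ∧ ∀ q, CorrectPosition S i j lev q → Claims F q := by
  classical
  -- The value is 0 at incorrect positions, which then count as unclaimed. At correct ones it codes
  -- a right response, or is an arbitrary nonzero number if the move is never legal.
  have key : ∀ (q : Position) (m : Move), ∃ v : ℕ, (CorrectPosition S i j lev q → v ≠ 0) ∧
      ∀ st c, LegalMove b i j st q m → v = Encodable.encode c + 1 →
        CorrectPosition S i j lev (nextPosition q m c) ∧ ∀ st t, ¬ BadResponse i j st q m c t := by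
    intro q m
    by_cases hq : CorrectPosition S i j lev q
    · by_cases hm : ∃ st, LegalMove b i j st q m
      · obtain ⟨st, hst⟩ := hm
        obtain ⟨c, hc⟩ := hq.exists_response hlev hst
        refine ⟨Encodable.encode c + 1, by simp, fun st' c' _ h => ?_⟩
        rw [add_left_inj, Encodable.encode_inj] at h
        exact h ▸ hc
      · exact ⟨1, by simp, fun st c h => (hm ⟨st, h⟩).elim⟩
    · exact ⟨0, fun h => (hq h).elim, fun st c _ h => by simp at h⟩
  choose G hG1 hG2 using key
  let F : ℕ → ℕ := fun n => if n.unpair.1 = 0 then h n.unpair.2 else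
    ((Encodable.decode (α := Position × Move) n.unpair.2).map fun p => G p.1 p.2).getD 0
  have hF : ∀ q m, F (responseKey q m) = G q m := fun q m => by
    simp only [F, responseKey, Nat.unpair_pair, one_ne_zero, if_false, Encodable.encodek,
      Option.map_some, Option.getD_some]
  have hcl : ∀ q, CorrectPosition S i j lev q → Claims F q := fun q hq m => by
    rw [hF]
    exact hG1 q m hq
  refine ⟨F, fun z => by simp [F, imageKey], fun st q m c hm hc => ?_, hcl⟩
  rw [hF] at hc
  exact ⟨(hG2 q m st c hm hc).2, hcl _ (hG2 q m st c hm hc).1⟩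

end Collegiate
end

noncomputable section

namespace Collegiate

open FirstOrder.Language Filter

variable {S : Signature}

/-! ### Maps given by lists of pairs -/

section

variable {M N : Type} [S.lang.Structure M] [S.lang.Structure N]

/-- Every finite subset of `T` is contained in a list with extensions whose two coordinates agree to
any given extent. -/
def IsPartialIso (S : Signature) {M N : Type} [S.lang.Structure M] [S.lang.Structure N]
    (T : Set (M × N)) : Prop :=
  ∀ l : List (M × N), (∀ p ∈ l, p ∈ T) → ∃ l', l ⊆ l' ∧ ∀ K, ∃ l'', l' <+: l'' ∧
    Agree S K (l''.map Prod.fst) (l''.map Prod.snd)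

theorem IsPartialIso.mono {T T' : Set (M × N)} (h : IsPartialIso S T) (hT : T' ⊆ T) :
    IsPartialIso S T' := fun l hl => h l fun p hp => hT (hl p hp)

/-- The positions `r` lie in a list fixed beforehand. The lists for the various tests extend it, so
the positions can be used to write down the test. -/
theorem IsPartialIso.exists_lists {T : Set (M × N)} (h : IsPartialIso S T) {n : ℕ}
    {w : Fin n → M × N} (hw : ∀ i, w i ∈ T) : ∃ r : Fin n → ℕ, ∀ t : Test, ∃ (u : List M)
      (u' : List N), (∀ i, u[r i]? = some (w i).1) ∧ (∀ i, u'[r i]? = some (w i).2) ∧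
        (Holds S u t ↔ Holds S u' t) := by
  obtain ⟨l', hl, hl'⟩ := h (List.ofFn w) (by simpa [List.mem_ofFn] using hw)
  have h1 : ∀ i, ∃ k : ℕ, l'[k]? = some (w i) := fun i =>
    List.mem_iff_getElem?.1 (hl (List.mem_ofFn.2 ⟨i, rfl⟩))
  choose r hr using h1
  refine ⟨r, fun t => ?_⟩
  obtain ⟨l'', ⟨e, rfl⟩, h2⟩ := hl' (Encodable.encode t + 1)
  have h3 : ∀ i, (l' ++ e)[r i]? = some (w i) := fun i => by
    rw [List.getElem?_append_left (List.getElem?_eq_some_iff.1 (hr i)).1, hr]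
  exact ⟨_, _, fun i => by simp only [List.getElem?_map, h3, Option.map_some],
    fun i => by simp only [List.getElem?_map, h3, Option.map_some], h2 t (Nat.lt_succ_self _)⟩

theorem IsPartialIso.eq_iff {T : Set (M × N)} (h : IsPartialIso S T) {p q : M × N} (hp : p ∈ T)
    (hq : q ∈ T) : p.1 = q.1 ↔ p.2 = q.2 := by
  obtain ⟨r, hr⟩ := h.exists_lists (w := ![p, q]) (by simp [Fin.forall_fin_two, hp, hq])
  obtain ⟨u, u', h1, h2, h3⟩ := hr (0, r 0, r 1, [])
  simpa [Holds, h1, h2] using h3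

theorem IsPartialIso.relMap_iff {T : Set (M × N)} (h : IsPartialIso S T) {n : ℕ}
    {w : Fin n → M × N} (hw : ∀ i, w i ∈ T) (R : S.lang.Relations n) :
    Structure.RelMap R (fun i => (w i).1) ↔ Structure.RelMap R fun i => (w i).2 := by
  obtain ⟨r, hr⟩ := h.exists_lists hw
  obtain ⟨u, u', h1, h2, h3⟩ := hr (1, R.1, 0, List.ofFn r)
  simp only [Holds] at h3
  rw [select_ofFn h1, select_ofFn h2, relHolds_ofFn, relHolds_ofFn, and_iff_right,
    and_iff_right] at h3
  · exact h3
  · simpa [List.mem_ofFn] using fun i => (List.getElem?_eq_some_iff.1 (h2 i)).1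
  · simpa [List.mem_ofFn] using fun i => (List.getElem?_eq_some_iff.1 (h1 i)).1

theorem IsPartialIso.funMap_eq_iff {T : Set (M × N)} (h : IsPartialIso S T) {n : ℕ}
    {w : Fin n → M × N} (hw : ∀ i, w i ∈ T) {p : M × N} (hp : p ∈ T) (f : S.lang.Functions n) :
    Structure.funMap f (fun i => (w i).1) = p.1 ↔
      Structure.funMap f (fun i => (w i).2) = p.2 := by
  obtain ⟨r, hr⟩ := h.exists_lists (w := Fin.snoc (α := fun _ => M × N) w p) (by
    intro i
    induction i using Fin.lastCases <;> simp [hp, hw])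
  obtain ⟨u, u', h1, h2, h3⟩ := hr (2, f.1, r (Fin.last n), List.ofFn fun i => r i.castSucc)
  have h1' : ∀ i : Fin n, u[r i.castSucc]? = some (w i).1 := fun i => by simp [h1]
  have h2' : ∀ i : Fin n, u'[r i.castSucc]? = some (w i).2 := fun i => by simp [h2]
  simp only [Holds, h1, h2, Fin.snoc_last, Option.some.injEq, exists_eq_left'] at h3
  rw [select_ofFn h1', select_ofFn h2', fnValue_ofFn, fnValue_ofFn, and_iff_right,
    and_iff_right] at h3
  · exact h3
  · simpa [List.mem_ofFn] using fun i => (List.getElem?_eq_some_iff.1 (h2' i)).1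
  · simpa [List.mem_ofFn] using fun i => (List.getElem?_eq_some_iff.1 (h1' i)).1

theorem IsPartialIso.exists_embedding {h : M → N}
    (H : IsPartialIso S (Set.range fun x => (x, h x))) : ∃ g : M ↪[S.lang] N, ⇑g = h :=
  ⟨{ toFun := h
     inj' := fun x y hxy => (H.eq_iff ⟨x, rfl⟩ ⟨y, rfl⟩).2 hxy
     map_fun' := fun f v => ((H.funMap_eq_iff (w := fun i => (v i, h (v i))) (fun i => ⟨v i, rfl⟩)
      ⟨_, rfl⟩ f).1 rfl).symm
     map_rel' := fun R v => (H.relMap_iff (w := fun i => (v i, h (v i)))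
      (fun i => ⟨v i, rfl⟩) R).symm }, rfl⟩

theorem exists_equiv_of_surjective (g : M ↪[S.lang] N) (hg : Function.Surjective g) :
    ∃ g' : M ≃[S.lang] N, ⇑g' = g :=
  ⟨{ toEquiv := Equiv.ofBijective g ⟨g.injective, hg⟩
     map_fun' := fun f v => g.map_fun f v
     map_rel' := fun R v => g.map_rel R v }, rfl⟩

theorem IsPartialIso.nonempty_equiv {T : Set (M × N)} (H : IsPartialIso S T)
    (h1 : ∀ x, ∃ y, (x, y) ∈ T) (h2 : ∀ y, ∃ x, (x, y) ∈ T) : Nonempty (M ≃[S.lang] N) := by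
  choose h hh using h1
  obtain ⟨g, rfl⟩ := (H.mono (Set.range_subset_iff.2 hh)).exists_embedding
  obtain ⟨g', -⟩ := exists_equiv_of_surjective g fun y => by
    obtain ⟨x, hx⟩ := h2 y
    exact ⟨x, (H.eq_iff (hh x) hx).1 rfl⟩
  exact ⟨g'⟩

theorem isPartialIso_of_agree_map {h : M → N} (H : ∀ K l, Agree S K l (l.map h)) :
    IsPartialIso S (Set.range fun x => (x, h x)) := by
  refine fun l hl => ⟨l, List.Subset.refl l, fun K => ⟨l, List.prefix_rfl, ?_⟩⟩
  have : l.map Prod.snd = (l.map Prod.fst).map h := by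
    rw [List.map_map, List.map_inj_left]
    rintro p hp
    obtain ⟨x, rfl⟩ := hl p hp
    rfl
  rw [this]
  exact H K _

theorem agree_map (g : M ↪[S.lang] N) (K : ℕ) (l : List M) : Agree S K l (l.map g) := by
  have h := ((isSigmaElementary_iff_piLE g).1 (isSigmaElementary_zero g) _ l.get).1.agree K
  rwa [← List.map_ofFn, List.ofFn_get] at h

end

/-! ### Functions on the natural numbers that code embeddings -/

variable {i j : ℕ} {A B : NatStructure S} {F : ℕ → ℕ}

theorem GoodImages.exists_embedding (hi : IsIndex i A) (hj : IsIndex j B)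
    (h : GoodImages i j F) : ∃ g : A ↪[S.lang] B, ∀ x, (g x).1 = F (imageKey x) := by
  have h1 : ∀ x : A, F (imageKey x) ∈ B.carrier := fun x => by
    obtain ⟨st, hst⟩ := (eventually_listIn hi [x]).exists
    obtain ⟨l, hl⟩ := exists_eq_map_val_of_not_listNotIn hj fun st' =>
      (h st _ hst st' (0, 0, 0, [])).1
    have := (List.mem_map (f := Subtype.val) (l := l)).1 (hl ▸ by simp : F (imageKey x) ∈ _)
    obtain ⟨y, -, hy⟩ := this
    exact hy ▸ y.2
  obtain ⟨g, hg⟩ := (isPartialIso_of_agree_map (S := S) (h := fun x : A =>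
      (⟨F (imageKey x), h1 x⟩ : B)) fun K l => by
    refine (agree_iff_not_mismatch hi hj (by simp)).2 fun st t _ => ?_
    obtain ⟨st', hst⟩ := (eventually_listIn hi l).exists
    have := (h st' _ hst st t).2
    rw [List.map_map] at this ⊢
    exact this).exists_embedding
  exact ⟨g, fun x => by rw [hg]⟩

theorem goodImages_of_embedding (hi : IsIndex i A) (hj : IsIndex j B) (g : A ↪[S.lang] B)
    (h : ∀ x, (g x).1 = F (imageKey x)) : GoodImages i j F := by
  intro st l hl
  obtain ⟨l, rfl⟩ := hl.exists_eq_map_val hi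
  have : (l.map Subtype.val).map (fun z => F (imageKey z)) = (l.map g).map Subtype.val := by
    simp [List.map_map, h]
  rw [this]
  exact fun st t => ⟨not_listNotIn hj _,
    (agree_iff_not_mismatch hi hj (by simp)).1 (agree_map g (Encodable.encode t + 1) l) st t
      (Nat.lt_succ_self _)⟩

theorem exists_equiv_of_good (hi : IsIndex i A) (hj : IsIndex j B) (h : GoodImages i j F)
    (h' : GoodPreimages i j F) : ∃ g : A ≃[S.lang] B, ∀ x, (g x).1 = F (imageKey x) := by
  obtain ⟨g, hg⟩ := h.exists_embedding hi hj
  obtain ⟨g', hg'⟩ := exists_equiv_of_surjective g fun y => by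
    obtain ⟨st, hst⟩ := (eventually_listIn hj [y]).exists
    obtain ⟨h1, h2⟩ := h' st y hst
    obtain ⟨l, hl⟩ := exists_eq_map_val_of_not_listNotIn hi h1
    obtain ⟨x, -, hx⟩ := (List.mem_map (f := Subtype.val) (l := l)).1
      (hl ▸ by simp : F (preimageKey y) ∈ _)
    exact ⟨x, Subtype.ext (by rw [hg, hx, h2])⟩
  exact ⟨g', fun x => by rw [hg', hg]⟩

theorem exists_good_of_equiv (hi : IsIndex i A) (hj : IsIndex j B) (g : A ≃[S.lang] B) :
    ∃ F, GoodImages i j F ∧ GoodPreimages i j F := by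
  classical
  let F : ℕ → ℕ := fun n => if n.unpair.1 = 0 then
      (if h : n.unpair.2 ∈ A.carrier then (g ⟨_, h⟩).1 else 0)
    else if h : n.unpair.2 ∈ B.carrier then (g.symm ⟨_, h⟩).1 else 0
  have h1 : ∀ x : A, (g x).1 = F (imageKey x) := fun x => by simp [F, imageKey]
  have h2 : ∀ y : B, F (preimageKey y) = (g.symm y).1 := fun y => by simp [F, preimageKey]
  refine ⟨F, goodImages_of_embedding hi hj g.toEmbedding h1, fun st z hz => ?_⟩
  obtain ⟨l, hl⟩ := hz.exists_eq_map_val hj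
  obtain ⟨y, -, rfl⟩ := (List.mem_map (f := Subtype.val) (l := l)).1 (hl ▸ by simp : z ∈ _)
  rw [h2, ← h1]
  exact ⟨fun st => not_listNotIn hi [g.symm y], by simp⟩

variable {b : ℕ} {β : Ordinal.{0}}

theorem exists_isSigmaElementary_of_good (hi : IsIndex i A) (hj : IsIndex j B)
    (hb : CodesOrdinal b β) (h : GoodImages i j F) (h' : GoodResponses b i j F)
    (h'' : ClaimsImages i F) :
    ∃ g : A ↪[S.lang] B, IsSigmaElementary β g ∧ ∀ x, (g x).1 = F (imageKey x) := by
  obtain ⟨g, hg⟩ := h.exists_embedding hi hj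
  refine ⟨g, ?_, hg⟩
  -- Claims carry no information at ordinal 0, where any embedding will do.
  rcases eq_or_ne β 0 with rfl | hβ
  · exact isSigmaElementary_zero g
  obtain ⟨lev, hlev, rfl⟩ := hb.exists_isLevelMap
  refine (isSigmaElementary_iff_piLE g).2 fun n v => ?_
  obtain ⟨st, hst⟩ := (eventually_listIn hi (List.ofFn v)).exists
  have := h'' st _ hst
  have hm : ((List.ofFn v).map Subtype.val).map (fun z => F (imageKey z)) =
      (List.ofFn (g ∘ v)).map Subtype.val := by
    simp [List.map_ofFn, Function.comp_def, hg]
  rw [hm] at this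
  exact ⟨piLE_of_claims h' hlev _ hβ 0 true A B rfl hi hj n v (g ∘ v) this.1,
    piLE_of_claims h' hlev _ hβ 0 false B A rfl hj hi n (g ∘ v) v this.2⟩

theorem exists_good_of_isSigmaElementary (hi : IsIndex i A) (hj : IsIndex j B)
    (hb : CodesOrdinal b β) {g : A ↪[S.lang] B} (hg : IsSigmaElementary β g) :
    ∃ F, GoodImages i j F ∧ GoodResponses b i j F ∧ ClaimsImages i F := by
  classical
  obtain ⟨lev, hlev, rfl⟩ := hb.exists_isLevelMap
  obtain ⟨F, h1, h2, h3⟩ := exists_goodResponses S i j hlev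
    fun z => if h : z ∈ A.carrier then (g ⟨z, h⟩).1 else 0
  have h1' : ∀ x : A, (g x).1 = F (imageKey x) := fun x => by simp [h1]
  refine ⟨F, goodImages_of_embedding hi hj g h1', h2, fun st l hl => ?_⟩
  obtain ⟨l, rfl⟩ := hl.exists_eq_map_val hi
  obtain ⟨n, v, rfl⟩ : ∃ (n : ℕ) (v : Fin n → A), List.ofFn v = l :=
    ⟨l.length, exists_ofFn_eq rfl⟩
  have hm : ((List.ofFn v).map Subtype.val).map (fun z => F (imageKey z)) =
      (List.ofFn (g ∘ v)).map Subtype.val := by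
    simp [List.map_ofFn, Function.comp_def, h1']
  have := (isSigmaElementary_iff_piLE g).1 hg n v
  rw [hm]
  exact ⟨h3 _ ⟨A, B, hi, hj, n, v, g ∘ v, rfl, rfl, fun _ => this.1⟩,
    h3 _ ⟨B, A, hj, hi, n, g ∘ v, v, rfl, rfl, fun _ => this.2⟩⟩

end Collegiate
end

noncomputable section

namespace Collegiate

open FirstOrder.Language Filter

/-! ### Embeddings from paths -/

theorem exists_imageIndex : ∃ p : ℕ → ℕ, Primrec p ∧ ∀ (c : ℕ) (D : Set ℕ) (F : ℕ → ℕ),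
    (∀ n, oracleEval c D n = Part.some (F n)) →
      ∀ z, oracleEval (p c) D z = Part.some (F (imageKey z)) := by
  obtain ⟨k, hk⟩ := OCode.exists_eval_eq_some (f := imageKey) (by fun_prop)
  refine ⟨fun c => compIndex c (Encodable.encode k), by unfold compIndex; fun_prop,
    fun c D F hF z => ?_⟩
  obtain ⟨c, rfl⟩ : ∃ c' : OCode, c = Encodable.encode c' := ⟨Denumerable.ofNat _ c, by simp⟩
  simp only [oracleEval, ← encode_comp, Denumerable.ofNat_encode] at hF ⊢
  rw [OCode.eval_comp_of_eq (hk _ z), hF]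

theorem exists_avoids_elementary : ∃ g : ℕ × ℕ × ℕ → ℕ, Computable g ∧ ∀ b i j F,
    Avoids (g (b, i, j)) F ↔ GoodImages i j F ∧ GoodResponses b i j F ∧ ClaimsImages i F := by
  obtain ⟨g1, hg1, h1⟩ := exists_avoids_goodImages
  obtain ⟨g2, hg2, h2⟩ := exists_avoids_goodResponses
  obtain ⟨g3, hg3, h3⟩ := exists_avoids_claimsImages
  obtain ⟨g4, hg4, h4⟩ := exists_avoids_and hg2
    (hg3.comp (Computable.fst.comp (Computable.snd (α := ℕ) (β := ℕ × ℕ))))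
  obtain ⟨g, hg, h⟩ := exists_avoids_and (hg1.comp (Computable.snd (α := ℕ) (β := ℕ × ℕ))) hg4
  exact ⟨g, hg, fun b i j F => by rw [h, h4, h1, h2, h3]⟩

theorem exists_avoids_iso : ∃ g : ℕ × ℕ → ℕ, Computable g ∧ ∀ i j F,
    Avoids (g (i, j)) F ↔ GoodImages i j F ∧ GoodPreimages i j F := by
  obtain ⟨g1, hg1, h1⟩ := exists_avoids_goodImages
  obtain ⟨g2, hg2, h2⟩ := exists_avoids_goodPreimages
  obtain ⟨g, hg, h⟩ := exists_avoids_and hg1 hg2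
  exact ⟨g, hg, fun i j F => by rw [h, h1, h2]⟩

theorem ComputesPaths.isCollegiate {d : TuringDegree} (h : ComputesPaths d) {α : Ordinal.{0}}
    (hα : IsComputableOrdinal α) : IsCollegiate α d := by
  rintro β hβ S A B ⟨i, hi⟩ ⟨j, hj⟩ ⟨f, hf⟩
  obtain ⟨b, hb⟩ := hα.of_le hβ
  obtain ⟨g, -, hg⟩ := exists_avoids_elementary
  obtain ⟨D, hD, c, F, hF, hc⟩ := h (g (b, i, j)) (by
    obtain ⟨F, hF⟩ := exists_good_of_isSigmaElementary hi hj hb hf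
    exact ⟨F, (hg _ _ _ _).2 hF⟩)
  obtain ⟨h1, h2, h3⟩ := (hg _ _ _ _).1 hF
  obtain ⟨f, hf, hfF⟩ := exists_isSigmaElementary_of_good hi hj hb h1 h2 h3
  obtain ⟨p, -, hp⟩ := exists_imageIndex
  exact ⟨f, hf, D, hD, _, turingReducible_oracleEval (p c) D, fun x => by rw [hp c D F hc, hfF]⟩

theorem ComputesPaths.highForIsomorphism {d : TuringDegree} (h : ComputesPaths d) :
    HighForIsomorphism d := by
  rintro S A B ⟨i, hi⟩ ⟨j, hj⟩ ⟨f⟩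
  obtain ⟨g, -, hg⟩ := exists_avoids_iso
  obtain ⟨D, hD, c, F, hF, hc⟩ := h (g (i, j)) (by
    obtain ⟨F, hF⟩ := exists_good_of_equiv hi hj f
    exact ⟨F, (hg _ _ _).2 hF⟩)
  obtain ⟨h1, h2⟩ := (hg _ _ _).1 hF
  obtain ⟨f, hfF⟩ := exists_equiv_of_good hi hj h1 h2
  obtain ⟨p, -, hp⟩ := exists_imageIndex
  exact ⟨f, D, hD, _, turingReducible_oracleEval (p c) D, fun x => by rw [hp c D F hc, hfF]⟩

theorem UniformlyComputesPaths.uniformlyComputablyCollegiate {d : TuringDegree}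
    (h : UniformlyComputesPaths d) : UniformlyComputablyCollegiate d := by
  obtain ⟨D, hD, c, hc, h⟩ := h
  obtain ⟨g, hgc, hg⟩ := exists_avoids_elementary
  obtain ⟨p, hpc, hp⟩ := exists_imageIndex
  refine ⟨D, hD, fun b i j => p (c (g (b, i, j))), hpc.to_comp.comp (hc.comp hgc), ?_⟩
  rintro β b hb S A B i j hi hj ⟨f, hf⟩
  obtain ⟨F, hF, hcF⟩ := h (g (b, i, j)) (by
    obtain ⟨F, hF⟩ := exists_good_of_isSigmaElementary hi hj hb hf
    exact ⟨F, (hg _ _ _ _).2 hF⟩)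
  obtain ⟨h1, h2, h3⟩ := (hg _ _ _ _).1 hF
  obtain ⟨f, hf, hfF⟩ := exists_isSigmaElementary_of_good hi hj hb h1 h2 h3
  exact ⟨f, hf, fun x => by rw [hp _ D F hcF, hfF]⟩

theorem UniformlyComputesPaths.uniformlyHighForIsomorphism {d : TuringDegree}
    (h : UniformlyComputesPaths d) : UniformlyHighForIsomorphism d := by
  obtain ⟨D, hD, c, hc, h⟩ := h
  obtain ⟨g, hgc, hg⟩ := exists_avoids_iso
  obtain ⟨p, hpc, hp⟩ := exists_imageIndex
  refine ⟨D, hD, fun i j => p (c (g (i, j))), hpc.to_comp.comp (hc.comp hgc), ?_⟩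
  rintro S A B i j hi hj ⟨f⟩
  obtain ⟨F, hF, hcF⟩ := h (g (i, j)) (by
    obtain ⟨F, hF⟩ := exists_good_of_equiv hi hj f
    exact ⟨F, (hg _ _ _).2 hF⟩)
  obtain ⟨h1, h2⟩ := (hg _ _ _).1 hF
  obtain ⟨f, hfF⟩ := exists_equiv_of_good hi hj h1 h2
  exact ⟨f, fun x => by rw [hp _ D F hcF, hfF]⟩

theorem UniformlyComputablyCollegiate.uniformlyCollegiate {d : TuringDegree}
    (h : UniformlyComputablyCollegiate d) (α : Ordinal.{0}) : UniformlyCollegiate α d := by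
  obtain ⟨D, hD, f, hf, h⟩ := h
  exact ⟨D, hD, f, hf, fun β _ => h β⟩

theorem UniformlyCollegiate.levelwiseUniformlyCollegiate {d : TuringDegree} {α : Ordinal.{0}}
    (h : UniformlyCollegiate α d) (hα : IsComputableOrdinal α) :
    LevelwiseUniformlyCollegiate α d := by
  obtain ⟨D, hD, f, hf, h⟩ := h
  intro β hβ
  obtain ⟨b, hb⟩ := hα.of_le hβ
  exact ⟨D, hD, f b, hf.comp (Computable.pair (Computable.const b) Computable.id), h β hβ b hb⟩

/-! ### Computable structures that are equivalent up to the Church-Kleene ordinal -/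

variable {S : Signature} {A B : NatStructure S} {i j b : ℕ} {F : ℕ → ℕ}

/-- A descending sequence of levels and responses along it yield an isomorphism. -/
theorem nonempty_equiv_of_claims (hi : IsIndex i A) (hj : IsIndex j B)
    (h : GoodResponses b i j F) (hc : Claims F (0, true, [], [])) {y : ℕ → ℕ}
    (hy0 : LevelLT b (y 0) 0) (hy : ∀ k, LevelLT b (y (k + 1)) (y k + 1)) :
    Nonempty (A ≃[S.lang] B) := by
  classical
  obtain ⟨x, hx0, hx⟩ : ∃ x : ℕ → ℕ, x 0 = 0 ∧ ∀ k, LevelLT b (y k) (x k) ∧ x (k + 1) = y k + 1 :=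
    ⟨fun k => Nat.casesOn k 0 fun k => y k + 1, rfl, fun k => ⟨by cases k; exacts [hy0, hy _], rfl⟩⟩
  -- Each step plays two rounds, one from each side, so the claimed position returns to side `true`
  -- at even stages.
  let Good : ℕ → List (A × B) → Prop := fun k W => Claims F (x (2 * k), true,
    (W.map Prod.fst).map Subtype.val, (W.map Prod.snd).map Subtype.val)
  have step : ∀ k W, Good k W → ∃ W', W <+: W' ∧ Good (k + 1) W' ∧
      (∀ a : A, a.1 = k → ∃ c, (a, c) ∈ W') ∧ (∀ a : B, a.1 = k → ∃ c, (c, a) ∈ W') ∧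
      Agree S k (W'.map Prod.fst) (W'.map Prod.snd) := by
    intro k W hW
    obtain ⟨d, hd⟩ : ∃ d : List B, ∀ a : B, a.1 = k → a ∈ d := by
      by_cases hk : k ∈ B.carrier
      · exact ⟨[⟨k, hk⟩], fun a ha => by simp [Subtype.ext_iff, ha]⟩
      · exact ⟨[], fun a ha => (hk (ha ▸ a.2)).elim⟩
    obtain ⟨d', hd'⟩ : ∃ d : List A, ∀ a : A, a.1 = k → a ∈ d := by
      by_cases hk : k ∈ A.carrier
      · exact ⟨[⟨k, hk⟩], fun a ha => by simp [Subtype.ext_iff, ha]⟩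
      · exact ⟨[], fun a ha => (hk (ha ▸ a.2)).elim⟩
    -- The first round brings in the number `k` of `B`. The second brings in `k` of `A` and demands
    -- agreement on the first `k` tests, covering both new tuples.
    obtain ⟨c, hcl, -, h1⟩ := h.exists_response (s := true) hi hj (hx (2 * k)).1 (by simp) hW d 0
    obtain ⟨c', hcl', h2, h3⟩ := h.exists_response (s := false) hj hi
      ((hx (2 * k)).2 ▸ (hx (2 * k + 1)).1) (by simp [hcl]) h1 d' k
    have hz1 : (W ++ c.zip d ++ d'.zip c').map Prod.fst = W.map Prod.fst ++ c ++ d' := by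
      simp [List.map_fst_zip, hcl, hcl']
    have hz2 : (W ++ c.zip d ++ d'.zip c').map Prod.snd = W.map Prod.snd ++ d ++ c' := by
      simp [List.map_snd_zip, hcl, hcl']
    refine ⟨W ++ c.zip d ++ d'.zip c', ?_, ?_, fun a ha => ?_, fun a ha => ?_, ?_⟩
    · rw [List.append_assoc]
      exact List.prefix_append _ _
    · simp only [Good]
      rw [hz1, hz2, show 2 * (k + 1) = 2 * k + 1 + 1 from rfl, (hx (2 * k + 1)).2]
      exact h3
    · have : a ∈ (W ++ c.zip d ++ d'.zip c').map Prod.fst := by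
        rw [hz1]
        exact List.mem_append_right _ (hd' a ha)
      obtain ⟨⟨a, c⟩, hp, rfl⟩ := List.mem_map.1 this
      exact ⟨c, hp⟩
    · have : a ∈ (W ++ c.zip d ++ d'.zip c').map Prod.snd := by
        rw [hz2]
        exact List.mem_append_left _ (List.mem_append_right _ (hd a ha))
      obtain ⟨⟨c, a⟩, hp, rfl⟩ := List.mem_map.1 this
      exact ⟨c, hp⟩
    · rw [hz1, hz2]
      exact h2
  choose! next hnext using step
  let W : ℕ → List (A × B) := fun k => Nat.rec [] next k
  have hW : ∀ k, Good k (W k) := by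
    intro k
    induction k with
    | zero =>
      simp only [Good, hx0, Nat.mul_zero]
      exact hc
    | succ k ih => exact (hnext k _ ih).2.1
  have mono : ∀ k l, k ≤ l → W k <+: W l := fun k l hkl => by
    induction l, hkl using Nat.le_induction with
    | base => exact List.prefix_rfl
    | succ l _ ih => exact ih.trans (hnext l _ (hW l)).1
  refine IsPartialIso.nonempty_equiv (T := {p | ∃ k, p ∈ W k}) ?_ ?_ ?_
  · intro l hl
    obtain ⟨k, hk⟩ : ∃ k, l ⊆ W k := by
      induction l with
      | nil => exact ⟨0, List.nil_subset _⟩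
      | cons p l ih =>
        obtain ⟨k, hk⟩ := ih fun q hq => hl q (List.mem_cons_of_mem _ hq)
        obtain ⟨k', hk'⟩ := hl p List.mem_cons_self
        exact ⟨max k k', List.cons_subset.2 ⟨(mono _ _ (le_max_right _ _)).subset hk',
          List.Subset.trans hk (mono _ _ (le_max_left _ _)).subset⟩⟩
    -- The list made at step `max k K` passes the tests below that bound, which include those below
    -- `K`.
    refine ⟨W k, hk, fun K => ⟨W (max k K + 1),
      mono _ _ ((le_max_left k K).trans (Nat.le_succ _)), ?_⟩⟩
    exact (hnext _ _ (hW (max k K))).2.2.2.2.mono (le_max_right _ _)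
  · intro a
    obtain ⟨c, hc⟩ := (hnext _ _ (hW a.1)).2.2.1 a rfl
    exact ⟨c, a.1 + 1, hc⟩
  · intro a
    obtain ⟨c, hc⟩ := (hnext _ _ (hW a.1)).2.2.2.1 a rfl
    exact ⟨c, a.1 + 1, hc⟩

/-- Initial segments of a path descend, because in the Kleene-Brouwer order an extension precedes
what it extends. -/
theorem levelLT_kbIndex {e : ℕ} (hF : Avoids e F) :
    LevelLT (kbIndex e) (Encodable.encode (initSeg F 0)) 0 ∧
      ∀ k, LevelLT (kbIndex e) (Encodable.encode (initSeg F (k + 1)))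
        (Encodable.encode (initSeg F k) + 1) := by
  have hT := avoids_iff_inTree.1 hF
  refine ⟨⟨by simp [phi_kbIndex_zero, hT], Or.inl rfl⟩, fun k =>
    ⟨by simp [phi_kbIndex_zero, hT], Or.inr ?_⟩⟩
  have : KB (initSeg F (k + 1)) (initSeg F k) := by
    rw [initSeg_succ]
    exact kb_append_singleton _ _
  simp [phi_kbIndex_zero, phi_kbIndex_one, hT, this]

/-- The recursion theorem: a class may be defined by conditions that refer to its own index. -/
theorem exists_avoids_eq {g : ℕ → ℕ} (hg : Computable g) :
    ∃ e, ∀ F, Avoids e F ↔ Avoids (g e) F := by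
  obtain ⟨c, hc⟩ := Nat.Partrec.Code.fixed_point
    (f := fun c => Denumerable.ofNat _ (g (Encodable.encode c)))
    ((Computable.ofNat _).comp (hg.comp Computable.encode))
  refine ⟨Encodable.encode c, fun F => ?_⟩
  have : phi (g (Encodable.encode c)) = phi (Encodable.encode c) := by
    rw [phi, phi, hc, Denumerable.ofNat_encode]
  rw [Avoids, Avoids, this]

theorem nonempty_equiv_of_backForthLE (hA : IsComputableStructure A)
    (hB : IsComputableStructure B)
    (h : BackForthLE S.lang omegaOneCK A B (Fin.elim0 : Fin 0 → A) (Fin.elim0 : Fin 0 → B)) :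
    Nonempty (A ≃[S.lang] B) := by
  obtain ⟨i, hi⟩ := hA
  obtain ⟨j, hj⟩ := hB
  obtain ⟨g1, hg1, h1⟩ := exists_avoids_goodResponses
  obtain ⟨g2, h2⟩ := exists_avoids_claims_nil
  obtain ⟨g, hg, hge⟩ := exists_avoids_and
    (hg1.comp (computable_kbIndex.pair (Computable.const (i, j)))) (Computable.const g2)
  obtain ⟨e, he⟩ := exists_avoids_eq hg
  simp only [hge, h1, h2] at he
  -- Emptiness refutes itself: it would make the order of levels a computable well-order, along
  -- which the back-and-forth relation provides a strategy, that is, a member of the class.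
  have hex : ∃ F, Avoids e F := by
    by_contra hne
    obtain ⟨β, hβ⟩ := exists_codesOrdinal_kbIndex hne
    have hlt : β < omegaOneCK := IsComputableOrdinal.lt_omegaOneCK ⟨_, hβ⟩
    obtain ⟨lev, hlev, rfl⟩ := hβ.exists_isLevelMap
    obtain ⟨F, -, hF, hcl⟩ := exists_goodResponses S i j hlev id
    refine hne ⟨F, (he F).2 ⟨hF, hcl _ ⟨A, B, hi, hj, 0, Fin.elim0, Fin.elim0, by simp, by simp,
      fun _ => (h.piLE ?_).mono hlt.le⟩⟩⟩
    exact (pos_of_gt hlt).ne'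
  obtain ⟨F, hF⟩ := hex
  obtain ⟨hy0, hy⟩ := levelLT_kbIndex hF
  obtain ⟨h3, h4⟩ := (he F).1 hF
  exact nonempty_equiv_of_claims hi hj h3 h4 (y := fun k => Encodable.encode (initSeg F k)) hy0 hy

end Collegiate
end

theorem mainTheorem5 :
    (∀ α : Ordinal.{0}, Collegiate.IsComputableOrdinal α →
      ∀ d : TuringDegree, d ∈ Set.range Collegiate.degreeOf →
        [Collegiate.IsCollegiate α d,
          Collegiate.IsComputablyCollegiate d,
          Collegiate.HighForIsomorphism d].TFAE ∧
        [Collegiate.UniformlyCollegiate α d,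
          Collegiate.LevelwiseUniformlyCollegiate α d,
          Collegiate.UniformlyComputablyCollegiate d,
          ∀ γ : Ordinal.{0}, Collegiate.IsComputableOrdinal γ →
            Collegiate.UniformlyCollegiate γ d,
          ∀ γ : Ordinal.{0}, Collegiate.IsComputableOrdinal γ →
            Collegiate.LevelwiseUniformlyCollegiate γ d,
          Collegiate.UniformlyHighForIsomorphism d].TFAE) ∧
    (∀ (S : Collegiate.Signature) (A B : Collegiate.NatStructure S),
      Collegiate.IsComputableStructure A → Collegiate.IsComputableStructure B →
      Collegiate.BackForthEquiv S.lang Collegiate.omegaOneCK A B →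
      Nonempty (A ≃[S.lang] B)) := by
  refine ⟨fun α hα d _ => ⟨?_, ?_⟩, fun S A B hA hB h =>
    Collegiate.nonempty_equiv_of_backForthLE hA hB h.1⟩
  -- Both cycles pass through the computation of members of Π⁰₁ classes, which mentions neither `α`
  -- nor structures.
  · tfae_have 1 → 3 := fun h => h.computesPaths.highForIsomorphism
    tfae_have 3 → 2 := fun h γ hγ => h.computesPaths.isCollegiate hγ
    tfae_have 2 → 1 := fun h => h α hα
    tfae_finish
  · tfae_have 1 → 2 := fun h => h.levelwiseUniformlyCollegiate hα
    tfae_have 2 → 6 := fun h => h.uniformlyComputesPaths.uniformlyHighForIsomorphism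
    tfae_have 6 → 3 := fun h => h.uniformlyComputesPaths.uniformlyComputablyCollegiate
    tfae_have 3 → 4 := fun h γ _ => h.uniformlyCollegiate γ
    tfae_have 4 → 5 := fun h γ hγ => (h γ hγ).levelwiseUniformlyCollegiate hγ
    tfae_have 5 → 2 := fun h => h α hα
    tfae_have 4 → 1 := fun h => h α hα
    tfae_finish
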